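/- **Setting.** Fix an integer $q\ge 1$ and $\sigma_0>0$. For each $n$ put $j_{\min}=(n/\log n)^{1/(2q+1)}$, let $j_{\max}=j_{\max,n}\in\mathbb N$ satisfy $j_{\min}\le j_{\max}$ for all large $n$ and $j_{\max}=o(n/\log n)$, and let $\mathcal J=[j_{\min},j_{\max}]\cap\mathbb N$. A partition $\mathcal T=\{0=t_0<t_1<\dots<t_{N+1}=1\}$ ($N\ge 0$) is quasi-uniform if $\max_k(t_k-t_{k-1})\le\rho\min_k(t_k-t_{k-1})$, where $\rho$ is a fixed constant; $\mathbb T$ is the set of all such partitions and $\Delta_{\mathcal T}=\max_k(t_k-t_{k-1})$. $\mathcal P_q(\mathcal T)$ is the space of polynomial splines of order $q$ (piecewise of degree $\le q-1$ and, if $q\ge2$, $C^{q-2}$) with knots in $\mathcal T$. For each $n$ and $J$ let $b_{J,q}(x)\in\mathbb R^J$ be the vector of normalised B-splines of order $q$ on a partition in $\mathbb T$ with $J-q$ interior knots. The covariates $X_1,\dots,X_n\in[0,1]$ (which may depend on $n$) have empirical distribution function $F_n$ with $\sup_{x\in[0,1]}|F_n(x)-F(x)|=o(1/j_{\max})$,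 where $F$ is a fixed distribution function with a positive continuous density on $[0,1]$. Let $B$ be the $n\times J$ matrix with rows $b_{J,q}(X_i)^T$. The prior is $f=b_{J,q}^T\theta$, $\theta\mid\sigma\sim N_J(\eta,\sigma^2\Omega)$, where $\|\eta\|_\infty$ is bounded, the eigenvalues of the symmetric matrix $\Omega$ lie in $[c_1,c_2]$ with $0<c_1\le c_2$, and $\Omega^{-1}$ is $r$-banded ($(\Omega^{-1})_{ij}=0$ for $|i-j|>r$); the bound on $\eta$ and $c_1,c_2,r$ do not depend on $n,J$. Put $$\mathrm E_J[f(x)\mid Y]=b_{J,q}(x)^T(B^TB+\Omega^{-1})^{-1}(B^TY+\Omega^{-1}\eta),\qquad \widehat\sigma_J^2=n^{-1}(Y-B\eta)^T(B\Omega B^T+I)^{-1}(Y-B\eta),$$ $$\widehat j_n=\min\Big\{j\in\mathcal J:\ \|\mathrm E_j(f\mid Y)-\mathrm E_i(f\mid Y)\|_\infty\le\tau\,\widehat\sigma_i\sqrt{i\log i/n}\ \text{ for all } i\in\mathcal J,\ i>j\Big\}.$$ Under $P_0$, $Y_i=f_0(X_i)+\varepsilon_i$ with $\varepsilon_i$ i.i.d.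 $N(0,\sigma_0^2)$. For $\alpha>0$ with integer part $[\alpha]$ let $$\|g\|_{\mathcal H^\alpha}=\max_{0\le k\le[\alpha]}\sup_{[0,1]}|g^{(k)}|+\sup_{x\ne y}\frac{|g^{([\alpha])}(x)-g^{([\alpha])}(y)|}{|x-y|^{\alpha-[\alpha]}},\qquad \mathcal H^\alpha(R)=\{g:[0,1]\to\mathbb R:\ \|g\|_{\mathcal H^\alpha}\le R\},$$ and, for $\delta>0$, let $$\mathcal F^\alpha=\bigcap_{\mathcal T\in\mathbb T}\Big\{f:\ \inf_{p\in\mathcal P_q(\mathcal T)}\|f-p\|_\infty\ge\delta\,\|f\|_{\mathcal H^\alpha}\Delta_{\mathcal T}^\alpha\Big\}.$$ The oracle index is $j_n^*=j_n^*(f_0,\alpha)=\min\{j\in\mathcal J:\|f_0\|_{\mathcal H^\alpha}j^{-\alpha}\le\sqrt{j\log j/n}\}$, with $j_n^*=j_{\max}$ if there is no such $j$. **Lemma 5.3.** There is $\tau_0>0$ such that for every $\tau\ge\tau_0$ and every $\delta>0$ there are integers $\kappa=\kappa(\alpha)\ge1$, $\alpha>0$ (depending, in the fixed setting above, only on $\delta,\alpha,\tau$),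 such that the following holds for every $R>0$. 1. There are constants $\mu>1$, $Q>0$, $C>0$ such that for all sufficiently large $n$, all $\alpha\in(0,q]$ and all $f_0\in\mathcal H^\alpha(R)\cap\mathcal F^\alpha$, $$P_0\big(\widehat j_n<j_n^*/\kappa(\alpha)\big)\le C\Big(\frac1{j_{\min}^{\mu-1}}+j_n^*e^{-Qj_n^*}\Big).$$ 2. As $n\to\infty$, $$\inf_{0<\alpha\le q}\ \inf_{f_0\in\mathcal H^\alpha(R)\cap\mathcal F^\alpha}P_0\big(j_n^*/\kappa(\alpha)\le\widehat j_n\le j_n^*\big)\to1.$$ -/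

import Mathlib

open Set Filter Topology MeasureTheory ProbabilityTheory
open scoped Matrix ENNReal

namespace BayesLepski

noncomputable section

/-! ### Knot partitions, polynomial splines, B-splines -/

/-- A partition `0 = t_0 < t_1 < ⋯ < t_N < t_{N+1} = 1` of `[0,1]` with `N` interior knots. -/
structure KnotPartition (N : ℕ) where
  t : Fin (N + 2) → ℝ
  strictMono : StrictMono t
  first : t 0 = 0
  last : t (Fin.last (N + 1)) = 1

/-- The knot increment `t_{k+1} - t_k`. -/
def KnotPartition.gap {N : ℕ} (T : KnotPartition N) (k : Fin (N + 1)) : ℝ :=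
  T.t k.succ - T.t k.castSucc

/-- The maximal knot increment `Δ_T`. -/
def KnotPartition.mesh {N : ℕ} (T : KnotPartition N) : ℝ := ⨆ k, T.gap k

/-- Quasi-uniformity with constant `ρ`: the largest increment is at most `ρ` times the smallest. -/
def KnotPartition.QuasiUniform {N : ℕ} (ρ : ℝ) (T : KnotPartition N) : Prop :=
  ∀ k l, T.gap k ≤ ρ * T.gap l

/-- The space of polynomial splines of order `q` (degree `< q`) with (simple) knots in `T`:
functions on `[0,1]` which are a polynomial of degree `< q` on each knot interval (intervals are
closed on the left, and the last one is closed), with `q - 2` continuous derivatives on `[0,1]`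
(no continuity is asked when `q = 1`). -/
def splineSpace (q : ℕ) {N : ℕ} (T : KnotPartition N) : Set (ℝ → ℝ) :=
  {p | (∀ k : Fin (N + 1), ∃ P : Polynomial ℝ, P.degree < q ∧
          (∀ x ∈ Ico (T.t k.castSucc) (T.t k.succ), p x = P.eval x) ∧
          (k = Fin.last N → p 1 = P.eval 1)) ∧
       (2 ≤ q → ContDiffOn ℝ ((q - 2 : ℕ) : WithTop ℕ∞) p (Icc 0 1))}

/-- The knot sequence extended by `q`-fold end knots:
`s_0 = ⋯ = s_{q-1} = 0`, `s_{q-1+k} = t_k`, and `s_i = 1` for all `i ≥ N + q`. -/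
def KnotPartition.extended (q : ℕ) {N : ℕ} (T : KnotPartition N) (i : ℕ) : ℝ :=
  T.t ⟨min (i - (q - 1)) (N + 1), by omega⟩

/-- B-splines by the Cox--de Boor recursion: `bspline s k i` is the `i`-th normalised B-spline of
order `k` on the knots `s` (a quotient with zero denominator is `0`, as usual). The last knot
interval is closed at the right end point `1`. -/
def bspline (s : ℕ → ℝ) : ℕ → ℕ → ℝ → ℝ
  | 0, _, _ => 0
  | 1, i, x =>
      open Classical in
      if (s i ≤ x ∧ x < s (i + 1)) ∨ (s i < s (i + 1) ∧ s (i + 1) = 1 ∧ x = 1) then 1 else 0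
  | m + 2, i, x =>
      (x - s i) / (s (i + m + 1) - s i) * bspline s (m + 1) i x
        + (s (i + m + 2) - x) / (s (i + m + 2) - s (i + 1)) * bspline s (m + 1) (i + 1) x

/-- The vector `b_{J,q}(x)` of the `J` B-splines of order `q` on a partition with `N = J - q`
interior knots (meaningful for `q ≤ J`). -/
def bvec (q J : ℕ) (T : KnotPartition (J - q)) (x : ℝ) : Fin J → ℝ :=
  fun j => bspline (T.extended q) q j x

/-! ### Hölder norm and the self-similar class -/

/-- The sup-norm on `[0,1]`, with values in `[0,∞]`. -/
def supENorm (g : ℝ → ℝ) : ℝ≥0∞ := ⨆ x ∈ Icc (0 : ℝ) 1, ENNReal.ofReal |g x|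

open Classical in
/-- The Hölder norm of order `α` on `[0,1]`, with `[α] = ⌊α⌋`:
`max_{0 ≤ k ≤ [α]} sup |g^(k)| + sup_{x ≠ y} |g^([α])(x) - g^([α])(y)| / |x - y|^(α - [α])`,
and `∞` if `g` is not `[α]` times differentiable on `[0,1]` (one-sidedly at the end points). -/
def holderENorm (α : ℝ) (g : ℝ → ℝ) : ℝ≥0∞ :=
  if ∀ k < ⌊α⌋₊, DifferentiableOn ℝ (iteratedDerivWithin k g (Icc 0 1)) (Icc 0 1) then
    (⨆ k ∈ Finset.range (⌊α⌋₊ + 1), supENorm (iteratedDerivWithin k g (Icc 0 1)))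
      + ⨆ x ∈ Icc (0 : ℝ) 1, ⨆ y ∈ Icc (0 : ℝ) 1, ⨆ _ : x ≠ y,
          ENNReal.ofReal (|iteratedDerivWithin ⌊α⌋₊ g (Icc 0 1) x
            - iteratedDerivWithin ⌊α⌋₊ g (Icc 0 1) y| / |x - y| ^ (α - ⌊α⌋₊))
  else ⊤

/-- The Hölder ball of radius `R`. -/
def holderBall (α R : ℝ) : Set (ℝ → ℝ) := {g | holderENorm α g ≤ ENNReal.ofReal R}

/-- The self-similar class: the sup-norm distance of `f` to the splines of order `q` on `T` is at
least `δ ‖f‖ Δ_T ^ α` for every partition `T` which is quasi-uniform with constant `ρ`. -/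
def selfSimilar (q : ℕ) (ρ δ α : ℝ) : Set (ℝ → ℝ) :=
  ⋂ (N : ℕ) (T : KnotPartition N) (_ : T.QuasiUniform ρ),
    {f | ENNReal.ofReal δ * holderENorm α f * ENNReal.ofReal (T.mesh ^ α)
          ≤ ⨅ p ∈ splineSpace q T, supENorm (f - p)}

/-! ### Candidate set, posterior mean, empirical Bayes variance, stopping rule -/

/-- `j_min = (n / log n)^(1/(2q+1))`. -/
def jmin (q n : ℕ) : ℝ := ((n : ℝ) / Real.log n) ^ ((1 : ℝ) / (2 * q + 1))

/-- The candidate set `[j_min, j_max] ∩ ℕ`. -/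
def candidates (q n jmax : ℕ) : Set ℕ := {j | jmin q n ≤ (j : ℝ) ∧ j ≤ jmax}

/-- The empirical distribution function of the covariates. -/
def empiricalCDF {n : ℕ} (X : Fin n → ℝ) (x : ℝ) : ℝ :=
  (n : ℝ)⁻¹ * ∑ i, (Iic x).indicator (fun _ => (1 : ℝ)) (X i)

/-- The B-spline basis matrix `B`, with rows `b_{J,q}(X_i)`. -/
def basisMatrix (q J : ℕ) {n : ℕ} (T : KnotPartition (J - q)) (X : Fin n → ℝ) :
    Matrix (Fin n) (Fin J) ℝ :=
  Matrix.of fun i => bvec q J T (X i)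

/-- The posterior mean
`E_J[f(x)|Y] = b(x)ᵀ (BᵀB + Ω⁻¹)⁻¹ (Bᵀ Y + Ω⁻¹ η)` for the prior `θ | σ ∼ N_J(η, σ² Ω)`. -/
def postMean (q J : ℕ) {n : ℕ} (T : KnotPartition (J - q)) (X : Fin n → ℝ) (η : Fin J → ℝ)
    (Ω : Matrix (Fin J) (Fin J) ℝ) (Y : Fin n → ℝ) (x : ℝ) : ℝ :=
  let B := basisMatrix q J T X
  bvec q J T x ⬝ᵥ ((Bᵀ * B + Ω⁻¹)⁻¹ *ᵥ (Bᵀ *ᵥ Y + Ω⁻¹ *ᵥ η))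

/-- The empirical Bayes estimate of the error standard deviation: the square root of
`n⁻¹ (Y - Bη)ᵀ (B Ω Bᵀ + I)⁻¹ (Y - Bη)`. -/
def sigmaHat (q J : ℕ) {n : ℕ} (T : KnotPartition (J - q)) (X : Fin n → ℝ) (η : Fin J → ℝ)
    (Ω : Matrix (Fin J) (Fin J) ℝ) (Y : Fin n → ℝ) : ℝ :=
  let B := basisMatrix q J T X
  Real.sqrt ((n : ℝ)⁻¹ * ((Y - B *ᵥ η) ⬝ᵥ ((B * Ω * Bᵀ + 1)⁻¹ *ᵥ (Y - B *ᵥ η))))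

/-- The sup-norm on `[0,1]` of a bounded function. -/
def supNorm (g : ℝ → ℝ) : ℝ := ⨆ x : Icc (0 : ℝ) 1, |g x|

/-- The Lepski index `ĵ_n`: the smallest `j ∈ 𝒥` such that
`‖E_j(f|Y) - E_i(f|Y)‖_∞ ≤ τ σ̂_i √(i log i / n)` for all `i ∈ 𝒥` with `i > j`. The minimum is over
a set that contains `j_max` as soon as `j_min ≤ j_max`. -/
def lepskiIndex (q : ℕ) {n : ℕ} (jmax : ℕ) (T : ∀ J, KnotPartition (J - q)) (X : Fin n → ℝ)
    (η : ∀ J, Fin J → ℝ) (Ω : ∀ J, Matrix (Fin J) (Fin J) ℝ) (τ : ℝ) (Y : Fin n → ℝ) : ℕ :=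
  sInf {j | j ∈ candidates q n jmax ∧ ∀ i ∈ candidates q n jmax, j < i →
    supNorm (fun x => postMean q j (T j) X (η j) (Ω j) Y x - postMean q i (T i) X (η i) (Ω i) Y x)
      ≤ τ * sigmaHat q i (T i) X (η i) (Ω i) Y * Real.sqrt (i * Real.log i / n)}

open Classical in
/-- The oracle index `j_n^*`: the smallest `j ∈ 𝒥` with
`‖f₀‖ j^(-α) ≤ √(j log j / n)`, and `j_max` if there is none. -/
def oracleIndex (q n jmax : ℕ) (α : ℝ) (f₀ : ℝ → ℝ) : ℕ :=
  let S : Set ℕ := {j | j ∈ candidates q n jmax ∧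
    (holderENorm α f₀).toReal * (j : ℝ) ^ (-α) ≤ Real.sqrt (j * Real.log j / n)}
  if S.Nonempty then sInf S else jmax

/-- The law `P_0` of `Y = (Y_1, …, Y_n)`, `Y_i = f₀(X_i) + ε_i` with `ε_i` i.i.d. `N(0, σ₀²)`. -/
def trueLaw {n : ℕ} (X : Fin n → ℝ) (f₀ : ℝ → ℝ) (σ₀ : ℝ) : Measure (Fin n → ℝ) :=
  Measure.pi fun i => gaussianReal (f₀ (X i)) (Real.toNNReal (σ₀ ^ 2))

end

end BayesLepski

/-! The argument is deterministic on one event of high probability. Write L for the Hölder norm of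
f₀ and r(J) for √(J log J / n). On the good event every candidate J satisfies ‖f₀ - E_J‖ ≤ K L
J^(-α) + (t + 1) r(J), and the empirical standard deviations satisfy σ₀/4 ≤ σ̂_J whenever that error
is at most σ₀/4, and σ̂_J ≤ 2σ₀ + O(L J^(-α)) always.

Upper bound on the selected index (`lepskiIndex_le_oracleIndex`): at and beyond the oracle index the
bias is at most the rate. Hence E_{j*} and E_i differ by at most 2(K + t + 1) r(i), which a large τ
turns into acceptance of j*.

Lower bound (`oracleIndex_div_le_lepskiIndex`): put x₀ = L j*^(-α). Minimality of j* gives r(j*) ≤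
2^(q+1) x₀. If j < j*/κ were selected, comparing E_j with E_{j*} would give ‖f₀ - E_j‖ ≤ Γ x₀. But
E_j is a spline on a partition of mesh at least 1/j, so self-similarity forces ‖f₀ - E_j‖ ≥ δ L
j^(-α) ≥ δ κ^α x₀. This is impossible once δ κ^α > Γ.

The error bound `PosteriorSetting.abs_sub_postMean_le` has three ingredients. Splines approximate at
rate J^(-α) with bounded coefficients (`ClampedKnots.exists_approx` and
`ClampedKnots.abs_coeff_le`). The posterior precision BᵀB + Ω⁻¹ is banded, with quadratic form of
order n/J by stability of the basis and the design condition. A Neumann series then bounds its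
inverse in the sup norm by a multiple of J/n (`abs_le_of_banded_mulVec_eq`), without a logarithmic
loss.

For the probability (`trueLaw_compl_goodEvent_le`), each posterior coefficient is a Gaussian linear
statistic of variance O(J/n). With t suitably large its tail is 2J^(-3), and summing over
coefficients and candidates gives O(1/jmin). Chebyshev's inequality controls ∑ εᵢ². So the failure
probability is O(1/jmin), which yields both claims with μ = 2. -/

namespace BayesLepski

noncomputable section

/-! ### Polynomial pieces of B-splines and local stability. -/

section Pieces

open Polynomial

/-- The polynomial which agrees with the B-spline `bspline s k i` on the knot interval
`[s m, s (m + 1))`. -/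
def piece (s : ℕ → ℝ) (m : ℕ) : ℕ → ℕ → ℝ[X]
  | 0, _ => 0
  | 1, i => if i = m then 1 else 0
  | k + 2, i =>
      C (s (i + k + 1) - s i)⁻¹ * ((X - C (s i)) * piece s m (k + 1) i)
        + C (s (i + k + 2) - s (i + 1))⁻¹ * ((C (s (i + k + 2)) - X) * piece s m (k + 1) (i + 1))

variable {s : ℕ → ℝ} {m : ℕ}

lemma piece_succ_succ (s : ℕ → ℝ) (m k i : ℕ) : piece s m (k + 2) i =
    C (s (i + k + 1) - s i)⁻¹ * ((X - C (s i)) * piece s m (k + 1) i)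
      + C (s (i + k + 2) - s (i + 1))⁻¹ * ((C (s (i + k + 2)) - X) * piece s m (k + 1) (i + 1)) :=
  rfl

lemma piece_eq_zero (s : ℕ → ℝ) (m k : ℕ) : ∀ i, m < i ∨ i + k ≤ m → piece s m k i = 0 := by
  induction k with
  | zero => intro i _; rfl
  | succ k ih =>
    cases k with
    | zero =>
      intro i hi
      simp only [piece]
      rw [if_neg (by omega)]
    | succ k =>
      intro i hi
      rw [piece_succ_succ, ih i (by omega), ih (i + 1) (by omega)]
      simp

lemma window_of_piece_ne_zero {k i : ℕ} (h : piece s m k i ≠ 0) : i ≤ m ∧ m < i + k := by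
  by_contra hc
  exact h (piece_eq_zero s m k i (by omega))

lemma knots_lt_of_window (hs : Monotone s) (hm : s m < s (m + 1)) {k i : ℕ} (h1 : i ≤ m)
    (h2 : m < i + k) : s i < s (i + k) :=
  (hs h1).trans_lt (hm.trans_le (hs h2))

lemma bspline_eq_piece (hs : Monotone s) (hs1 : ∀ i, s i ≤ 1) (hm : s m < s (m + 1)) {x : ℝ}
    (hx : (s m ≤ x ∧ x < s (m + 1)) ∨ (s (m + 1) = 1 ∧ x = 1)) (k : ℕ) :
    ∀ i, bspline s k i x = (piece s m k i).eval x := by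
  induction k with
  | zero => intro i; simp [bspline, piece]
  | succ k ih =>
    cases k with
    | zero =>
      intro i
      simp only [bspline, piece]
      by_cases him : i = m
      · subst him
        rw [if_pos rfl, if_pos]
        · simp
        · rcases hx with hx | hx
          · exact Or.inl hx
          · exact Or.inr ⟨hm, hx⟩
      · rw [if_neg him, if_neg]
        · simp
        · rintro (⟨h1, h2⟩ | ⟨h1, h2, h3⟩)
          · rcases hx with ⟨h4, h5⟩ | ⟨h4, h5⟩
            · rcases lt_or_gt_of_ne him with h | h
              · linarith [hs (show i + 1 ≤ m by omega)]
              · linarith [hs (show m + 1 ≤ i by omega)]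
            · linarith [hs1 (i + 1)]
          · rcases hx with ⟨h4, h5⟩ | ⟨h4, h5⟩
            · linarith [hs1 (m + 1)]
            · rcases lt_or_gt_of_ne him with h | h
              · linarith [hs (show i + 1 ≤ m by omega)]
              · linarith [hs (show m + 1 ≤ i by omega)]
    | succ k =>
      intro i
      rw [piece_succ_succ]
      simp only [bspline, eval_add, eval_mul, eval_C, eval_sub, eval_X, ← ih]
      ring

lemma degree_piece_lt (s : ℕ → ℝ) (m k : ℕ) : ∀ i, (piece s m k i).degree < k ∨ k = 0 := by
  induction k with
  | zero => intro i; exact Or.inr rfl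
  | succ k ih =>
    cases k with
    | zero =>
      intro i
      left
      simp only [piece]
      split_ifs
      · simp
      · simp
    | succ k =>
      intro i
      left
      have key : ∀ (c : ℝ) (P Q : ℝ[X]), P.natDegree ≤ 1 → (Q.degree < (k + 1 : ℕ)) →
          (C c * (P * Q)).degree < ((k + 1 + 1 : ℕ) : WithBot ℕ) := by
        intro c P Q hP hQ
        rw [degree_lt_iff_coeff_zero]
        intro n hn
        rw [coeff_C_mul]
        by_cases hQ0 : Q = 0
        · simp [hQ0]
        rw [← natDegree_lt_iff_degree_lt hQ0] at hQ
        rw [coeff_eq_zero_of_natDegree_lt, mul_zero]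
        exact lt_of_le_of_lt natDegree_mul_le (by omega)
      rw [piece_succ_succ]
      have h1 := (ih i).resolve_right (by omega)
      have h2 := (ih (i + 1)).resolve_right (by omega)
      refine lt_of_le_of_lt (degree_add_le _ _) (max_lt (key _ _ _ ?_ h1) (key _ _ _ ?_ h2))
      · exact natDegree_X_sub_C_le _
      · exact (natDegree_sub_le _ _).trans (by simp)

lemma eval_piece_nonneg (hs : Monotone s) {x : ℝ} (hx : s m ≤ x) (hx' : x ≤ s (m + 1)) (k : ℕ) :
    ∀ i, 0 ≤ (piece s m k i).eval x := by
  induction k with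
  | zero => intro i; simp [piece]
  | succ k ih =>
    cases k with
    | zero =>
      intro i
      simp only [piece]
      split_ifs <;> simp
    | succ k =>
      intro i
      rw [piece_succ_succ]
      simp only [eval_add, eval_mul, eval_C, eval_sub, eval_X]
      refine add_nonneg ?_ ?_
      · by_cases h : piece s m (k + 1) i = 0
        · simp [h]
        · obtain ⟨h1, h2⟩ := window_of_piece_ne_zero h
          exact mul_nonneg (inv_nonneg.2 (sub_nonneg.2 (hs (by omega))))
            (mul_nonneg (sub_nonneg.2 ((hs h1).trans hx)) (ih i))
      · by_cases h : piece s m (k + 1) (i + 1) = 0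
        · simp [h]
        · obtain ⟨h1, h2⟩ := window_of_piece_ne_zero h
          exact mul_nonneg (inv_nonneg.2 (sub_nonneg.2 (hs (by omega))))
            (mul_nonneg (sub_nonneg.2 (hx'.trans (hs (by omega)))) (ih (i + 1)))

/-- Index shift for summation by parts; the boundary terms vanish in the uses below because the
extreme basis functions do not reach the interval considered. -/
lemma sum_range_shift {M : Type*} [AddCommGroup M] (F : ℕ → M) (L : ℕ) (h0 : F 0 = 0)
    (hL : F L = 0) : ∑ i ∈ Finset.range L, F (i + 1) = ∑ i ∈ Finset.range L, F i := by
  have h1 := Finset.sum_range_succ F L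
  have h2 := Finset.sum_range_succ' F L
  rw [h1, h0, hL] at h2
  simpa using h2.symm

/-- After an index shift the two recursion weights falling on the same lower-order piece add up to
1. The bound on the order ensures that the shifted boundary piece of index 0 vanishes on the
interval. -/
lemma sum_piece (hs : Monotone s) (hm : s m < s (m + 1)) {L : ℕ} (hL : m < L) (k : ℕ)
    (hk : k ≤ m) : ∑ i ∈ Finset.range L, piece s m (k + 1) i = 1 := by
  induction k with
  | zero =>
    simp only [piece]
    rw [Finset.sum_ite_eq', if_pos (Finset.mem_range.2 hL)]
  | succ k ih =>
    rw [← ih (by omega)]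
    simp_rw [piece_succ_succ]
    rw [Finset.sum_add_distrib]
    have := sum_range_shift (fun i => C (s (i + k + 1) - s i)⁻¹ * ((C (s (i + k + 1)) - X) *
      piece s m (k + 1) i)) L (by rw [piece_eq_zero s m (k + 1) 0 (by omega)]; simp)
      (by rw [piece_eq_zero s m (k + 1) L (by omega)]; simp)
    have e : ∀ i, i + 1 + k + 1 = i + k + 2 := fun i => by ring
    simp only [e] at this
    rw [this, ← Finset.sum_add_distrib]
    refine Finset.sum_congr rfl fun i _ => ?_
    by_cases h : piece s m (k + 1) i = 0
    · simp [h]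
    · obtain ⟨h1, h2⟩ := window_of_piece_ne_zero h
      have h3 := knots_lt_of_window hs hm h1 h2
      have h4 : (C (s (i + k + 1) - s i)⁻¹ : ℝ[X]) * (C (s (i + k + 1)) - C (s i)) = 1 := by
        rw [← C_sub, ← C_mul, inv_mul_cancel₀, C_1]
        rw [add_assoc]; linarith
      linear_combination (piece s m (k + 1) i) * h4

/-- Induction on the order: differentiate the recursion, insert the formula for the lower order, and
recombine by the recursion one order further down. -/
lemma derivative_piece (hs : Monotone s) (hm : s m < s (m + 1)) (k : ℕ) :
    ∀ i, derivative (piece s m (k + 1) i) =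
      C (k : ℝ) * (C (s (i + k) - s i)⁻¹ * piece s m k i
        - C (s (i + k + 1) - s (i + 1))⁻¹ * piece s m k (i + 1)) := by
  induction k with
  | zero =>
    intro i
    simp only [piece]
    split_ifs <;> simp
  | succ k ih =>
    intro i
    cases k with
    | zero =>
      rw [piece_succ_succ]
      simp only [derivative_add, derivative_mul, derivative_C, derivative_sub, derivative_X, ih]
      simp
      ring_nf
    | succ k =>
      rw [piece_succ_succ s m (k + 1)]
      simp only [derivative_add, derivative_mul, derivative_C, derivative_sub, derivative_X, ih]
      rw [piece_succ_succ s m k i, piece_succ_succ s m k (i + 1)]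
      have e1 : i + 1 + (k + 1) = i + k + 2 := by ring
      have e3 : i + 1 + k + 1 = i + k + 2 := by ring
      have e4 : i + 1 + k + 2 = i + k + 3 := by ring
      have e5 : i + (k + 1) = i + k + 1 := by ring
      have e8 : i + (k + 1 + 1) = i + k + 2 := by ring
      have e10 : i + 1 + 1 = i + 2 := by ring
      simp only [e1, e3, e4, e5, e8, e10]
      -- What the recursion does not match is a multiple of this difference. Where the piece is
      -- nonzero both knot spans contain the nondegenerate interval, so both products equal 1.
      have key : (C (s (i + k + 2) - s i)⁻¹ * (C (s (i + k + 2)) - C (s i))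
          - C (s (i + k + 3) - s (i + 1))⁻¹ * (C (s (i + k + 3)) - C (s (i + 1))) : ℝ[X])
          * piece s m (k + 1) (i + 1) = 0 := by
        by_cases h : piece s m (k + 1) (i + 1) = 0
        · rw [h, mul_zero]
        · obtain ⟨h1, h2⟩ := window_of_piece_ne_zero h
          have h3 : s i < s (i + k + 2) :=
            knots_lt_of_window (k := k + 2) hs hm (by omega) (by omega)
          have h4 : s (i + 1) < s (i + k + 3) := by
            have := knots_lt_of_window (i := i + 1) (k := k + 2) hs hm (by omega) (by omega)
            rwa [show i + 1 + (k + 2) = i + k + 3 by ring] at this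
          rw [← C_sub, ← C_sub, ← C_mul, ← C_mul, inv_mul_cancel₀ (by linarith),
            inv_mul_cancel₀ (by linarith), sub_self, zero_mul]
      push_cast
      simp only [C_add, C_1]
      linear_combination (-(C (k : ℝ) + 1) * C (s (i + k + 2) - s (i + 1))⁻¹) * key

/-- The derivative of a combination of B-splines of order `k + 1` in terms of those of order `k`. -/
lemma derivative_sum_piece (hs : Monotone s) (hm : s m < s (m + 1)) {L : ℕ} (hL : m < L) (k : ℕ)
    (hk : k ≤ m) (θ : ℕ → ℝ) :
    derivative (∑ i ∈ Finset.range L, C (θ i) * piece s m (k + 1) i) =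
      ∑ i ∈ Finset.range L,
        C (k * ((s (i + k) - s i)⁻¹ * (θ i - θ (i - 1)))) * piece s m k i := by
  have h := sum_range_shift (fun i => C (θ (i - 1)) * (C (s (i + k) - s i)⁻¹ * piece s m k i)) L
    (by rw [piece_eq_zero s m k 0 (by omega)]; simp)
    (by rw [piece_eq_zero s m k L (by omega)]; simp)
  simp only [Nat.add_sub_cancel] at h
  rw [derivative_sum]
  have e : ∀ i, derivative (C (θ i) * piece s m (k + 1) i) = C (k : ℝ) * (C (θ i) *
      (C (s (i + k) - s i)⁻¹ * piece s m k i)) - C (k : ℝ) * (C (θ i) *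
        (C (s (i + 1 + k) - s (i + 1))⁻¹ * piece s m k (i + 1))) := by
    intro i
    rw [derivative_C_mul, derivative_piece hs hm, show i + 1 + k = i + k + 1 by ring]
    ring
  rw [Finset.sum_congr rfl fun i _ => e i, Finset.sum_sub_distrib, ← Finset.mul_sum,
    ← Finset.mul_sum, h, Finset.mul_sum, Finset.mul_sum, ← Finset.sum_sub_distrib]
  refine Finset.sum_congr rfl fun i _ => ?_
  simp only [C_mul, C_sub]
  ring

/-- Stability of the B-spline basis on one knot interval: bounds at sufficiently many separated
points control the coefficients. -/
lemma abs_coeff_le_of_abs_eval_le (hs : Monotone s) (hm : s m < s (m + 1)) {L : ℕ} (hL : m < L)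
    {q : ℕ} {W d : ℝ} (hd : 0 < d) (hW : ∀ i k, i ≤ m → m < i + k → k ≤ q → s (i + k) - s i ≤ W)
    (k : ℕ) : ∀ (_ : k ≤ m) (_ : k + 1 ≤ q) (θ : ℕ → ℝ) (ε : ℝ) (x : ℕ → ℝ),
      (∀ l < 2 ^ k, x l ∈ Icc (s m) (s (m + 1))) → (∀ l, l + 1 < 2 ^ k → x l + d ≤ x (l + 1)) →
      (∀ l < 2 ^ k,
        |(∑ i ∈ Finset.range L, C (θ i) * piece s m (k + 1) i).eval (x l)| ≤ ε) →
      ∀ i, i ≤ m → m ≤ i + k → |θ i| ≤ (1 + 2 * q * W / d) ^ k * ε := by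
  induction k with
  | zero =>
    intro _ _ θ ε x _ _ hε i h1 h2
    obtain rfl : i = m := by omega
    have h := hε 0 (by norm_num)
    simp only [piece, mul_ite, mul_one, mul_zero] at h
    rw [Finset.sum_ite_eq', if_pos (Finset.mem_range.2 hL), eval_C] at h
    simpa using h
  | succ k ih =>
    intro hkm hkq θ ε x hx hxd hε i hi1 hi2
    set P : ℝ[X] := ∑ i ∈ Finset.range L, C (θ i) * piece s m (k + 1 + 1) i with hP
    have hε0 : 0 ≤ ε := (abs_nonneg _).trans (hε 0 (by positivity))
    have hW0 : 0 < W := by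
      have := hW m 1 le_rfl (by omega) (by omega)
      linarith
    have hpow : 2 ^ (k + 1) = 2 * 2 ^ k := by ring
    -- The mean value theorem on the pairs x (2l), x (2l+1) halves the number of points, whence 2 ^
    -- k points for order k + 1. The new points stay `d`-separated because a full old gap lies
    -- between consecutive pairs.
    have hmvt : ∀ l, ∃ y, l < 2 ^ k → x (2 * l) < y ∧ y < x (2 * l + 1) ∧
        |(derivative P).eval y| ≤ 2 * ε / d := by
      intro l
      by_cases hl : l < 2 ^ k
      · have hlt := hxd (2 * l) (by omega)
        obtain ⟨y, hy, hy'⟩ := exists_hasDerivAt_eq_slope (fun z => P.eval z)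
          (fun z => (derivative P).eval z) (show x (2 * l) < x (2 * l + 1) by linarith)
          P.continuous.continuousOn (fun z _ => P.hasDerivAt z)
        refine ⟨y, fun _ => ⟨hy.1, hy.2, ?_⟩⟩
        rw [hy', abs_div, abs_of_pos (show 0 < x (2 * l + 1) - x (2 * l) by linarith)]
        have h3 := abs_sub (P.eval (x (2 * l + 1))) (P.eval (x (2 * l)))
        have h1 := hε (2 * l + 1) (by omega)
        have h2 := hε (2 * l) (by omega)
        exact div_le_div₀ (by positivity) (by linarith) hd (by linarith)
      · exact ⟨0, fun h => absurd h hl⟩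
    choose y hy using hmvt
    have hih := ih (by omega) (by omega)
      (fun i => ((k + 1 : ℕ) : ℝ) * ((s (i + (k + 1)) - s i)⁻¹ * (θ i - θ (i - 1)))) (2 * ε / d) y
      (fun l hl => by
        obtain ⟨h1, h2, _⟩ := hy l hl
        exact ⟨(hx (2 * l) (by omega)).1.trans h1.le, h2.le.trans (hx (2 * l + 1) (by omega)).2⟩)
      (fun l hl => by
        obtain ⟨_, h2, _⟩ := hy l (by omega)
        obtain ⟨h1, _, _⟩ := hy (l + 1) hl
        have := hxd (2 * l + 1) (by omega)
        rw [show 2 * l + 1 + 1 = 2 * (l + 1) by ring] at this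
        linarith)
      (fun l hl => by
        rw [← derivative_sum_piece hs hm hL (k + 1) (by omega) θ]
        exact (hy l hl).2.2)
    set A := 1 + 2 * q * W / d with hA
    have hA1 : 1 ≤ A := by
      have : 0 ≤ 2 * q * W / d := by positivity
      linarith
    -- The coefficients of the derivative are scaled differences of neighbouring coefficients, so
    -- the induction hypothesis bounds these differences.
    have hstep : ∀ i, i ≤ m → m ≤ i + k → |θ i - θ (i - 1)| ≤ A ^ k * (2 * ε / d) * W := by
      intro i h1 h2
      have h3 := hih i h1 h2
      have h4 := knots_lt_of_window (k := k + 1) hs hm h1 (by omega)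
      have h5 := hW i (k + 1) h1 (by omega) (by omega)
      rw [abs_mul, abs_mul, abs_inv, abs_of_pos (sub_pos.2 h4), Nat.abs_cast] at h3
      have h6 : (s (i + (k + 1)) - s i)⁻¹ * |θ i - θ (i - 1)| ≤ A ^ k * (2 * ε / d) := by
        refine le_trans ?_ h3
        have : (1 : ℝ) ≤ ((k + 1 : ℕ) : ℝ) := by exact_mod_cast Nat.succ_le_succ (Nat.zero_le k)
        exact le_mul_of_one_le_left (mul_nonneg (inv_nonneg.2 (sub_pos.2 h4).le) (abs_nonneg _))
          this
      rw [inv_mul_le_iff₀ (sub_pos.2 h4)] at h6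
      refine h6.trans ?_
      rw [mul_comm]
      exact mul_le_mul_of_nonneg_left h5 (by positivity)
    set E := A ^ k * (2 * ε / d) * W with hE
    have hE0 : 0 ≤ E := by positivity
    have hchain : ∀ c i, i + c ≤ m → m ≤ i + k + 1 → |θ (i + c) - θ i| ≤ c * E := by
      intro c
      induction c with
      | zero => intro i _ _; simp
      | succ c ihc =>
        intro i h1 h2
        have h3 := ihc i (by omega) h2
        have h4 := hstep (i + c + 1) (by omega) (by omega)
        rw [Nat.add_sub_cancel] at h4
        have h5 := abs_sub_le (θ (i + (c + 1))) (θ (i + c)) (θ i)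
        push_cast
        have e : i + (c + 1) = i + c + 1 := by ring
        rw [e] at h5 ⊢
        linarith
    have hpair : ∀ j, j ≤ m → m ≤ j + k + 1 → |θ i - θ j| ≤ ((k + 1 : ℕ) : ℝ) * E := by
      intro j h1 h2
      rcases le_total i j with h | h
      · obtain ⟨c, rfl⟩ := Nat.exists_eq_add_of_le h
        rw [abs_sub_comm]
        refine (hchain c i h1 (by omega)).trans (mul_le_mul_of_nonneg_right ?_ hE0)
        exact_mod_cast (by omega : c ≤ k + 1)
      · obtain ⟨c, rfl⟩ := Nat.exists_eq_add_of_le h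
        refine (hchain c j hi1 (by omega)).trans (mul_le_mul_of_nonneg_right ?_ hE0)
        exact_mod_cast (by omega : c ≤ k + 1)
    have hx0 := hx 0 (by positivity)
    have hsum : ∑ j ∈ Finset.range L, (piece s m (k + 1 + 1) j).eval (x 0) = 1 := by
      have := congrArg (eval (x 0)) (sum_piece hs hm hL (k + 1) hkm)
      rwa [eval_finsetSum, eval_one] at this
    have hval : P.eval (x 0) = ∑ j ∈ Finset.range L, θ j * (piece s m (k + 1 + 1) j).eval (x 0) := by
      rw [hP, eval_finsetSum]
      simp
    -- The value at x 0 is a convex combination of the coefficients active on the interval, and all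
    -- of these are close to one another.
    have hdiff : |θ i - P.eval (x 0)| ≤ ((k + 1 : ℕ) : ℝ) * E := by
      have e : θ i - P.eval (x 0) =
          ∑ j ∈ Finset.range L, (θ i - θ j) * (piece s m (k + 1 + 1) j).eval (x 0) := by
        simp_rw [sub_mul]
        rw [Finset.sum_sub_distrib, ← Finset.mul_sum, hsum, hval, mul_one]
      rw [e]
      calc |∑ j ∈ Finset.range L, (θ i - θ j) * (piece s m (k + 1 + 1) j).eval (x 0)|
          ≤ ∑ j ∈ Finset.range L, |(θ i - θ j) * (piece s m (k + 1 + 1) j).eval (x 0)| :=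
            Finset.abs_sum_le_sum_abs _ _
        _ ≤ ∑ j ∈ Finset.range L, (((k + 1 : ℕ) : ℝ) * E) *
              (piece s m (k + 1 + 1) j).eval (x 0) := by
            refine Finset.sum_le_sum fun j _ => ?_
            by_cases h : piece s m (k + 1 + 1) j = 0
            · simp [h]
            · obtain ⟨h1, h2⟩ := window_of_piece_ne_zero h
              have h0 := eval_piece_nonneg hs hx0.1 hx0.2 (k + 1 + 1) j
              rw [abs_mul, abs_of_nonneg h0]
              exact mul_le_mul_of_nonneg_right (hpair j h1 (by omega)) h0
        _ = ((k + 1 : ℕ) : ℝ) * E := by rw [← Finset.mul_sum, hsum, mul_one]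
    have hkq' : ((k + 1 : ℕ) : ℝ) ≤ q := by exact_mod_cast (by omega : k + 1 ≤ q)
    have hAk : 1 ≤ A ^ k := one_le_pow₀ hA1
    have h8 := hε 0 (by positivity)
    have h7 : |θ i| ≤ |θ i - P.eval (x 0)| + |P.eval (x 0)| := by
      have := abs_add_le (θ i - P.eval (x 0)) (P.eval (x 0))
      simpa using this
    have h9 : ((k + 1 : ℕ) : ℝ) * E ≤ q * E := mul_le_mul_of_nonneg_right hkq' hE0
    -- One more factor A = 1 + 2qW/d is exactly what pays for the oscillation q * E.
    have h10 : (A ^ (k + 1)) * ε = A ^ k * ε + q * E := by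
      rw [pow_succ, hE]
      nth_rewrite 2 [hA]
      field_simp
    have h11 : ε ≤ A ^ k * ε := le_mul_of_one_le_left hε0 hAk
    rw [h10]
    linarith

end Pieces

end

end BayesLepski


namespace BayesLepski

noncomputable section

/-! ### Splines on clamped knots: partition of unity, derivatives, smoothness. -/

section SplineFunctions

open Polynomial

/-- A knot sequence with `q`-fold knots at `0` and `1` and simple knots in between, for `J`
B-splines of order `q`. -/
structure ClampedKnots (q J : ℕ) (s : ℕ → ℝ) : Prop where
  one_le : 1 ≤ q
  le : q ≤ J
  mono : Monotone s
  zero : ∀ i < q, s i = 0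
  one : ∀ i, J ≤ i → s i = 1
  lt : ∀ m, q ≤ m + 1 → m < J → s m < s (m + 1)

/-- The spline `∑ i < J, θ i * B_{i,k}` of order `k`. -/
def splineFun (s : ℕ → ℝ) (J k : ℕ) (θ : ℕ → ℝ) (x : ℝ) : ℝ :=
  ∑ i ∈ Finset.range J, θ i * bspline s k i x

namespace ClampedKnots

variable {q J : ℕ} {s : ℕ → ℝ}

lemma nonneg (h : ClampedKnots q J s) (i : ℕ) : 0 ≤ s i := by
  rw [← h.zero 0 h.one_le]
  exact h.mono (Nat.zero_le i)

lemma le_one (h : ClampedKnots q J s) (i : ℕ) : s i ≤ 1 := by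
  rw [← h.one (max i J) (le_max_right _ _)]
  exact h.mono (le_max_left _ _)

lemma exists_right_interval (h : ClampedKnots q J s) {x : ℝ} (hx : x ∈ Ico (0 : ℝ) 1) :
    ∃ m, q ≤ m + 1 ∧ m < J ∧ s m < s (m + 1) ∧ s m ≤ x ∧ x < s (m + 1) := by
  have hex : ∃ i, x < s i := ⟨J, by rw [h.one J le_rfl]; exact hx.2⟩
  classical
  have h1 := Nat.find_spec hex
  have h2 : ¬ (Nat.find hex < q) := fun hlt => by
    rw [h.zero _ hlt] at h1
    linarith [hx.1]
  have h3 : Nat.find hex ≤ J := Nat.find_min' hex (by rw [h.one J le_rfl]; exact hx.2)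
  have h4 := h.one_le
  obtain ⟨m, hm⟩ : ∃ m, Nat.find hex = m + 1 := ⟨Nat.find hex - 1, by omega⟩
  have h5 : ¬ (x < s m) := Nat.find_min hex (by omega)
  rw [hm] at h1
  exact ⟨m, by omega, by omega, by linarith, not_lt.1 h5, h1⟩

lemma exists_interval (h : ClampedKnots q J s) {x : ℝ} (hx : x ∈ Icc (0 : ℝ) 1) :
    ∃ m, q ≤ m + 1 ∧ m < J ∧ s m < s (m + 1) ∧ s m ≤ x ∧ x ≤ s (m + 1) ∧
      ((s m ≤ x ∧ x < s (m + 1)) ∨ (s (m + 1) = 1 ∧ x = 1)) := by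
  rcases hx.2.lt_or_eq with hx1 | hx1
  · obtain ⟨m, h1, h2, h3, h4, h5⟩ := h.exists_right_interval ⟨hx.1, hx1⟩
    exact ⟨m, h1, h2, h3, h4, h5.le, Or.inl ⟨h4, h5⟩⟩
  · have h1 := h.one_le
    have h2 := h.le
    have h3 := h.lt (J - 1) (by omega) (by omega)
    have h4 : s (J - 1 + 1) = 1 := h.one _ (by omega)
    refine ⟨J - 1, by omega, by omega, h3, ?_, ?_, Or.inr ⟨h4, hx1⟩⟩
    · rw [hx1]; exact h.le_one _
    · rw [hx1, h4]

lemma splineFun_eq_eval (h : ClampedKnots q J s) {m : ℕ} (hm : s m < s (m + 1)) {x : ℝ}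
    (hx : (s m ≤ x ∧ x < s (m + 1)) ∨ (s (m + 1) = 1 ∧ x = 1)) (k : ℕ) (θ : ℕ → ℝ) :
    splineFun s J k θ x = (∑ i ∈ Finset.range J, C (θ i) * piece s m k i).eval x := by
  rw [splineFun, eval_finsetSum]
  simp_rw [eval_mul, eval_C, bspline_eq_piece h.mono h.le_one hm hx]

lemma bspline_nonneg (h : ClampedKnots q J s) (k i : ℕ) {x : ℝ} (hx : x ∈ Icc (0 : ℝ) 1) :
    0 ≤ bspline s k i x := by
  obtain ⟨m, _, _, hm, h1, h2, h3⟩ := h.exists_interval hx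
  rw [bspline_eq_piece h.mono h.le_one hm h3]
  exact eval_piece_nonneg h.mono h1 h2 k i

lemma sum_bspline (h : ClampedKnots q J s) {k : ℕ} (hk1 : 1 ≤ k) (hkq : k ≤ q) {x : ℝ}
    (hx : x ∈ Icc (0 : ℝ) 1) : ∑ i ∈ Finset.range J, bspline s k i x = 1 := by
  obtain ⟨m, hqm, hmJ, hm, h1, h2, h3⟩ := h.exists_interval hx
  simp_rw [bspline_eq_piece h.mono h.le_one hm h3]
  obtain ⟨k, rfl⟩ : ∃ k', k = k' + 1 := ⟨k - 1, by omega⟩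
  rw [← eval_finsetSum, sum_piece h.mono hm hmJ k (by omega), eval_one]

lemma bspline_support (h : ClampedKnots q J s) {k i : ℕ} {x : ℝ} (hx : x ∈ Icc (0 : ℝ) 1)
    (hne : bspline s k i x ≠ 0) : s i ≤ x ∧ x ≤ s (i + k) := by
  obtain ⟨m, _, _, hm, h1, h2, h3⟩ := h.exists_interval hx
  rw [bspline_eq_piece h.mono h.le_one hm h3] at hne
  obtain ⟨h4, h5⟩ := window_of_piece_ne_zero (s := s) (m := m) (k := k) (i := i)
    (fun h0 => hne (by rw [h0, eval_zero]))
  exact ⟨(h.mono h4).trans h1, h2.trans (h.mono h5)⟩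

/-- Two B-splines of order `k` overlap only if their indices differ by less than `k`. -/
lemma bspline_mul_eq_zero (h : ClampedKnots q J s) {k i j : ℕ} (hij : i + k ≤ j) {x : ℝ}
    (hx : x ∈ Icc (0 : ℝ) 1) : bspline s k i x * bspline s k j x = 0 := by
  obtain ⟨m, _, _, hm, h1, h2, h3⟩ := h.exists_interval hx
  simp_rw [bspline_eq_piece h.mono h.le_one hm h3]
  by_cases h4 : j ≤ m
  · rw [piece_eq_zero s m k i (by omega)]; simp
  · rw [piece_eq_zero s m k j (by omega)]; simp

lemma bspline_le_one (h : ClampedKnots q J s) {k i : ℕ} (hk1 : 1 ≤ k) (hkq : k ≤ q) (hi : i < J)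
    {x : ℝ} (hx : x ∈ Icc (0 : ℝ) 1) : bspline s k i x ≤ 1 := by
  rw [← h.sum_bspline hk1 hkq hx]
  exact Finset.single_le_sum (f := fun i => bspline s k i x)
    (fun j _ => h.bspline_nonneg k j hx) (Finset.mem_range.2 hi)

/-- A spline is, at every point, a convex combination of the coefficients of the B-splines
whose support contains that point. -/
lemma abs_sub_splineFun_le (h : ClampedKnots q J s) {k : ℕ} (hk1 : 1 ≤ k) (hkq : k ≤ q) {x : ℝ}
    (hx : x ∈ Icc (0 : ℝ) 1) (θ : ℕ → ℝ) (y ε : ℝ)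
    (hθ : ∀ i < J, s i ≤ x → x ≤ s (i + k) → |y - θ i| ≤ ε) :
    |y - splineFun s J k θ x| ≤ ε := by
  have e : y - splineFun s J k θ x =
      ∑ i ∈ Finset.range J, (y - θ i) * bspline s k i x := by
    simp_rw [sub_mul]
    rw [Finset.sum_sub_distrib, ← Finset.mul_sum, h.sum_bspline hk1 hkq hx, mul_one, splineFun]
  rw [e]
  refine (Finset.abs_sum_le_sum_abs _ _).trans ?_
  have : ∑ i ∈ Finset.range J, ε * bspline s k i x = ε := by
    rw [← Finset.mul_sum, h.sum_bspline hk1 hkq hx, mul_one]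
  rw [← this]
  refine Finset.sum_le_sum fun i hi => ?_
  have h0 := h.bspline_nonneg k i hx
  rw [abs_mul, abs_of_nonneg h0]
  by_cases hne : bspline s k i x = 0
  · simp [hne]
  · obtain ⟨h1, h2⟩ := h.bspline_support hx hne
    exact mul_le_mul_of_nonneg_right (hθ i (Finset.mem_range.1 hi) h1 h2) h0

lemma abs_splineFun_le (h : ClampedKnots q J s) {k : ℕ} (hk1 : 1 ≤ k) (hkq : k ≤ q) {x : ℝ}
    (hx : x ∈ Icc (0 : ℝ) 1) (θ : ℕ → ℝ) (ε : ℝ) (hθ : ∀ i < J, |θ i| ≤ ε) :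
    |splineFun s J k θ x| ≤ ε := by
  have := h.abs_sub_splineFun_le hk1 hkq hx θ 0 ε (fun i hi _ _ => by simpa using hθ i hi)
  simpa using this

/-- The coefficients of the derivative of a spline of order `k + 1`. -/
def _root_.BayesLepski.derivCoeff (s : ℕ → ℝ) (k : ℕ) (θ : ℕ → ℝ) (i : ℕ) : ℝ :=
  k * ((s (i + k) - s i)⁻¹ * (θ i - θ (i - 1)))

/-- Just to the right of a point the spline is a single polynomial, even at a knot. The two-sided
derivative is recovered later from continuity of this one. -/
lemma hasDerivWithinAt_splineFun_Ici (h : ClampedKnots q J s) {k : ℕ} (hk : k + 1 ≤ q)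
    (θ : ℕ → ℝ) {x : ℝ} (hx : x ∈ Ico (0 : ℝ) 1) :
    HasDerivWithinAt (splineFun s J (k + 1) θ) (splineFun s J k (derivCoeff s k θ) x) (Ici x) x := by
  obtain ⟨m, hqm, hmJ, hm, h1, h2⟩ := h.exists_right_interval hx
  rw [h.splineFun_eq_eval hm (Or.inl ⟨h1, h2⟩)]
  unfold derivCoeff
  rw [← derivative_sum_piece h.mono hm hmJ k (by omega) θ]
  refine (Polynomial.hasDerivAt _ x).hasDerivWithinAt.congr_of_eventuallyEq ?_
    (h.splineFun_eq_eval hm (Or.inl ⟨h1, h2⟩) _ _)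
  have h3 : ∀ᶠ y in 𝓝[≥] x, y < s (m + 1) :=
    mem_nhdsWithin_of_mem_nhds (Iio_mem_nhds h2)
  filter_upwards [h3, self_mem_nhdsWithin] with y hy hy'
  exact h.splineFun_eq_eval hm (Or.inl ⟨h1.trans hy', hy⟩) _ _

lemma bspline_two_eq (s : ℕ → ℝ) (i : ℕ) (x : ℝ) : bspline s 2 i x =
    (x - s i) / (s (i + 1) - s i) * bspline s 1 i x
      + (s (i + 2) - x) / (s (i + 2) - s (i + 1)) * bspline s 1 (i + 1) x := rfl

/-- Order 2 gives a hat function, written as a positive part of a minimum of linear functions. The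
four cases are whether each of its two knot spans is degenerate; a degenerate span leaves half a hat
at an end point, or zero. -/
lemma continuousOn_bspline_two (h : ClampedKnots q J s) (i : ℕ) :
    ContinuousOn (bspline s 2 i) (Icc 0 1) := by
  have hin : ∀ x ∈ Icc (0 : ℝ) 1, ∀ j, s j < s (j + 1) → s j ≤ x → x < s (j + 1) →
      ∀ l, bspline s 1 l x = if l = j then 1 else 0 := by
    intro x hx j hj h1 h2 l
    rw [bspline_eq_piece h.mono h.le_one hj (Or.inl ⟨h1, h2⟩)]
    simp only [piece]
    split_ifs <;> simp
  have hout : ∀ x ∈ Icc (0 : ℝ) 1, ∀ l, (x < s l ∨ s (l + 1) < x ∨ s l = s (l + 1)) →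
      bspline s 1 l x = 0 := by
    intro x hx l hl
    by_contra hne
    obtain ⟨h1, h2⟩ := h.bspline_support hx hne
    rcases hl with hl | hl | hl
    · linarith
    · linarith
    · obtain ⟨m, _, _, hm, _, _, h3⟩ := h.exists_interval hx
      rw [bspline_eq_piece h.mono h.le_one hm h3] at hne
      obtain ⟨h4, h5⟩ := window_of_piece_ne_zero (s := s) (m := m) (k := 1) (i := l)
        (fun h0 => hne (by rw [h0, eval_zero]))
      obtain rfl : l = m := by omega
      linarith
  have hone : ∀ l, s l < s (l + 1) → s (l + 1) = 1 → bspline s 1 l 1 = 1 := by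
    intro l h1 h2
    rw [bspline_eq_piece h.mono h.le_one h1 (Or.inr ⟨h2, rfl⟩)]
    simp [piece]
  have m1 := h.mono (Nat.le_succ i)
  have m2 := h.mono (Nat.le_succ (i + 1))
  simp only [Nat.succ_eq_add_one, add_assoc, Nat.reduceAdd] at m1 m2
  rcases m1.lt_or_eq with h1 | h1 <;> rcases m2.lt_or_eq with h2 | h2
  · have hc : ContinuousOn (fun x => max 0 (min ((x - s i) / (s (i + 1) - s i))
        ((s (i + 2) - x) / (s (i + 2) - s (i + 1))))) (Icc 0 1) := by fun_prop
    refine hc.congr fun x hx => ?_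
    have d1 : 0 < s (i + 1) - s i := by linarith
    have d2 : 0 < s (i + 2) - s (i + 1) := by linarith
    rw [bspline_two_eq]
    dsimp only
    rcases lt_or_ge x (s i) with g | g
    · rw [hout x hx i (Or.inl g), hout x hx (i + 1) (Or.inl (by linarith)), max_eq_left]
      · simp
      · exact (min_le_left _ _).trans (div_nonpos_of_nonpos_of_nonneg (by linarith) d1.le)
    rcases lt_or_ge x (s (i + 1)) with g' | g'
    · rw [hin x hx i h1 g g', hin x hx i h1 g g', if_pos rfl, if_neg (by omega), min_eq_left,
        max_eq_right (div_nonneg (by linarith) d1.le)]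
      · ring
      · have : 1 ≤ (s (i + 2) - x) / (s (i + 2) - s (i + 1)) := (one_le_div d2).2 (by linarith)
        exact le_trans ((div_le_one d1).2 (by linarith)) this
    have e1 : 1 ≤ (x - s i) / (s (i + 1) - s i) := (one_le_div d1).2 (by linarith)
    rcases lt_or_ge x (s (i + 2)) with g'' | g''
    · rw [hin x hx (i + 1) h2 g' g'', hin x hx (i + 1) h2 g' g'', if_pos rfl, if_neg (by omega),
        min_eq_right, max_eq_right (div_nonneg (by linarith) d2.le)]
      · ring
      · exact le_trans ((div_le_one d2).2 (by linarith)) e1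
    · rw [hout x hx i (Or.inr (Or.inl (by linarith))), max_eq_left]
      · rcases g''.lt_or_eq with g3 | g3
        · rw [hout x hx (i + 1) (Or.inr (Or.inl g3))]; simp
        · rw [g3]; simp
      · exact (min_le_right _ _).trans (div_nonpos_of_nonpos_of_nonneg (by linarith) d2.le)
  · have hc : ContinuousOn (fun x => max 0 ((x - s i) / (s (i + 1) - s i))) (Icc 0 1) := by
      fun_prop
    -- A double knot after a genuine span can only be the right end point; otherwise the half hat
    -- would jump.
    have hJ : s (i + 1) = 1 := by
      by_contra hne
      have hiJ : i + 1 < J := by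
        by_contra hge
        exact hne (h.one _ (by omega))
      have hiq : ¬ q ≤ i + 2 := fun hq' => by
        have := h.lt (i + 1) (by omega) hiJ
        simp only [add_assoc, Nat.reduceAdd] at this
        linarith
      rw [h.zero i (by omega), h.zero (i + 1) (by omega)] at h1
      exact lt_irrefl _ h1
    refine hc.congr fun x hx => ?_
    have d1 : 0 < s (i + 1) - s i := by linarith
    rw [bspline_two_eq, hout x hx (i + 1) (Or.inr (Or.inr h2)), mul_zero, add_zero]
    dsimp only
    rcases lt_or_ge x (s i) with g | g
    · rw [hout x hx i (Or.inl g), max_eq_left, mul_zero]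
      exact div_nonpos_of_nonpos_of_nonneg (by linarith) d1.le
    rw [max_eq_right (div_nonneg (by linarith) d1.le)]
    rcases lt_or_ge x (s (i + 1)) with g' | g'
    · rw [hin x hx i h1 g g', if_pos rfl, mul_one]
    · have : x = 1 := le_antisymm hx.2 (by linarith)
      rw [this, hone i h1 hJ, mul_one]
  · have hc : ContinuousOn (fun x => max 0 ((s (i + 2) - x) / (s (i + 2) - s (i + 1))))
        (Icc 0 1) := by fun_prop
    have h0 : s (i + 1) = 0 := by
      by_contra hne
      have hiq : q ≤ i + 1 := by
        by_contra hge
        exact hne (h.zero _ (by omega))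
      have hiJ : ¬ i < J := fun hJ' => by
        have := h.lt i (by omega) hJ'
        linarith
      rw [h.one (i + 1) (by omega), h.one (i + 2) (by omega)] at h2
      exact lt_irrefl _ h2
    refine hc.congr fun x hx => ?_
    have d2 : 0 < s (i + 2) - s (i + 1) := by linarith
    rw [bspline_two_eq, hout x hx i (Or.inr (Or.inr h1)), mul_zero, zero_add]
    dsimp only
    rcases lt_or_ge x (s (i + 2)) with g'' | g''
    · rw [hin x hx (i + 1) h2 (by linarith [hx.1]) g'', if_pos rfl,
        max_eq_right (div_nonneg (by linarith) d2.le), mul_one]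
    · rw [max_eq_left (div_nonpos_of_nonpos_of_nonneg (by linarith) d2.le)]
      rcases g''.lt_or_eq with g3 | g3
      · rw [hout x hx (i + 1) (Or.inr (Or.inl g3)), mul_zero]
      · rw [g3]; simp
  · refine (continuousOn_const (c := (0 : ℝ))).congr fun x hx => ?_
    rw [bspline_two_eq, hout x hx i (Or.inr (Or.inr h1)), hout x hx (i + 1) (Or.inr (Or.inr h2))]
    simp

lemma continuousOn_bspline (h : ClampedKnots q J s) (k : ℕ) :
    ∀ i, ContinuousOn (bspline s (k + 2) i) (Icc 0 1) := by
  induction k with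
  | zero => exact h.continuousOn_bspline_two
  | succ k ih =>
    intro i
    have h1 := ih i
    have h2 := ih (i + 1)
    have : bspline s (k + 1 + 2) i = fun x =>
      (x - s i) / (s (i + (k + 1) + 1) - s i) * bspline s (k + 2) i x
        + (s (i + (k + 1) + 2) - x) / (s (i + (k + 1) + 2) - s (i + 1)) *
          bspline s (k + 2) (i + 1) x := by
      funext x; rfl
    rw [this]
    fun_prop

lemma continuousOn_splineFun (h : ClampedKnots q J s) (k : ℕ) (θ : ℕ → ℝ) :
    ContinuousOn (splineFun s J (k + 2) θ) (Icc 0 1) := by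
  unfold splineFun
  have := h.continuousOn_bspline k
  fun_prop

/-- A continuous function with continuous right derivative g is its initial value plus the integral
of g, hence differentiable with derivative g from both sides. -/
lemma hasDerivWithinAt_splineFun (h : ClampedKnots q J s) {k : ℕ} (hk : k + 3 ≤ q)
    (θ : ℕ → ℝ) {x : ℝ} (hx : x ∈ Icc (0 : ℝ) 1) :
    HasDerivWithinAt (splineFun s J (k + 3) θ)
      (splineFun s J (k + 2) (derivCoeff s (k + 2) θ) x) (Icc 0 1) x := by
  set g := splineFun s J (k + 2) (derivCoeff s (k + 2) θ) with hg
  have hgc : ContinuousOn g (Icc 0 1) := h.continuousOn_splineFun k _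
  have hfc : ContinuousOn (splineFun s J (k + 3) θ) (Icc 0 1) :=
    h.continuousOn_splineFun (k + 1) _
  -- Extending g continuously to the whole line lets the fundamental theorem apply at the end points
  -- too.
  set G : ℝ → ℝ := IccExtend (zero_le_one (α := ℝ)) ((Icc 0 1).domRestrict g) with hG
  have hGc : Continuous G := (continuousOn_iff_continuous_domRestrict.1 hgc).Icc_extend'
  have hGg : ∀ y ∈ Icc (0 : ℝ) 1, G y = g y := fun y hy => by
    rw [hG, IccExtend_of_mem _ _ hy]; rfl
  have hF : ∀ y, HasDerivAt (fun y => ∫ z in (0 : ℝ)..y, G z) (G y) y := fun y =>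
    intervalIntegral.integral_hasDerivAt_right (hGc.intervalIntegrable _ _)
      (hGc.stronglyMeasurableAtFilter _ _) hGc.continuousAt
  have heq : ∀ y ∈ Icc (0 : ℝ) 1, splineFun s J (k + 3) θ y =
      (splineFun s J (k + 3) θ 0) + ∫ z in (0 : ℝ)..y, G z := by
    intro y hy
    have := intervalIntegral.integral_eq_sub_of_hasDeriv_right_of_le (a := 0) (b := y)
      (f := splineFun s J (k + 3) θ) (f' := G) hy.1
      (hfc.mono (Icc_subset_Icc_right hy.2)) (fun z hz => by
        have hz' : z ∈ Ico (0 : ℝ) 1 := ⟨hz.1.le, hz.2.trans_le hy.2⟩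
        rw [hGg z ⟨hz'.1, hz'.2.le⟩]
        exact (h.hasDerivWithinAt_splineFun_Ici (k := k + 2) (by omega) θ hz').mono
          Ioi_subset_Ici_self)
      (hGc.intervalIntegrable _ _)
    rw [this]; ring
  rw [← hGg x hx]
  exact (((hF x).const_add _).hasDerivWithinAt).congr heq (heq x hx)

lemma contDiffOn_splineFun (h : ClampedKnots q J s) (k : ℕ) : ∀ (_ : k + 2 ≤ q) (θ : ℕ → ℝ),
    ContDiffOn ℝ k (splineFun s J (k + 2) θ) (Icc 0 1) := by
  induction k with
  | zero =>
    intro hk θ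
    exact contDiffOn_zero.2 (h.continuousOn_splineFun 0 θ)
  | succ k ih =>
    intro hk θ
    have hu : UniqueDiffOn ℝ (Icc (0 : ℝ) 1) := uniqueDiffOn_Icc zero_lt_one
    have hd := fun x (hx : x ∈ Icc (0 : ℝ) 1) =>
      h.hasDerivWithinAt_splineFun (k := k) (by omega) θ hx
    push_cast
    rw [contDiffOn_succ_iff_derivWithin hu]
    refine ⟨fun x hx => (hd x hx).differentiableWithinAt, by simp, ?_⟩
    exact (ih (by omega) (derivCoeff s (k + 2) θ)).congr
      fun x hx => (hd x hx).derivWithin (hu x hx)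

end ClampedKnots

/-- The extended knot sequence of a partition is clamped. -/
lemma KnotPartition.clampedKnots {q J : ℕ} (hq : 1 ≤ q) (hJ : q ≤ J) (T : KnotPartition (J - q)) :
    ClampedKnots q J (T.extended q) where
  one_le := hq
  le := hJ
  mono := fun i j hij => T.strictMono.monotone (by
    rw [Fin.mk_le_mk]
    omega)
  zero := fun i hi => by
    rw [← T.first, extended]
    congr 1
    ext
    simp
    omega
  one := fun i hi => by
    rw [← T.last, extended]
    congr 1
    ext
    simp
    omega
  lt := fun m h1 h2 => T.strictMono (by
    rw [Fin.mk_lt_mk]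
    omega)

lemma KnotPartition.extended_add {q N : ℕ} (T : KnotPartition N) (k : ℕ) (hk : k < N + 2) :
    T.extended q (q - 1 + k) = T.t ⟨k, hk⟩ := by
  rw [extended]
  congr 1
  ext
  simp
  omega

lemma splineFun_mem_splineSpace {q J : ℕ} (hq : 1 ≤ q) (hJ : q ≤ J) (T : KnotPartition (J - q))
    (θ : ℕ → ℝ) : splineFun (T.extended q) J q θ ∈ splineSpace q T := by
  have h := T.clampedKnots hq hJ
  refine ⟨fun k => ?_, fun h2 => ?_⟩
  · have hk1 : T.extended q (q - 1 + k) = T.t k.castSucc :=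
      T.extended_add (k : ℕ) (by omega)
    have hk2 : T.extended q (q - 1 + k + 1) = T.t k.succ :=
      T.extended_add (k + 1 : ℕ) (by omega)
    have hm := h.lt (q - 1 + k) (by omega) (by omega)
    refine ⟨∑ i ∈ Finset.range J, C (θ i) * piece (T.extended q) (q - 1 + k) q i, ?_, ?_, ?_⟩
    · rw [← mem_degreeLT]
      refine Submodule.sum_mem _ fun i _ => ?_
      rw [← smul_eq_C_mul]
      exact Submodule.smul_mem _ _
        (mem_degreeLT.2 ((degree_piece_lt _ _ q i).resolve_right (by omega)))
    · intro x hx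
      rw [← hk1, ← hk2] at hx
      exact h.splineFun_eq_eval hm (Or.inl ⟨hx.1, hx.2⟩) q θ
    · intro hlast
      refine h.splineFun_eq_eval hm (Or.inr ⟨?_, rfl⟩) q θ
      rw [hk2, hlast, ← T.last]
      rfl
  · obtain ⟨k, rfl⟩ : ∃ k, q = k + 2 := ⟨q - 2, by omega⟩
    exact h.contDiffOn_splineFun k le_rfl θ

end SplineFunctions

end

end BayesLepski


namespace BayesLepski

noncomputable section

/-! ### Spline approximation of Hölder functions, and size of the coefficients. -/

section Approximation

variable {q J : ℕ} {s : ℕ → ℝ}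

/-- Take the value at the left end of each support as coefficient: the basis functions active at x
have their left knot within distance W of x. -/
lemma ClampedKnots.exists_approx_of_holder (h : ClampedKnots q J s) {W H β : ℝ} (hβ : 0 < β)
    (hH : 0 ≤ H) (hW : ∀ i k, k ≤ q → s (i + k) - s i ≤ W) {k : ℕ} (hk1 : 1 ≤ k) (hkq : k ≤ q)
    {g : ℝ → ℝ} (hg : ∀ x ∈ Icc (0 : ℝ) 1, ∀ y ∈ Icc (0 : ℝ) 1, |g x - g y| ≤ H * |x - y| ^ β) :
    ∃ θ, ∀ x ∈ Icc (0 : ℝ) 1, |g x - splineFun s J k θ x| ≤ H * W ^ β := by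
  refine ⟨fun i => g (s i), fun x hx => h.abs_sub_splineFun_le hk1 hkq hx _ _ _ ?_⟩
  intro i _ h1 h2
  refine (hg x hx (s i) ⟨h.nonneg i, h.le_one i⟩).trans ?_
  have := hW i k hkq
  rw [abs_of_nonneg (by linarith)]
  exact mul_le_mul_of_nonneg_left (Real.rpow_le_rpow (by linarith) (by linarith) hβ.le) hH

/-- Integrate the approximant of the derivative. The remainder is Lipschitz with constant ε, so
approximating it once more costs ε W instead of an accumulated global error. -/
lemma ClampedKnots.exists_approx_of_deriv (h : ClampedKnots q J s) {W : ℝ}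
    (hW : ∀ i k, k ≤ q → s (i + k) - s i ≤ W) {k : ℕ} (hk1 : 1 ≤ k) (hkq : k + 1 ≤ q)
    {g g' : ℝ → ℝ} (hg : ∀ x ∈ Icc (0 : ℝ) 1, HasDerivWithinAt g (g' x) (Icc 0 1) x) {ε : ℝ}
    {c : ℕ → ℝ} (hc : ∀ x ∈ Icc (0 : ℝ) 1, |g' x - splineFun s J k c x| ≤ ε) :
    ∃ θ, ∀ x ∈ Icc (0 : ℝ) 1, |g x - splineFun s J (k + 1) θ x| ≤ ε * W := by
  have hε : 0 ≤ ε := (abs_nonneg _).trans (hc 0 ⟨le_rfl, zero_le_one⟩)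
  -- Partial sums inverting the map from coefficients to derivative coefficients.
  set θ₀ : ℕ → ℝ := fun i => ∑ j ∈ Finset.range (i + 1), c j * (s (j + k) - s j) / k with hθ₀
  -- At index 0 truncated subtraction makes the difference 0. This is harmless: since k < q, the
  -- basis function of order k and index 0 vanishes on the unit interval.
  have hstep : ∀ i, i ≠ 0 → θ₀ i - θ₀ (i - 1) = c i * (s (i + k) - s i) / k := by
    intro i hi
    obtain ⟨i, rfl⟩ := Nat.exists_eq_succ_of_ne_zero hi
    simp only [hθ₀, Nat.succ_eq_add_one, Nat.add_sub_cancel]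
    rw [Finset.sum_range_succ]
    ring
  have hk0 : (k : ℝ) ≠ 0 := by positivity
  have hderiv : ∀ x ∈ Icc (0 : ℝ) 1,
      splineFun s J k (derivCoeff s k θ₀) x = splineFun s J k c x := by
    intro x hx
    unfold splineFun
    refine Finset.sum_congr rfl fun i _ => ?_
    by_cases hne : bspline s k i x = 0
    · rw [hne, mul_zero, mul_zero]
    · obtain ⟨m, hqm, hmJ, hm, h1, h2, h3⟩ := h.exists_interval hx
      rw [bspline_eq_piece h.mono h.le_one hm h3] at hne
      obtain ⟨h4, h5⟩ := window_of_piece_ne_zero (s := s) (m := m) (k := k) (i := i)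
        (fun h0 => hne (by rw [h0, Polynomial.eval_zero]))
      have h6 := knots_lt_of_window h.mono hm h4 h5
      have h7 : s (i + k) - s i ≠ 0 := by linarith
      congr 1
      rw [derivCoeff, hstep i (by omega)]
      field_simp
  set S := splineFun s J (k + 1) θ₀ with hS
  have hgc : ContinuousOn g (Icc 0 1) := fun x hx => (hg x hx).continuousWithinAt
  have hSc : ContinuousOn S (Icc 0 1) := by
    obtain ⟨k, rfl⟩ : ∃ k', k = k' + 1 := ⟨k - 1, by omega⟩
    exact h.continuousOn_splineFun k θ₀
  have hlip : ∀ x ∈ Icc (0 : ℝ) 1, ∀ y ∈ Icc (0 : ℝ) 1, x ≤ y →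
      |(g y - S y) - (g x - S x)| ≤ ε * (y - x) := by
    intro x hx y hy hxy
    have := norm_image_sub_le_of_norm_deriv_right_le_segment (f := fun z => g z - S z)
      (f' := fun z => g' z - splineFun s J k c z) (a := x) (b := y) (C := ε)
      ((hgc.sub hSc).mono (Icc_subset_Icc hx.1 hy.2)) (fun z hz => by
        have hz' : z ∈ Ico (0 : ℝ) 1 := ⟨hx.1.trans hz.1, hz.2.trans_le hy.2⟩
        have h1 := h.hasDerivWithinAt_splineFun_Ici hkq θ₀ hz'
        rw [hderiv z ⟨hz'.1, hz'.2.le⟩] at h1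
        have h2 : HasDerivWithinAt g (g' z) (Ici z) z :=
          (hg z ⟨hz'.1, hz'.2.le⟩).mono_of_mem_nhdsWithin (by
            filter_upwards [self_mem_nhdsWithin,
              mem_nhdsWithin_of_mem_nhds (Iio_mem_nhds hz'.2)] with w hw hw'
            exact ⟨hz'.1.trans hw, le_of_lt hw'⟩)
        exact h2.sub h1)
      (fun z hz => hc z ⟨hx.1.trans hz.1, hz.2.le.trans hy.2⟩) y ⟨hxy, le_rfl⟩
    simpa using this
  obtain ⟨θ₁, hθ₁⟩ := h.exists_approx_of_holder (H := ε) (β := 1) (W := W) (g := fun z => g z - S z)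
    (k := k + 1) one_pos hε hW (by omega) hkq (fun x hx y hy => by
      rw [Real.rpow_one]
      rcases le_total x y with hxy | hxy
      · rw [abs_sub_comm, abs_sub_comm x, abs_of_nonneg (sub_nonneg.2 hxy)]
        exact hlip x hx y hy hxy
      · rw [abs_of_nonneg (sub_nonneg.2 hxy)]
        exact hlip y hy x hx hxy)
  refine ⟨fun i => θ₀ i + θ₁ i, fun x hx => ?_⟩
  have h1 := hθ₁ x hx
  rw [Real.rpow_one] at h1
  have e : splineFun s J (k + 1) (fun i => θ₀ i + θ₁ i) x = S x + splineFun s J (k + 1) θ₁ x := by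
    simp only [hS, splineFun, add_mul, Finset.sum_add_distrib]
  rw [e, ← sub_sub]
  exact h1

/-- Each integration raises the order by one and gains one factor W. -/
lemma ClampedKnots.exists_approx_of_iterated_holder (h : ClampedKnots q J s) {W H β : ℝ}
    (hβ : 0 < β) (hH : 0 ≤ H) (hW : ∀ i k, k ≤ q → s (i + k) - s i ≤ W) {k : ℕ} (hk1 : 1 ≤ k)
    (m : ℕ) : ∀ (_ : k + m ≤ q) (g : ℕ → ℝ → ℝ),
      (∀ l < m, ∀ x ∈ Icc (0 : ℝ) 1, HasDerivWithinAt (g l) (g (l + 1) x) (Icc 0 1) x) →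
      (∀ x ∈ Icc (0 : ℝ) 1, ∀ y ∈ Icc (0 : ℝ) 1, |g m x - g m y| ≤ H * |x - y| ^ β) →
      ∃ θ, ∀ x ∈ Icc (0 : ℝ) 1, |g 0 x - splineFun s J (k + m) θ x| ≤ H * W ^ β * W ^ m := by
  induction m with
  | zero =>
    intro hk g _ hg
    simpa using h.exists_approx_of_holder hβ hH hW hk1 hk hg
  | succ m ih =>
    intro hk g hd hg
    obtain ⟨c, hc⟩ := ih (by omega) (fun l => g (l + 1)) (fun l hl => hd (l + 1) (by omega)) hg
    obtain ⟨θ, hθ⟩ := h.exists_approx_of_deriv hW (k := k + m) (by omega) hk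
      (hd 0 (by omega)) hc
    exact ⟨θ, fun x hx => (hθ x hx).trans_eq (by ring)⟩

lemma abs_le_of_supENorm_le {g : ℝ → ℝ} {L : ℝ} (hL : 0 ≤ L) (h : supENorm g ≤ ENNReal.ofReal L)
    {x : ℝ} (hx : x ∈ Icc (0 : ℝ) 1) : |g x| ≤ L := by
  have h1 : ENNReal.ofReal |g x| ≤ supENorm g :=
    le_iSup₂ (f := fun x (_ : x ∈ Icc (0 : ℝ) 1) => ENNReal.ofReal |g x|) x hx
  exact (ENNReal.ofReal_le_ofReal_iff hL).1 (h1.trans h)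

/-- What finiteness of the Hölder norm says in terms of the derivatives. -/
lemma exists_holder_data {α : ℝ} (hα : 0 < α) (hαq : α ≤ q) {f : ℝ → ℝ}
    (hf : holderENorm α f ≠ ⊤) :
    (∀ x ∈ Icc (0 : ℝ) 1, |f x| ≤ (holderENorm α f).toReal) ∧
    ∃ (m : ℕ) (β : ℝ), m + 1 ≤ q ∧ 0 < β ∧ (m : ℝ) + β = α ∧
      (∀ l < m, ∀ x ∈ Icc (0 : ℝ) 1, HasDerivWithinAt (iteratedDerivWithin l f (Icc 0 1))
        (iteratedDerivWithin (l + 1) f (Icc 0 1) x) (Icc 0 1) x) ∧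
      ∀ x ∈ Icc (0 : ℝ) 1, ∀ y ∈ Icc (0 : ℝ) 1,
        |iteratedDerivWithin m f (Icc 0 1) x - iteratedDerivWithin m f (Icc 0 1) y|
          ≤ (holderENorm α f).toReal * |x - y| ^ β := by
  set L := (holderENorm α f).toReal with hL
  have hL0 : 0 ≤ L := ENNReal.toReal_nonneg
  have hdiff : ∀ k < ⌊α⌋₊,
      DifferentiableOn ℝ (iteratedDerivWithin k f (Icc 0 1)) (Icc 0 1) := by
    by_contra hc
    exact hf (by rw [holderENorm, if_neg hc])
  have hval := ENNReal.ofReal_toReal hf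
  rw [← hL] at hval
  have hdef : holderENorm α f =
      (⨆ k ∈ Finset.range (⌊α⌋₊ + 1), supENorm (iteratedDerivWithin k f (Icc 0 1)))
      + ⨆ x ∈ Icc (0 : ℝ) 1, ⨆ y ∈ Icc (0 : ℝ) 1, ⨆ _ : x ≠ y,
          ENNReal.ofReal (|iteratedDerivWithin ⌊α⌋₊ f (Icc 0 1) x
            - iteratedDerivWithin ⌊α⌋₊ f (Icc 0 1) y| / |x - y| ^ (α - ⌊α⌋₊)) := by
    rw [holderENorm, if_pos hdiff]
  have hsup : ∀ k ≤ ⌊α⌋₊, ∀ x ∈ Icc (0 : ℝ) 1, |iteratedDerivWithin k f (Icc 0 1) x| ≤ L := by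
    intro k hk x hx
    refine abs_le_of_supENorm_le hL0 ?_ hx
    rw [hval, hdef]
    refine le_trans ?_ le_self_add
    exact le_iSup₂ (f := fun k (_ : k ∈ Finset.range (⌊α⌋₊ + 1)) =>
      supENorm (iteratedDerivWithin k f (Icc 0 1))) k (Finset.mem_range.2 (by omega))
  have hhol : ∀ x ∈ Icc (0 : ℝ) 1, ∀ y ∈ Icc (0 : ℝ) 1,
      |iteratedDerivWithin ⌊α⌋₊ f (Icc 0 1) x - iteratedDerivWithin ⌊α⌋₊ f (Icc 0 1) y|
        ≤ L * |x - y| ^ (α - ⌊α⌋₊) := by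
    intro x hx y hy
    rcases eq_or_ne x y with rfl | hxy
    · rw [sub_self, abs_zero]
      positivity
    · have hpos : 0 < |x - y| ^ (α - ⌊α⌋₊) := Real.rpow_pos_of_pos (abs_pos.2 (sub_ne_zero.2 hxy)) _
      rw [← div_le_iff₀ hpos]
      refine (ENNReal.ofReal_le_ofReal_iff hL0).1 ?_
      rw [hval, hdef]
      refine le_trans ?_ le_add_self
      exact le_iSup₂_of_le x hx (le_iSup₂_of_le y hy (le_iSup_of_le hxy le_rfl))
  have hder : ∀ k < ⌊α⌋₊, ∀ x ∈ Icc (0 : ℝ) 1,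
      HasDerivWithinAt (iteratedDerivWithin k f (Icc 0 1))
        (iteratedDerivWithin (k + 1) f (Icc 0 1) x) (Icc 0 1) x := by
    intro k hk x hx
    rw [iteratedDerivWithin_succ]
    exact (hdiff k hk x hx).hasDerivWithinAt
  refine ⟨fun x hx => by simpa using hsup 0 (Nat.zero_le _) x hx, ?_⟩
  have hfl := Nat.floor_le hα.le
  rcases hfl.lt_or_eq with hlt | heq
  · refine ⟨⌊α⌋₊, α - ⌊α⌋₊, ?_, by linarith, by ring, hder, hhol⟩
    have : (⌊α⌋₊ : ℝ) < q := hlt.trans_le hαq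
    exact_mod_cast this
  -- For integer α the top derivative is only known to be bounded in a useful way. So it is traded
  -- for a Lipschitz condition on the derivative of order α - 1, which also keeps m < q when α = q.
  · have h1 : 1 ≤ ⌊α⌋₊ := by
      by_contra hc
      have : ⌊α⌋₊ = 0 := by omega
      rw [this] at heq
      simp at heq
      linarith
    obtain ⟨m, hm⟩ : ∃ m, ⌊α⌋₊ = m + 1 := ⟨⌊α⌋₊ - 1, by omega⟩
    refine ⟨m, 1, ?_, one_pos, ?_, fun l hl => hder l (by omega), ?_⟩
    · have : ((m + 1 : ℕ) : ℝ) ≤ q := by rw [← hm, heq]; exact hαq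
      exact_mod_cast this
    · rw [← heq, hm]; push_cast; ring
    · intro x hx y hy
      rw [Real.rpow_one]
      have := Convex.norm_image_sub_le_of_norm_hasDerivWithin_le (C := L)
        (fun z hz => hder m (by omega) z hz)
        (fun z hz => hsup (m + 1) (by omega) z hz) (convex_Icc 0 1) hy hx
      simpa using this

/-- Splines of order `q` approximate a function of finite Hölder norm of order `α ≤ q`. -/
lemma ClampedKnots.exists_approx (h : ClampedKnots q J s) {W : ℝ} (hW0 : 0 < W)
    (hW : ∀ i k, k ≤ q → s (i + k) - s i ≤ W) {α : ℝ} (hα : 0 < α) (hαq : α ≤ q) {f : ℝ → ℝ}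
    (hf : holderENorm α f ≠ ⊤) :
    ∃ θ, ∀ x ∈ Icc (0 : ℝ) 1,
      |f x - splineFun s J q θ x| ≤ (holderENorm α f).toReal * W ^ α := by
  obtain ⟨-, m, β, hm, hβ, hmβ, hd, hh⟩ := exists_holder_data hα hαq hf
  obtain ⟨θ, hθ⟩ := h.exists_approx_of_iterated_holder hβ ENNReal.toReal_nonneg hW (k := q - m)
    (by omega) m (by omega) (fun l => iteratedDerivWithin l f (Icc 0 1)) hd hh
  refine ⟨θ, fun x hx => ?_⟩
  have h1 := hθ x hx
  rw [show q - m + m = q by omega, iteratedDerivWithin_zero, mul_assoc, ← Real.rpow_natCast,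
    ← Real.rpow_add hW0, add_comm β, hmβ] at h1
  exact h1

/-- Bound for the B-spline coefficients in terms of the size of the spline on `[0,1]`. -/
lemma ClampedKnots.abs_coeff_le (h : ClampedKnots q J s) {W w : ℝ} (hw : 0 < w) (hW0 : 0 ≤ W)
    (hW : ∀ i k, k ≤ q → s (i + k) - s i ≤ W)
    (hgap : ∀ m, q ≤ m + 1 → m < J → w ≤ s (m + 1) - s m) {θ : ℕ → ℝ} {ε : ℝ}
    (hε : ∀ x ∈ Icc (0 : ℝ) 1, |splineFun s J q θ x| ≤ ε) {i : ℕ} (hi : i < J) :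
    |θ i| ≤ (1 + 2 * q * W / (w / 2 ^ q)) ^ (q - 1) * ε := by
  have hq1 := h.one_le
  -- A nondegenerate knot interval in the support of the i-th basis function: the i-th one, or the
  -- first genuine interval when i is smaller than q - 1.
  obtain ⟨m, hm1, hm2, hm3, hm4⟩ : ∃ m, q ≤ m + 1 ∧ m < J ∧ i ≤ m ∧ m ≤ i + (q - 1) := by
    rcases le_total (q - 1) i with hi' | hi'
    · exact ⟨i, by omega, hi, le_rfl, by omega⟩
    · have := h.le
      exact ⟨q - 1, by omega, by omega, hi', by omega⟩
  have hm := h.lt m hm1 hm2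
  have hg := hgap m hm1 hm2
  have hpow : (0 : ℝ) < 2 ^ q := by positivity
  have hle : ∀ l : ℕ, l < 2 ^ (q - 1) → (l : ℝ) * ((s (m + 1) - s m) / 2 ^ q) <
      s (m + 1) - s m := by
    intro l hl
    have h2 : l < 2 ^ q := hl.trans_le (Nat.pow_le_pow_right (by norm_num) (by omega))
    have h3 : (l : ℝ) < 2 ^ q := by exact_mod_cast h2
    rw [mul_div_assoc', div_lt_iff₀ hpow, mul_comm]
    exact mul_lt_mul_of_pos_left h3 (by linarith)
  have hd0 : 0 < (s (m + 1) - s m) / 2 ^ q := by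
    have : 0 < s (m + 1) - s m := by linarith
    positivity
  -- The 2 ^ (q - 1) test points at spacing gap / 2 ^ q stay strictly left of the right knot, so the
  -- polynomial formula holds at all of them.
  refine abs_coeff_le_of_abs_eval_le h.mono hm hm2 (q := q) (W := W) (d := w / 2 ^ q)
    (by positivity) (fun i k _ _ hk => hW i k hk) (q - 1) (by omega) (by omega) θ ε
    (fun l => s m + l * ((s (m + 1) - s m) / 2 ^ q)) ?_ ?_ ?_ i hm3 hm4
  · intro l hl
    have := hle l hl
    have : 0 ≤ (l : ℝ) * ((s (m + 1) - s m) / 2 ^ q) := by positivity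
    constructor <;> linarith
  · intro l _
    have : w / 2 ^ q ≤ (s (m + 1) - s m) / 2 ^ q := div_le_div_of_nonneg_right hg hpow.le
    push_cast
    linarith
  · intro l hl
    have h1 := hle l hl
    have h0 : 0 ≤ (l : ℝ) * ((s (m + 1) - s m) / 2 ^ q) := by positivity
    have h2 := h.nonneg m
    have h3 := h.le_one (m + 1)
    have h4 := hε (s m + l * ((s (m + 1) - s m) / 2 ^ q)) ⟨by linarith, by linarith⟩
    rw [h.splineFun_eq_eval hm (Or.inl ⟨by linarith, by linarith⟩)] at h4
    rw [show q - 1 + 1 = q by omega]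
    exact h4

end Approximation

end

end BayesLepski


namespace BayesLepski

noncomputable section

/-! ### Quadratic forms and inverses of banded matrices. -/

section Matrices

lemma dotProduct_self_eq_sum_sq {ι : Type*} [Fintype ι] (v : ι → ℝ) : v ⬝ᵥ v = ∑ i, v i ^ 2 := by
  simp [dotProduct, sq]

lemma dotProduct_self_nonneg' {ι : Type*} [Fintype ι] (v : ι → ℝ) : 0 ≤ v ⬝ᵥ v := by
  rw [dotProduct_self_eq_sum_sq]
  positivity

lemma sq_le_dotProduct_self {ι : Type*} [Fintype ι] (v : ι → ℝ) (i : ι) : v i ^ 2 ≤ v ⬝ᵥ v := by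
  rw [dotProduct_self_eq_sum_sq]
  exact Finset.single_le_sum (f := fun i => v i ^ 2) (fun j _ => sq_nonneg _) (Finset.mem_univ i)

lemma dotProduct_sq_le {ι : Type*} [Fintype ι] (v w : ι → ℝ) :
    (v ⬝ᵥ w) ^ 2 ≤ (v ⬝ᵥ v) * (w ⬝ᵥ w) := by
  rw [dotProduct_self_eq_sum_sq, dotProduct_self_eq_sum_sq]
  exact Finset.sum_mul_sq_le_sq_mul_sq _ _ _

lemma dotProduct_self_le_of_abs_le {ι : Type*} [Fintype ι] {v : ι → ℝ} {V : ℝ}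
    (h : ∀ i, |v i| ≤ V) : v ⬝ᵥ v ≤ Fintype.card ι * V ^ 2 := by
  rw [dotProduct_self_eq_sum_sq]
  refine (Finset.sum_le_card_nsmul _ _ (V ^ 2) fun i _ => ?_).trans_eq (by simp)
  exact sq_le_sq' (by linarith [neg_abs_le (v i), h i]) ((le_abs_self _).trans (h i))

lemma dotProduct_mulVec_transpose {m n : Type*} [Fintype m] [Fintype n] (A : Matrix m n ℝ)
    (x : m → ℝ) (y : n → ℝ) : x ⬝ᵥ (A *ᵥ y) = (Aᵀ *ᵥ x) ⬝ᵥ y := by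
  rw [Matrix.dotProduct_mulVec, Matrix.mulVec_transpose]

lemma dotProduct_mulVec_symm {n : Type*} [Fintype n] {A : Matrix n n ℝ} (hA : Aᵀ = A)
    (x y : n → ℝ) : x ⬝ᵥ (A *ᵥ y) = y ⬝ᵥ (A *ᵥ x) := by
  rw [dotProduct_mulVec_transpose, hA, dotProduct_comm]

/-- A symmetric matrix with form between `0` and `γ` is a contraction with factor `γ`. -/
lemma mulVec_contraction {n : Type*} [Fintype n] {K : Matrix n n ℝ} (hK : Kᵀ = K) {γ : ℝ}
    (hγ : 0 < γ) (h0 : ∀ v, 0 ≤ v ⬝ᵥ (K *ᵥ v)) (h1 : ∀ v, v ⬝ᵥ (K *ᵥ v) ≤ γ * (v ⬝ᵥ v))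
    (v : n → ℝ) : (K *ᵥ v) ⬝ᵥ (K *ᵥ v) ≤ γ ^ 2 * (v ⬝ᵥ v) := by
  -- Positivity at this test vector gives 2γ⁻¹|Kv|² ≤ vᵀKv + γ⁻²(Kv)ᵀK(Kv). The last term is at most
  -- γ⁻¹|Kv|², which leaves γ⁻¹|Kv|² ≤ γ|v|².
  have h2 := h0 (v - γ⁻¹ • (K *ᵥ v))
  have h3 := h1 v
  have h4 := h1 (K *ᵥ v)
  simp only [Matrix.mulVec_sub, Matrix.mulVec_smul, dotProduct_sub, sub_dotProduct,
    smul_dotProduct, dotProduct_smul, smul_eq_mul] at h2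
  rw [dotProduct_mulVec_symm hK v (K *ᵥ v)] at h2
  set a := (K *ᵥ v) ⬝ᵥ (K *ᵥ v) with ha
  have h5 : γ⁻¹ * (γ⁻¹ * (K *ᵥ v ⬝ᵥ K *ᵥ (K *ᵥ v))) ≤ γ⁻¹ * a := by
    have : γ⁻¹ * (K *ᵥ v ⬝ᵥ K *ᵥ (K *ᵥ v)) ≤ a := by
      rw [inv_mul_le_iff₀ hγ]; exact h4
    exact mul_le_mul_of_nonneg_left this (inv_nonneg.2 hγ.le)
  have h6 : γ⁻¹ * a ≤ γ * (v ⬝ᵥ v) := by linarith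
  rw [inv_mul_le_iff₀ hγ] at h6
  linarith [h6]

lemma card_filter_abs_sub_le {J : ℕ} (i : Fin J) (N : ℕ) :
    (Finset.univ.filter fun j : Fin J => |(i : ℤ) - (j : ℤ)| ≤ N).card ≤ 2 * N + 1 := by
  have h : (Finset.univ.filter fun j : Fin J => |(i : ℤ) - (j : ℤ)| ≤ N).card ≤
      (Finset.Icc ((i : ℤ) - N) (i + N)).card := by
    refine Finset.card_le_card_of_injOn (fun j => (j : ℤ)) ?_ ?_
    · intro j hj
      simp only [Finset.coe_filter, Finset.mem_univ, true_and, mem_ofPred_eq, abs_le] at hj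
      simp only [Finset.coe_Icc, mem_Icc]
      omega
    · intro a _ b _ hab
      simpa [Fin.ext_iff] using hab
  refine h.trans ?_
  rw [Int.card_Icc]
  omega

/-- A banded matrix with bounded entries acts boundedly in the sup norm. -/
lemma abs_mulVec_le_of_banded {J : ℕ} {A : Matrix (Fin J) (Fin J) ℝ} {N : ℕ}
    (hA : ∀ i j : Fin J, (N : ℤ) < |(i : ℤ) - (j : ℤ)| → A i j = 0) {c V : ℝ} (hc : 0 ≤ c)
    (hAc : ∀ i j, |A i j| ≤ c) {v : Fin J → ℝ} (hv : ∀ i, |v i| ≤ V) (i : Fin J) :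
    |(A *ᵥ v) i| ≤ (2 * N + 1) * c * V := by
  have hV : 0 ≤ V := (abs_nonneg _).trans (hv i)
  have e : (A *ᵥ v) i =
      ∑ j ∈ Finset.univ.filter (fun j : Fin J => |(i : ℤ) - (j : ℤ)| ≤ N), A i j * v j := by
    rw [Finset.sum_filter, Matrix.mulVec, dotProduct]
    refine Finset.sum_congr rfl fun j _ => ?_
    split_ifs with h
    · rfl
    · rw [hA i j (not_le.1 h), zero_mul]
  rw [e]
  refine (Finset.abs_sum_le_sum_abs _ _).trans ?_
  refine (Finset.sum_le_card_nsmul _ _ (c * V) fun j _ => ?_).trans ?_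
  · rw [abs_mul]
    exact mul_le_mul (hAc i j) (hv j) (abs_nonneg _) hc
  · rw [nsmul_eq_mul, mul_assoc]
    refine mul_le_mul_of_nonneg_right ?_ (by positivity)
    exact_mod_cast card_filter_abs_sub_le i N

/-- The constant in the sup-norm bound for inverses of banded matrices. -/
def bandConst (w : ℕ) (γ : ℝ) : ℝ := ∑' l : ℕ, (2 * ((l * w : ℕ) : ℝ) + 1) * γ ^ l

lemma summable_bandConst (w : ℕ) {γ : ℝ} (h0 : 0 ≤ γ) (h1 : γ < 1) :
    Summable fun l : ℕ => (2 * ((l * w : ℕ) : ℝ) + 1) * γ ^ l := by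
  have hn : ‖γ‖ < 1 := by rwa [Real.norm_of_nonneg h0]
  have h2 := (summable_pow_mul_geometric_of_norm_lt_one 1 hn).mul_left (2 * (w : ℝ))
  have h3 := summable_geometric_of_lt_one h0 h1
  refine (h2.add h3).congr fun l => ?_
  push_cast
  ring

lemma bandConst_nonneg (w : ℕ) {γ : ℝ} (h0 : 0 ≤ γ) : 0 ≤ bandConst w γ :=
  tsum_nonneg fun l => by positivity

/-- The inverse of a well conditioned banded positive definite matrix is bounded in the
sup norm. -/
lemma abs_le_of_banded_mulVec_eq {J : ℕ} {M : Matrix (Fin J) (Fin J) ℝ} (hM : Mᵀ = M) {w : ℕ}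
    (hband : ∀ i j : Fin J, (w : ℤ) < |(i : ℤ) - (j : ℤ)| → M i j = 0) {a b : ℝ} (ha : 0 < a)
    (hab : a < b) (hlow : ∀ v, a * (v ⬝ᵥ v) ≤ v ⬝ᵥ (M *ᵥ v))
    (hup : ∀ v, v ⬝ᵥ (M *ᵥ v) ≤ b * (v ⬝ᵥ v)) {u v : Fin J → ℝ} (huv : M *ᵥ u = v) {V : ℝ}
    (hv : ∀ i, |v i| ≤ V) (i : Fin J) : |u i| ≤ b⁻¹ * (bandConst w (1 - a / b) * V) := by
  have hb : 0 < b := ha.trans hab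
  set γ := 1 - a / b with hγ
  have hab' : a / b < 1 := (div_lt_one hb).2 hab
  have hγ0 : 0 < γ := by linarith
  have hγ1 : γ < 1 := by linarith [div_pos ha hb]
  have hV : 0 ≤ V := (abs_nonneg _).trans (hv i)
  -- Neumann series: b⁻¹M = 1 - K with K a contraction of factor γ = 1 - a / b.
  set K : Matrix (Fin J) (Fin J) ℝ := 1 - b⁻¹ • M with hK
  have hKT : Kᵀ = K := by simp [hK, hM]
  have hKform : ∀ x, x ⬝ᵥ (K *ᵥ x) = x ⬝ᵥ x - b⁻¹ * (x ⬝ᵥ (M *ᵥ x)) := by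
    intro x
    simp [hK, Matrix.sub_mulVec, Matrix.smul_mulVec, dotProduct_sub, dotProduct_smul]
  have hcontr := mulVec_contraction hKT hγ0
    (fun x => by
      rw [hKform]
      have : b⁻¹ * (x ⬝ᵥ (M *ᵥ x)) ≤ x ⬝ᵥ x := by
        rw [inv_mul_le_iff₀ hb]; exact hup x
      linarith)
    (fun x => by
      rw [hKform]
      have : a / b * (x ⬝ᵥ x) ≤ b⁻¹ * (x ⬝ᵥ (M *ᵥ x)) := by
        rw [div_mul_eq_mul_div, div_eq_inv_mul]
        exact mul_le_mul_of_nonneg_left (hlow x) (inv_nonneg.2 hb.le)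
      rw [hγ]; linarith)
  have hpow : ∀ (l : ℕ) (x : Fin J → ℝ),
      ((K ^ l) *ᵥ x) ⬝ᵥ ((K ^ l) *ᵥ x) ≤ (γ ^ l) ^ 2 * (x ⬝ᵥ x) := by
    intro l
    induction l with
    | zero => intro x; simp
    | succ l ih =>
      intro x
      rw [pow_succ', ← Matrix.mulVec_mulVec]
      refine (hcontr _).trans ?_
      refine (mul_le_mul_of_nonneg_left (ih x) (by positivity)).trans_eq (by ring)
  have hentry : ∀ (l : ℕ) (i j : Fin J), |(K ^ l) i j| ≤ γ ^ l := by
    intro l i j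
    refine abs_le_of_sq_le_sq ?_ (by positivity)
    have h1 := hpow l (Pi.single j 1)
    have h2 := sq_le_dotProduct_self ((K ^ l) *ᵥ Pi.single j 1) i
    have h3 : (Pi.single j (1 : ℝ) : Fin J → ℝ) ⬝ᵥ Pi.single j 1 = 1 := by simp
    rw [h3, mul_one] at h1
    have h4 : ((K ^ l) *ᵥ Pi.single j 1) i = (K ^ l) i j := by simp
    rw [h4] at h2
    linarith
  have hKband : ∀ i j : Fin J, (w : ℤ) < |(i : ℤ) - (j : ℤ)| → K i j = 0 := by
    intro i j hij
    have hne : i ≠ j := by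
      rintro rfl
      simp at hij
      omega
    simp [hK, hband i j hij, Matrix.one_apply_ne hne]
  -- Bandwidth grows linearly in l while entries decay like γ ^ l, so the row sums of K ^ l are
  -- summable.
  have hpband : ∀ (l : ℕ) (i j : Fin J), ((l * w : ℕ) : ℤ) < |(i : ℤ) - (j : ℤ)| →
      (K ^ l) i j = 0 := by
    intro l
    induction l with
    | zero =>
      intro i j hij
      have hne : i ≠ j := by
        rintro rfl
        simp at hij
      simp [Matrix.one_apply_ne hne]
    | succ l ih =>
      intro i j hij
      rw [pow_succ, Matrix.mul_apply]
      refine Finset.sum_eq_zero fun k _ => ?_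
      by_cases h : ((l * w : ℕ) : ℤ) < |(i : ℤ) - (k : ℤ)|
      · rw [ih i k h, zero_mul]
      · rw [hKband k j, mul_zero]
        have := abs_sub_le (i : ℤ) k j
        push_cast at hij h
        linarith
  -- Finite Neumann expansion of the given solution; its remainder is killed by the contraction as L
  -- tends to infinity, although not uniformly in J.
  have hiter : ∀ L : ℕ, u = (K ^ L) *ᵥ u + b⁻¹ • ∑ l ∈ Finset.range L, (K ^ l) *ᵥ v := by
    have hu : u = K *ᵥ u + b⁻¹ • v := by
      rw [← huv, hK, Matrix.sub_mulVec, Matrix.smul_mulVec]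
      simp
    intro L
    induction L with
    | zero => simp
    | succ L ih =>
      have h1 : (K ^ L) *ᵥ u = (K ^ (L + 1)) *ᵥ u + b⁻¹ • ((K ^ L) *ᵥ v) := by
        rw [pow_succ, ← Matrix.mulVec_mulVec, ← Matrix.mulVec_smul, ← Matrix.mulVec_add, ← hu]
      rw [Finset.sum_range_succ, smul_add, add_comm (b⁻¹ • _), ← add_assoc, ← h1]
      exact ih
  have hbound : ∀ L : ℕ,
      |u i| ≤ γ ^ L * Real.sqrt (u ⬝ᵥ u) + b⁻¹ * (bandConst w γ * V) := by
    intro L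
    have h1 : |((K ^ L) *ᵥ u) i| ≤ γ ^ L * Real.sqrt (u ⬝ᵥ u) := by
      refine abs_le_of_sq_le_sq ?_ (by positivity)
      rw [mul_pow, Real.sq_sqrt (dotProduct_self_nonneg' u)]
      exact (sq_le_dotProduct_self _ i).trans (hpow L u)
    have h2 : |(∑ l ∈ Finset.range L, (K ^ l) *ᵥ v) i| ≤ bandConst w γ * V := by
      rw [Finset.sum_apply]
      refine (Finset.abs_sum_le_sum_abs _ _).trans ?_
      have h3 : ∀ l ∈ Finset.range L, |((K ^ l) *ᵥ v) i| ≤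
          (2 * ((l * w : ℕ) : ℝ) + 1) * γ ^ l * V := fun l _ =>
        abs_mulVec_le_of_banded (hpband l) (by positivity) (hentry l) hv i
      refine (Finset.sum_le_sum h3).trans ?_
      rw [← Finset.sum_mul]
      refine mul_le_mul_of_nonneg_right ?_ hV
      exact (summable_bandConst w hγ0.le hγ1).sum_le_tsum _ fun l _ => by positivity
    have h4 := congrFun (hiter L) i
    rw [h4, Pi.add_apply, Pi.smul_apply, smul_eq_mul]
    refine (abs_add_le _ _).trans (add_le_add h1 ?_)
    rw [abs_mul, abs_of_pos (inv_pos.2 hb)]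
    exact mul_le_mul_of_nonneg_left h2 (inv_nonneg.2 hb.le)
  have hlim : Tendsto (fun L : ℕ => γ ^ L * Real.sqrt (u ⬝ᵥ u) + b⁻¹ * (bandConst w γ * V)) atTop
      (𝓝 (0 * Real.sqrt (u ⬝ᵥ u) + b⁻¹ * (bandConst w γ * V))) :=
    ((tendsto_pow_atTop_nhds_zero_of_lt_one hγ0.le hγ1).mul_const _).add_const _
  have := ge_of_tendsto' hlim hbound
  simpa using this

/-- Lower bound for the quadratic form of a symmetric matrix by its eigenvalues. -/
lemma mul_dotProduct_le_of_le_eigenvalues {n : Type*} [Fintype n] [DecidableEq n]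
    {A : Matrix n n ℝ} (hA : A.IsHermitian) {c : ℝ} (h : ∀ i, c ≤ hA.eigenvalues i) (v : n → ℝ) :
    c * (v ⬝ᵥ v) ≤ v ⬝ᵥ (A *ᵥ v) := by
  have hB : (A - algebraMap ℝ (Matrix n n ℝ) c).IsHermitian := by
    refine hA.sub ?_
    rw [Algebra.algebraMap_eq_smul_one]
    simp [Matrix.IsHermitian]
  have hpos : (A - algebraMap ℝ (Matrix n n ℝ) c).PosSemidef := by
    rw [hB.posSemidef_iff_eigenvalues_nonneg]
    intro i
    -- Subtracting a scalar matrix shifts the spectrum, so every eigenvalue here is some eigenvalue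
    -- of A minus c.
    have h1 := hB.eigenvalues_mem_spectrum_real i
    rw [← spectrum.sub_singleton_eq, hA.spectrum_real_eq_range_eigenvalues] at h1
    obtain ⟨x, ⟨j, rfl⟩, y, hy, hxy⟩ := h1
    rw [mem_singleton_iff] at hy
    subst hy
    simp only [Pi.zero_apply]
    rw [← hxy]
    exact sub_nonneg.2 (h j)
  have h2 := hpos.dotProduct_mulVec_nonneg v
  rw [Algebra.algebraMap_eq_smul_one, Matrix.sub_mulVec, Matrix.smul_mulVec, Matrix.one_mulVec,
    dotProduct_sub, dotProduct_smul, smul_eq_mul] at h2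
  simp only [star_trivial] at h2
  linarith

/-! ### Prior precision, posterior precision and the marginal quadratic form. -/

section Prior

variable {J : ℕ} {Ω : Matrix (Fin J) (Fin J) ℝ} {c₁ : ℝ}

lemma posDef_of_le_eigenvalues (hΩ : Ω.IsHermitian) (hc₁ : 0 < c₁)
    (h : ∀ i, c₁ ≤ hΩ.eigenvalues i) : Ω.PosDef :=
  hΩ.posDef_iff_eigenvalues_pos.2 fun i => hc₁.trans_le (h i)

lemma inv_form_nonneg (hpd : Ω.PosDef) (v : Fin J → ℝ) : 0 ≤ v ⬝ᵥ (Ω⁻¹ *ᵥ v) := by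
  have := hpd.inv.posSemidef.dotProduct_mulVec_nonneg v
  simpa using this

lemma inv_transpose_eq (hpd : Ω.PosDef) : (Ω⁻¹)ᵀ = Ω⁻¹ := by
  have := hpd.inv.isHermitian
  rwa [Matrix.IsHermitian, Matrix.conjTranspose_eq_transpose_of_trivial] at this

lemma mul_inv_of_posDef (hpd : Ω.PosDef) : Ω * Ω⁻¹ = 1 :=
  Matrix.mul_nonsing_inv _ ((Matrix.isUnit_iff_isUnit_det _).1 hpd.isUnit)

/-- With y = Ω⁻¹v the eigenvalue bound reads c₁|y|² ≤ yᵀv, and Cauchy–Schwarz concludes. -/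
lemma inv_mulVec_sq_le (hΩ : Ω.IsHermitian) (hc₁ : 0 < c₁) (h : ∀ i, c₁ ≤ hΩ.eigenvalues i)
    (v : Fin J → ℝ) : c₁ ^ 2 * ((Ω⁻¹ *ᵥ v) ⬝ᵥ (Ω⁻¹ *ᵥ v)) ≤ v ⬝ᵥ v := by
  have hpd := posDef_of_le_eigenvalues hΩ hc₁ h
  have h1 := mul_dotProduct_le_of_le_eigenvalues hΩ h (Ω⁻¹ *ᵥ v)
  rw [Matrix.mulVec_mulVec, mul_inv_of_posDef hpd, Matrix.one_mulVec] at h1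
  have h2 := dotProduct_sq_le (Ω⁻¹ *ᵥ v) v
  have h3 := dotProduct_self_nonneg' (Ω⁻¹ *ᵥ v)
  have h4 := dotProduct_self_nonneg' v
  set y := (Ω⁻¹ *ᵥ v) ⬝ᵥ (Ω⁻¹ *ᵥ v)
  rcases h3.lt_or_eq with h5 | h5
  · have h6 : (c₁ * y) ^ 2 ≤ y * (v ⬝ᵥ v) :=
      (pow_le_pow_left₀ (by positivity) h1 2).trans h2
    have h7 : y * (c₁ ^ 2 * y) ≤ y * (v ⬝ᵥ v) := by linarith [h6]
    exact le_of_mul_le_mul_left h7 h5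
  · rw [← h5]; simpa using h4

lemma inv_form_le (hΩ : Ω.IsHermitian) (hc₁ : 0 < c₁) (h : ∀ i, c₁ ≤ hΩ.eigenvalues i)
    (v : Fin J → ℝ) : v ⬝ᵥ (Ω⁻¹ *ᵥ v) ≤ c₁⁻¹ * (v ⬝ᵥ v) := by
  have h1 := inv_mulVec_sq_le hΩ hc₁ h v
  have h2 := dotProduct_sq_le v (Ω⁻¹ *ᵥ v)
  have h4 := dotProduct_self_nonneg' v
  refine le_of_abs_le (abs_le_of_sq_le_sq ?_ (by positivity))
  refine h2.trans ?_
  rw [mul_pow, sq (v ⬝ᵥ v), mul_left_comm]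
  refine mul_le_mul_of_nonneg_left ?_ h4
  rw [inv_pow, ← div_eq_inv_mul, le_div_iff₀ (by positivity), mul_comm]
  exact h1

lemma abs_inv_entry_le (hΩ : Ω.IsHermitian) (hc₁ : 0 < c₁) (h : ∀ i, c₁ ≤ hΩ.eigenvalues i)
    (i j : Fin J) : |Ω⁻¹ i j| ≤ c₁⁻¹ := by
  refine abs_le_of_sq_le_sq ?_ (by positivity)
  have h1 := inv_mulVec_sq_le hΩ hc₁ h (Pi.single j 1)
  have h2 := sq_le_dotProduct_self (Ω⁻¹ *ᵥ Pi.single j 1) i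
  have h3 : (Pi.single j (1 : ℝ) : Fin J → ℝ) ⬝ᵥ Pi.single j 1 = 1 := by simp
  have h4 : (Ω⁻¹ *ᵥ Pi.single j 1) i = Ω⁻¹ i j := by simp
  rw [h3] at h1
  rw [h4] at h2
  rw [inv_pow, ← one_div (c₁ ^ 2), le_div_iff₀ (by positivity), mul_comm]
  exact (mul_le_mul_of_nonneg_left h2 (by positivity)).trans h1

variable {n : ℕ} (B : Matrix (Fin n) (Fin J) ℝ)

lemma posterior_form (v : Fin J → ℝ) :
    v ⬝ᵥ ((Bᵀ * B + Ω⁻¹) *ᵥ v) = (B *ᵥ v) ⬝ᵥ (B *ᵥ v) + v ⬝ᵥ (Ω⁻¹ *ᵥ v) := by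
  rw [Matrix.add_mulVec, dotProduct_add, ← Matrix.mulVec_mulVec, dotProduct_mulVec_transpose,
    Matrix.transpose_transpose]

lemma posterior_posDef (hpd : Ω.PosDef) : (Bᵀ * B + Ω⁻¹).PosDef := by
  have := Matrix.posSemidef_conjTranspose_mul_self B
  rw [Matrix.conjTranspose_eq_transpose_of_trivial] at this
  exact Matrix.PosDef.posSemidef_add this hpd.inv

lemma posterior_transpose (hpd : Ω.PosDef) : (Bᵀ * B + Ω⁻¹)ᵀ = Bᵀ * B + Ω⁻¹ := by
  rw [Matrix.transpose_add, Matrix.transpose_mul, Matrix.transpose_transpose,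
    inv_transpose_eq hpd]

lemma posterior_mul_inv (hpd : Ω.PosDef) : (Bᵀ * B + Ω⁻¹) * (Bᵀ * B + Ω⁻¹)⁻¹ = 1 :=
  mul_inv_of_posDef (posterior_posDef B hpd)

lemma posterior_inv_mul (hpd : Ω.PosDef) : (Bᵀ * B + Ω⁻¹)⁻¹ * (Bᵀ * B + Ω⁻¹) = 1 :=
  mul_eq_one_comm.1 (posterior_mul_inv B hpd)

/-- The Woodbury identity, which ties the marginal covariance in the empirical Bayes variance to the
posterior precision. -/
lemma marginal_inv_eq (hpd : Ω.PosDef) :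
    (B * Ω * Bᵀ + 1)⁻¹ = 1 - B * (Bᵀ * B + Ω⁻¹)⁻¹ * Bᵀ := by
  refine Matrix.inv_eq_right_inv ?_
  set N := (Bᵀ * B + Ω⁻¹)⁻¹ with hN
  have h1 : Ω * (Bᵀ * B) * N = Ω - N := by
    have h2 : Ω * ((Bᵀ * B + Ω⁻¹) * N) = Ω := by rw [posterior_mul_inv B hpd, mul_one]
    rw [add_mul, mul_add, ← mul_assoc, ← mul_assoc Ω Ω⁻¹, mul_inv_of_posDef hpd, one_mul] at h2
    exact eq_sub_of_add_eq h2
  have h3 : B * Ω * Bᵀ * (B * N * Bᵀ) = B * (Ω * (Bᵀ * B) * N) * Bᵀ := by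
    simp only [Matrix.mul_assoc]
  rw [Matrix.add_mul, Matrix.mul_sub, Matrix.mul_one, h3, h1, Matrix.mul_sub, Matrix.sub_mul,
    Matrix.one_mul]
  abel

/-- The penalised least squares characterisation of the marginal quadratic form. -/
lemma marginal_form_add (hpd : Ω.PosDef) (z : Fin n → ℝ) (v : Fin J → ℝ) :
    z ⬝ᵥ ((B * Ω * Bᵀ + 1)⁻¹ *ᵥ z)
      + (v - (Bᵀ * B + Ω⁻¹)⁻¹ *ᵥ (Bᵀ *ᵥ z)) ⬝ᵥ
        ((Bᵀ * B + Ω⁻¹) *ᵥ (v - (Bᵀ * B + Ω⁻¹)⁻¹ *ᵥ (Bᵀ *ᵥ z)))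
      = (z - B *ᵥ v) ⬝ᵥ (z - B *ᵥ v) + v ⬝ᵥ (Ω⁻¹ *ᵥ v) := by
  set M := Bᵀ * B + Ω⁻¹ with hM
  set u := M⁻¹ *ᵥ (Bᵀ *ᵥ z) with hu
  have hMu : M *ᵥ u = Bᵀ *ᵥ z := by
    rw [hu, Matrix.mulVec_mulVec, posterior_mul_inv B hpd, Matrix.one_mulVec]
  have h1 : z ⬝ᵥ ((B * Ω * Bᵀ + 1)⁻¹ *ᵥ z) = z ⬝ᵥ z - (Bᵀ *ᵥ z) ⬝ᵥ u := by
    rw [marginal_inv_eq B hpd, Matrix.sub_mulVec, dotProduct_sub, Matrix.one_mulVec,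
      ← Matrix.mulVec_mulVec, ← Matrix.mulVec_mulVec, dotProduct_mulVec_transpose]
  have h2 := posterior_form (Ω := Ω) B v
  have h3 : u ⬝ᵥ (M *ᵥ v) = (Bᵀ *ᵥ z) ⬝ᵥ v := by
    rw [dotProduct_mulVec_symm (posterior_transpose B hpd), hMu, dotProduct_comm]
  have h4 : z ⬝ᵥ (B *ᵥ v) = (Bᵀ *ᵥ z) ⬝ᵥ v := dotProduct_mulVec_transpose _ _ _
  rw [h1, Matrix.mulVec_sub, dotProduct_sub, sub_dotProduct, sub_dotProduct, h3, hMu, h2,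
    dotProduct_sub, sub_dotProduct, sub_dotProduct, h4, dotProduct_comm (B *ᵥ v) z, h4,
    dotProduct_comm v (Bᵀ *ᵥ z), dotProduct_comm u (Bᵀ *ᵥ z)]
  ring

/-- The marginal form is the minimum of a penalised least squares criterion, so any trial
coefficient vector bounds it from above. -/
lemma marginal_form_le (hpd : Ω.PosDef) (z : Fin n → ℝ) (v : Fin J → ℝ) :
    z ⬝ᵥ ((B * Ω * Bᵀ + 1)⁻¹ *ᵥ z) ≤ (z - B *ᵥ v) ⬝ᵥ (z - B *ᵥ v) + v ⬝ᵥ (Ω⁻¹ *ᵥ v) := by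
  rw [← marginal_form_add B hpd z v]
  have := (posterior_posDef B hpd).posSemidef.dotProduct_mulVec_nonneg
    (v - (Bᵀ * B + Ω⁻¹)⁻¹ *ᵥ (Bᵀ *ᵥ z))
  rw [star_trivial] at this
  linarith

/-- Evaluate the criterion at its minimiser and drop the penalty. -/
lemma le_marginal_form (hpd : Ω.PosDef) (z : Fin n → ℝ) :
    (z - B *ᵥ ((Bᵀ * B + Ω⁻¹)⁻¹ *ᵥ (Bᵀ *ᵥ z))) ⬝ᵥ (z - B *ᵥ ((Bᵀ * B + Ω⁻¹)⁻¹ *ᵥ (Bᵀ *ᵥ z))) ≤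
      z ⬝ᵥ ((B * Ω * Bᵀ + 1)⁻¹ *ᵥ z) := by
  have h1 := marginal_form_add B hpd z ((Bᵀ * B + Ω⁻¹)⁻¹ *ᵥ (Bᵀ *ᵥ z))
  have h2 := inv_form_nonneg hpd ((Bᵀ * B + Ω⁻¹)⁻¹ *ᵥ (Bᵀ *ᵥ z))
  rw [sub_self, zero_dotProduct, add_zero] at h1
  linarith

/-- Each posterior coefficient is a linear statistic with small weights. -/
lemma posterior_weights_sq_le (hpd : Ω.PosDef) {a : ℝ} (ha : 0 < a)
    (hlow : ∀ v, a * (v ⬝ᵥ v) ≤ (B *ᵥ v) ⬝ᵥ (B *ᵥ v)) (k : Fin J) :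
    ∑ i, ((Bᵀ * B + Ω⁻¹)⁻¹ * Bᵀ) k i ^ 2 ≤ a⁻¹ := by
  set M := Bᵀ * B + Ω⁻¹ with hM
  set u := M⁻¹ *ᵥ Pi.single k 1 with hu
  have hMT : (M⁻¹)ᵀ = M⁻¹ := by
    rw [Matrix.transpose_nonsing_inv, posterior_transpose B hpd]
  -- By symmetry of M the k-th row of weights is Bu with u = M⁻¹e_k.
  have h1 : ∑ i, (M⁻¹ * Bᵀ) k i ^ 2 = (B *ᵥ u) ⬝ᵥ (B *ᵥ u) := by
    rw [dotProduct_self_eq_sum_sq]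
    refine Finset.sum_congr rfl fun i _ => ?_
    congr 1
    rw [hu, Matrix.mulVec_mulVec, Matrix.mulVec_single_one, Matrix.col_apply,
      ← Matrix.transpose_apply (B * M⁻¹), Matrix.transpose_mul, hMT]
  have h2 : u ⬝ᵥ (M *ᵥ u) = u k := by
    rw [hu, Matrix.mulVec_mulVec, posterior_mul_inv B hpd, Matrix.one_mulVec]
    simp
  have h3 := posterior_form (Ω := Ω) B u
  have h4 := inv_form_nonneg hpd u
  have h5 := hlow u
  have h6 := sq_le_dotProduct_self u k
  rw [h1]
  -- From a u_k² ≤ |Bu|² ≤ uᵀMu = u_k it follows that u_k ≤ 1/a, and |Bu|² ≤ u_k.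
  have h7 : (B *ᵥ u) ⬝ᵥ (B *ᵥ u) ≤ u k := by linarith
  have h8 : a * u k ^ 2 ≤ u k := by nlinarith
  have h9 : 0 ≤ u k := (dotProduct_self_nonneg' _).trans h7
  refine h7.trans ?_
  rcases h9.lt_or_eq with h10 | h10
  · rw [← one_div, le_div_iff₀ ha]
    nlinarith
  · rw [← h10]; positivity

end Prior

end Matrices

end

end BayesLepski


namespace BayesLepski

noncomputable section

/-! ### Gaussian tails for linear statistics and for the squared noise. -/

section Probability

variable {n : ℕ} (X : Fin n → ℝ) (f₀ : ℝ → ℝ) (σ₀ : ℝ)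

instance isProbabilityMeasure_trueLaw : IsProbabilityMeasure (trueLaw X f₀ σ₀) := by
  unfold trueLaw
  infer_instance

lemma map_trueLaw_sub (i : Fin n) :
    (trueLaw X f₀ σ₀).map (fun Y => Y i - f₀ (X i)) = gaussianReal 0 (Real.toNNReal (σ₀ ^ 2)) := by
  have h1 := (measurePreserving_eval
    (fun i => gaussianReal (f₀ (X i)) (Real.toNNReal (σ₀ ^ 2))) i).map_eq
  have h2 := gaussianReal_map_sub_const (μ := f₀ (X i)) (v := Real.toNNReal (σ₀ ^ 2)) (f₀ (X i))
  rw [sub_self, ← h1, Measure.map_map (by fun_prop) (by fun_prop)] at h2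
  exact h2

lemma hasSubgaussianMGF_noise (i : Fin n) :
    HasSubgaussianMGF (fun Y => Y i - f₀ (X i)) (Real.toNNReal (σ₀ ^ 2)) (trueLaw X f₀ σ₀) where
  integrable_exp_mul t := by
    rw [← mgf_pos_iff, mgf_gaussianReal (map_trueLaw_sub X f₀ σ₀ i)]
    exact Real.exp_pos _
  mgf_le t := by
    rw [mgf_gaussianReal (map_trueLaw_sub X f₀ σ₀ i)]
    simp

/-- Chernoff bound for a sum of independent sub-Gaussian variables, applied to both signs. -/
lemma trueLaw_real_le_abs_sum (hσ₀ : 0 < σ₀) (c : Fin n → ℝ) {v : ℝ} (hv : 0 < v)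
    (hc : ∑ i, c i ^ 2 ≤ v) {t : ℝ} (ht : 0 ≤ t) :
    (trueLaw X f₀ σ₀).real {Y | t ≤ |∑ i, c i * (Y i - f₀ (X i))|}
      ≤ 2 * Real.exp (-t ^ 2 / (2 * (σ₀ ^ 2 * v))) := by
  have key : ∀ c : Fin n → ℝ, ∑ i, c i ^ 2 ≤ v →
      (trueLaw X f₀ σ₀).real {Y | t ≤ ∑ i, c i * (Y i - f₀ (X i))}
        ≤ Real.exp (-t ^ 2 / (2 * (σ₀ ^ 2 * v))) := by
    intro c hc
    have hind : iIndepFun (fun i (Y : Fin n → ℝ) => c i * (Y i - f₀ (X i)))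
        (trueLaw X f₀ σ₀) :=
      iIndepFun_pi (X := fun i (y : ℝ) => c i * (y - f₀ (X i))) (fun i => by fun_prop)
    have hsub : ∀ i, HasSubgaussianMGF (fun Y : Fin n → ℝ => c i * (Y i - f₀ (X i)))
        (Real.toNNReal (c i ^ 2 * σ₀ ^ 2)) (trueLaw X f₀ σ₀) := by
      intro i
      rw [Real.toNNReal_mul (sq_nonneg _), Real.toNNReal_of_nonneg (sq_nonneg (c i))]
      exact (hasSubgaussianMGF_noise X f₀ σ₀ i).const_mul (c i)
    have h1 := HasSubgaussianMGF.measure_sum_ge_le_of_iIndepFun hind (s := Finset.univ)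
      (fun i _ => hsub i) ht
    have h2 : ((∑ i, Real.toNNReal (c i ^ 2 * σ₀ ^ 2) : NNReal) : ℝ) = σ₀ ^ 2 * ∑ i, c i ^ 2 := by
      push_cast
      rw [Finset.mul_sum]
      refine Finset.sum_congr rfl fun i _ => ?_
      rw [Real.coe_toNNReal _ (by positivity), mul_comm]
    rw [h2] at h1
    rcases (Finset.sum_nonneg fun i (_ : i ∈ Finset.univ) => sq_nonneg (c i)).lt_or_eq with h3 | h3
    · refine h1.trans (Real.exp_le_exp.2 ?_)
      rw [neg_div, neg_div, neg_le_neg_iff]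
      have h4 : 0 < σ₀ ^ 2 := by positivity
      exact div_le_div_of_nonneg_left (by positivity) (by positivity)
        (mul_le_mul_of_nonneg_left (mul_le_mul_of_nonneg_left hc h4.le) (by norm_num))
    -- With zero weights division by zero makes the Chernoff exponent 0, hence the bound trivial;
    -- here the statistic is identically zero and the claim is checked directly.
    · have h4 : ∀ i, c i = 0 := by
        intro i
        have := (Finset.sum_eq_zero_iff_of_nonneg fun i _ => sq_nonneg (c i)).1 h3.symm i
          (Finset.mem_univ i)
        simpa using this
      simp only [h4, zero_mul, Finset.sum_const_zero]
      rcases ht.lt_or_eq with h5 | h5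
      · have : {Y : Fin n → ℝ | t ≤ 0} = ∅ := by
          ext Y
          simp [h5]
        rw [this]
        simp [Real.exp_nonneg]
      · rw [← h5]
        simp
  have h1 := key c hc
  have h2 := key (fun i => -c i) (by simpa using hc)
  have h3 : {Y : Fin n → ℝ | t ≤ |∑ i, c i * (Y i - f₀ (X i))|} ⊆
      {Y | t ≤ ∑ i, c i * (Y i - f₀ (X i))} ∪ {Y | t ≤ ∑ i, -c i * (Y i - f₀ (X i))} := by
    intro Y hY
    rcases le_abs.1 (mem_ofPred.1 hY) with h | h
    · exact Or.inl h
    · refine Or.inr ?_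
      simp only [neg_mul, Finset.sum_neg_distrib, mem_ofPred_eq]
      exact h
  refine (measureReal_mono h3).trans ((measureReal_union_le _ _).trans ?_)
  linarith

/-- The variance of a squared centred Gaussian variable. -/
def gaussianSqVariance (σ₀ : ℝ) : ℝ :=
  Var[fun x : ℝ => x ^ 2; gaussianReal 0 (Real.toNNReal (σ₀ ^ 2))]

lemma gaussianSqVariance_nonneg : 0 ≤ gaussianSqVariance σ₀ := variance_nonneg _ _

lemma memLp_sq_gaussian (v : NNReal) : MemLp (fun x : ℝ => x ^ 2) 2 (gaussianReal 0 v) := by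
  have h := memLp_id_gaussianReal (μ := 0) (v := v) 4
  have h2 := h.norm_rpow_div 2
  have e : (fun x : ℝ => ‖id x‖ ^ (ENNReal.toReal 2)) = fun x : ℝ => x ^ 2 := by
    funext x
    simp
  rw [e] at h2
  convert! h2 using 1
  rw [ENNReal.eq_div_iff (by norm_num) (by norm_num)]
  norm_num

/-- Chebyshev's inequality at half the mean; a bound of order 1/n suffices, since the stochastic
terms already cost 1/jmin. -/
lemma trueLaw_real_chiSq (hσ₀ : 0 < σ₀) (hn : 0 < n) :
    (trueLaw X f₀ σ₀).real
      {Y | n * σ₀ ^ 2 / 2 ≤ |∑ i, (Y i - f₀ (X i)) ^ 2 - n * σ₀ ^ 2|}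
      ≤ 4 * gaussianSqVariance σ₀ / σ₀ ^ 4 / n := by
  set v := Real.toNNReal (σ₀ ^ 2) with hv
  have hvv : (v : ℝ) = σ₀ ^ 2 := Real.coe_toNNReal _ (sq_nonneg _)
  have hmap : ∀ i, (gaussianReal (f₀ (X i)) v).map (fun y => y - f₀ (X i)) = gaussianReal 0 v := by
    intro i
    rw [gaussianReal_map_sub_const, sub_self]
  have hmem : ∀ i, MemLp (fun y : ℝ => (y - f₀ (X i)) ^ 2) 2 (gaussianReal (f₀ (X i)) v) := by
    intro i
    have h1 := memLp_sq_gaussian v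
    rw [← hmap i] at h1
    exact h1.comp_of_map (by fun_prop)
  have hmem' : ∀ i, MemLp (fun Y : Fin n → ℝ => (Y i - f₀ (X i)) ^ 2) 2 (trueLaw X f₀ σ₀) := by
    intro i
    exact (hmem i).comp_measurePreserving (measurePreserving_eval
      (fun i => gaussianReal (f₀ (X i)) v) i)
  have hvar : Var[∑ i, fun Y : Fin n → ℝ => (Y i - f₀ (X i)) ^ 2; trueLaw X f₀ σ₀] =
      n * gaussianSqVariance σ₀ := by
    have h1 := variance_sum_pi hmem
    have h2 : ∀ i, Var[fun y : ℝ => (y - f₀ (X i)) ^ 2; gaussianReal (f₀ (X i)) v] =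
        gaussianSqVariance σ₀ := by
      intro i
      rw [gaussianSqVariance, ← hv, ← hmap i, variance_map (by fun_prop) (by fun_prop)]
      rfl
    simp only [h2, Finset.sum_const, Finset.card_univ, Fintype.card_fin, nsmul_eq_mul] at h1
    exact h1
  have hmean : ∀ i, ∫ Y, (Y i - f₀ (X i)) ^ 2 ∂(trueLaw X f₀ σ₀) = σ₀ ^ 2 := by
    intro i
    have h1 : ∫ x, x ^ 2 ∂(gaussianReal 0 v) = v := by
      have h2 := variance_fun_id_gaussianReal (μ := 0) (v := v)
      rw [variance_of_integral_eq_zero (by fun_prop) integral_id_gaussianReal] at h2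
      exact h2
    rw [← map_trueLaw_sub X f₀ σ₀ i, integral_map (Measurable.aemeasurable (by fun_prop))
      (by fun_prop), hvv] at h1
    exact h1
  have hmean' : ∫ Y, (∑ i, fun Y : Fin n → ℝ => (Y i - f₀ (X i)) ^ 2) Y ∂(trueLaw X f₀ σ₀)
      = n * σ₀ ^ 2 := by
    simp only [Finset.sum_apply]
    rw [integral_finsetSum _ fun i _ => (hmem' i).integrable (by norm_num)]
    simp [hmean]
  have hn' : (0 : ℝ) < n := by exact_mod_cast hn
  have hch := meas_ge_le_variance_div_sq (memLp_finsetSum' Finset.univ fun i _ => hmem' i)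
    (show 0 < n * σ₀ ^ 2 / 2 by positivity)
  rw [hmean', hvar] at hch
  simp only [Finset.sum_apply] at hch
  have h0 := gaussianSqVariance_nonneg σ₀
  have h3 := ENNReal.toReal_mono ENNReal.ofReal_ne_top hch
  rw [ENNReal.toReal_ofReal (by positivity)] at h3
  refine h3.trans_eq ?_
  field_simp
  ring

end Probability

end

end BayesLepski


namespace BayesLepski

noncomputable section

/-! ### Quasi-uniform partitions have gaps of order 1/J. -/

section Geometry

/-- Clamped knots whose simple gaps are of order `1 / J`. -/
structure UniformKnots (ρ : ℝ) (q J : ℕ) (s : ℕ → ℝ) : Prop extends ClampedKnots q J s where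
  one_le_ratio : 1 ≤ ρ
  gap : ∀ m, q ≤ m + 1 → m < J → (ρ * J)⁻¹ ≤ s (m + 1) - s m
  width : ∀ i k, k ≤ q → s (i + k) - s i ≤ ρ * q ^ 2 / J

lemma UniformKnots.pos {ρ : ℝ} {q J : ℕ} {s : ℕ → ℝ} (h : UniformKnots ρ q J s) : 0 < J :=
  lt_of_lt_of_le h.one_le h.le

variable {N : ℕ} {ρ : ℝ} {T : KnotPartition N}

lemma KnotPartition.gap_pos (T : KnotPartition N) (k : Fin (N + 1)) : 0 < T.gap k :=
  sub_pos.2 (T.strictMono Fin.castSucc_lt_succ)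

lemma KnotPartition.sum_gap (T : KnotPartition N) : ∑ k, T.gap k = 1 := by
  have h : ∑ k, T.gap k = T.t (Fin.last _) - T.t 0 := by
    unfold gap
    rw [Finset.sum_sub_distrib, sub_eq_sub_iff_add_eq_add, add_comm, ← Fin.sum_univ_succ,
      Fin.sum_univ_castSucc, add_comm]
  rw [h, T.first, T.last, sub_zero]

lemma KnotPartition.QuasiUniform.one_le (h : T.QuasiUniform ρ) : 1 ≤ ρ := by
  have h1 := h 0 0
  have h2 := T.gap_pos 0
  nlinarith

lemma KnotPartition.QuasiUniform.gap_le (h : T.QuasiUniform ρ) (k : Fin (N + 1)) :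
    T.gap k ≤ ρ / ((N + 1 : ℕ) : ℝ) := by
  rw [le_div_iff₀ (by positivity)]
  have h1 : ∑ _l : Fin (N + 1), T.gap k ≤ ∑ l, ρ * T.gap l := Finset.sum_le_sum fun l _ => h k l
  rw [← Finset.mul_sum, T.sum_gap] at h1
  simp only [Finset.sum_const, Finset.card_univ, Fintype.card_fin, nsmul_eq_mul] at h1
  linarith

lemma KnotPartition.QuasiUniform.le_gap (h : T.QuasiUniform ρ) (k : Fin (N + 1)) :
    (ρ * ((N + 1 : ℕ) : ℝ))⁻¹ ≤ T.gap k := by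
  have h0 := h.one_le
  rw [inv_le_iff_one_le_mul₀ (by positivity)]
  have h1 : ∑ l, T.gap l ≤ ∑ _l : Fin (N + 1), ρ * T.gap k := Finset.sum_le_sum fun l _ => h l k
  rw [T.sum_gap] at h1
  simp only [Finset.sum_const, Finset.card_univ, Fintype.card_fin, nsmul_eq_mul] at h1
  linarith

lemma KnotPartition.inv_le_mesh (T : KnotPartition N) : ((N + 1 : ℕ) : ℝ)⁻¹ ≤ T.mesh := by
  have h1 : ∀ k, T.gap k ≤ T.mesh := fun k =>
    le_ciSup (f := fun k => T.gap k) (Set.finite_range _).bddAbove k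
  have h2 : ∑ k, T.gap k ≤ ∑ _k : Fin (N + 1), T.mesh := Finset.sum_le_sum fun k _ => h1 k
  rw [T.sum_gap] at h2
  simp only [Finset.sum_const, Finset.card_univ, Fintype.card_fin, nsmul_eq_mul] at h2
  rw [inv_le_iff_one_le_mul₀ (by positivity)]
  linarith

lemma KnotPartition.QuasiUniform.uniformKnots {q J : ℕ} (hq : 1 ≤ q) (hJ : q ≤ J)
    {T : KnotPartition (J - q)} (h : T.QuasiUniform ρ) : UniformKnots ρ q J (T.extended q) := by
  have hc := T.clampedKnots hq hJ
  have h0 := h.one_le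
  have hJ0 : (0 : ℝ) < J := by exact_mod_cast (by omega : 0 < J)
  have hgap : ∀ m, q ≤ m + 1 → m < J → ∃ k, T.extended q (m + 1) - T.extended q m = T.gap k := by
    intro m h1 h2
    refine ⟨⟨m - (q - 1), by omega⟩, ?_⟩
    have e1 := T.extended_add (q := q) (m - (q - 1)) (by omega)
    have e2 := T.extended_add (q := q) (m - (q - 1) + 1) (by omega)
    rw [show q - 1 + (m - (q - 1)) = m by omega] at e1
    rw [show q - 1 + (m - (q - 1) + 1) = m + 1 by omega] at e2
    rw [e1, e2]
    rfl
  have hstep : ∀ i, T.extended q (i + 1) - T.extended q i ≤ ρ * q / J := by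
    intro i
    by_cases h1 : q ≤ i + 1 ∧ i < J
    · obtain ⟨k, hk⟩ := hgap i h1.1 h1.2
      rw [hk]
      refine (h.gap_le k).trans ?_
      rw [div_le_div_iff₀ (by positivity) hJ0, mul_assoc]
      refine mul_le_mul_of_nonneg_left ?_ (by linarith)
      -- Quasi-uniformity speaks of the J - q + 1 intervals; passing to J costs a factor q, and up
      -- to q steps make the q ^ 2 in the width.
      have : J ≤ q * (J - q + 1) := by
        obtain ⟨d, rfl⟩ := Nat.exists_eq_add_of_le hJ
        rw [Nat.add_sub_cancel_left]
        nlinarith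
      exact_mod_cast this
    · have : T.extended q (i + 1) - T.extended q i = 0 := by
        by_cases h2 : q ≤ i + 1
        · rw [hc.one i (by omega), hc.one (i + 1) (by omega), sub_self]
        · rw [hc.zero i (by omega), hc.zero (i + 1) (by omega), sub_self]
      rw [this]
      positivity
  have hsteps : ∀ k i, T.extended q (i + k) - T.extended q i ≤ k * (ρ * q / J) := by
    intro k
    induction k with
    | zero => intro i; simp
    | succ k ih =>
      intro i
      have h1 := ih i
      have h2 := hstep (i + k)
      rw [← add_assoc]
      push_cast
      linarith
  refine ⟨hc, h0, fun m h1 h2 => ?_, fun i k hk => ?_⟩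
  · obtain ⟨k, hk⟩ := hgap m h1 h2
    rw [hk]
    refine le_trans (inv_anti₀ (by positivity) ?_) (h.le_gap k)
    refine mul_le_mul_of_nonneg_left ?_ (by linarith)
    exact_mod_cast (by omega : J - q + 1 ≤ J)
  · refine (hsteps k i).trans ?_
    have : (k : ℝ) ≤ q := by exact_mod_cast hk
    calc (k : ℝ) * (ρ * q / J) ≤ q * (ρ * q / J) := mul_le_mul_of_nonneg_right this (by positivity)
      _ = ρ * q ^ 2 / J := by ring

end Geometry

/-! ### Counting design points and the empirical Gram form. -/

section Design

variable {n : ℕ} {X : Fin n → ℝ} {φ : ℝ → ℝ} {φ₀ φ₁ D : ℝ}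

lemma empiricalCDF_eq (X : Fin n → ℝ) (x : ℝ) :
    empiricalCDF X x = (n : ℝ)⁻¹ * ((Finset.univ.filter fun i => X i ≤ x).card : ℝ) := by
  rw [empiricalCDF, Finset.card_filter]
  push_cast
  congr 1

lemma integral_density_bounds (hφ : ContinuousOn φ (Icc 0 1))
    (h0 : ∀ x ∈ Icc (0 : ℝ) 1, φ₀ ≤ φ x) (h1 : ∀ x ∈ Icc (0 : ℝ) 1, φ x ≤ φ₁) {u v : ℝ}
    (hu : 0 ≤ u) (huv : u ≤ v) (hv : v ≤ 1) :
    φ₀ * (v - u) ≤ (∫ t in (0 : ℝ)..v, φ t) - ∫ t in (0 : ℝ)..u, φ t ∧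
      (∫ t in (0 : ℝ)..v, φ t) - ∫ t in (0 : ℝ)..u, φ t ≤ φ₁ * (v - u) := by
  have hi : ∀ a b, 0 ≤ a → a ≤ b → b ≤ 1 → IntervalIntegrable φ volume a b := by
    intro a b ha hab hb
    refine ContinuousOn.intervalIntegrable (hφ.mono ?_)
    rw [uIcc_of_le hab]
    exact Icc_subset_Icc ha hb
  have e : (∫ t in (0 : ℝ)..v, φ t) - ∫ t in (0 : ℝ)..u, φ t = ∫ t in u..v, φ t :=
    intervalIntegral.integral_interval_sub_left (hi 0 v le_rfl (hu.trans huv) hv)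
      (hi 0 u le_rfl hu (huv.trans hv))
  rw [e]
  constructor
  · have := intervalIntegral.integral_mono_on (μ := volume) huv
      (intervalIntegrable_const (c := φ₀)) (hi u v hu huv hv)
      fun x hx => h0 x ⟨hu.trans hx.1, hx.2.trans hv⟩
    rw [intervalIntegral.integral_const, smul_eq_mul] at this
    linarith
  · have := intervalIntegral.integral_mono_on (μ := volume) huv (hi u v hu huv hv)
      (intervalIntegrable_const (c := φ₁))
      fun x hx => h1 x ⟨hu.trans hx.1, hx.2.trans hv⟩
    rw [intervalIntegral.integral_const, smul_eq_mul] at this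
    linarith

lemma empirical_sub_eq (hn : 0 < n) {u v : ℝ} (huv : u ≤ v) :
    (n : ℝ) * (empiricalCDF X v - empiricalCDF X u) =
      ((Finset.univ.filter fun i => u < X i ∧ X i ≤ v).card : ℝ) := by
  have hn' : (n : ℝ) ≠ 0 := by positivity
  rw [empiricalCDF_eq, empiricalCDF_eq, ← mul_sub, mul_inv_cancel_left₀ hn', sub_eq_iff_eq_add]
  rw [← Nat.cast_add, ← Finset.card_union_of_disjoint]
  · congr 2
    ext i
    simp only [Finset.mem_filter, Finset.mem_univ, true_and, Finset.mem_union]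
    constructor
    · intro h
      rcases lt_or_ge u (X i) with h1 | h1
      · exact Or.inl ⟨h1, h⟩
      · exact Or.inr h1
    · rintro (h | h)
      · exact h.2
      · exact h.trans huv
  · rw [Finset.disjoint_filter]
    intro i _ h1 h2
    linarith [h1.1]

/-- The mass of the interval under the limit distribution, minus the sup distance once at each end
point. -/
lemma le_card_design (hn : 0 < n) (hφ : ContinuousOn φ (Icc 0 1))
    (h0 : ∀ x ∈ Icc (0 : ℝ) 1, φ₀ ≤ φ x) (h1 : ∀ x ∈ Icc (0 : ℝ) 1, φ x ≤ φ₁)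
    (hD : ∀ x ∈ Icc (0 : ℝ) 1, |empiricalCDF X x - ∫ t in (0 : ℝ)..x, φ t| ≤ D) {u v : ℝ}
    (hu : 0 ≤ u) (huv : u ≤ v) (hv : v ≤ 1) :
    (n : ℝ) * (φ₀ * (v - u) - 2 * D) ≤
      ((Finset.univ.filter fun i => u < X i ∧ X i ≤ v).card : ℝ) := by
  rw [← empirical_sub_eq hn huv]
  have h2 := abs_le.1 (hD u ⟨hu, huv.trans hv⟩)
  have h3 := abs_le.1 (hD v ⟨hu.trans huv, hv⟩)
  have h4 := (integral_density_bounds hφ h0 h1 hu huv hv).1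
  exact mul_le_mul_of_nonneg_left (by linarith [h2.1, h2.2, h3.1, h3.2]) (by positivity)

/-- Differences of the distribution function miss points sitting at the left end a, so the interval
is widened by e. If that leaves the unit interval, all points up to b are counted instead. -/
lemma card_design_le (hn : 0 < n) (hφ : ContinuousOn φ (Icc 0 1))
    (h0 : ∀ x ∈ Icc (0 : ℝ) 1, 0 ≤ φ x) (h1 : ∀ x ∈ Icc (0 : ℝ) 1, φ x ≤ φ₁)
    (hD : ∀ x ∈ Icc (0 : ℝ) 1, |empiricalCDF X x - ∫ t in (0 : ℝ)..x, φ t| ≤ D) {a b e : ℝ}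
    (ha : 0 ≤ a) (hab : a ≤ b) (hb : b ≤ 1) (he : 0 < e) :
    ((Finset.univ.filter fun i => a ≤ X i ∧ X i ≤ b).card : ℝ) ≤
      (n : ℝ) * (φ₁ * (b - a + e) + 2 * D) := by
  have hφ1 : 0 ≤ φ₁ := (h0 0 ⟨le_rfl, zero_le_one⟩).trans (h1 0 ⟨le_rfl, zero_le_one⟩)
  have hD0 : 0 ≤ D := (abs_nonneg _).trans (hD 0 ⟨le_rfl, zero_le_one⟩)
  have h3 := abs_le.1 (hD b ⟨ha.trans hab, hb⟩)
  rcases le_total 0 (a - e) with h | h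
  · have h2 := abs_le.1 (hD (a - e) ⟨h, by linarith⟩)
    have h4 := (integral_density_bounds hφ h0 h1 h (by linarith : a - e ≤ b) hb).2
    have h5 : ((Finset.univ.filter fun i => a ≤ X i ∧ X i ≤ b).card : ℝ) ≤
        ((Finset.univ.filter fun i => a - e < X i ∧ X i ≤ b).card : ℝ) := by
      refine Nat.cast_le.2 (Finset.card_le_card fun i hi => ?_)
      simp only [Finset.mem_filter, Finset.mem_univ, true_and] at hi ⊢
      exact ⟨by linarith [hi.1], hi.2⟩
    refine h5.trans ?_
    rw [← empirical_sub_eq hn (by linarith)]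
    refine mul_le_mul_of_nonneg_left ?_ (by positivity)
    have : φ₁ * (b - (a - e)) = φ₁ * (b - a + e) := by ring
    linarith [h2.1, h2.2, h3.1, h3.2]
  · have h4 := (integral_density_bounds hφ h0 h1 le_rfl (ha.trans hab) hb).2
    rw [intervalIntegral.integral_same, sub_zero, sub_zero] at h4
    have h5 : ((Finset.univ.filter fun i => a ≤ X i ∧ X i ≤ b).card : ℝ) ≤
        (n : ℝ) * empiricalCDF X b := by
      have hn' : (n : ℝ) ≠ 0 := by positivity
      rw [empiricalCDF_eq, mul_inv_cancel_left₀ hn']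
      refine Nat.cast_le.2 (Finset.card_le_card fun i hi => ?_)
      simp only [Finset.mem_filter, Finset.mem_univ, true_and] at hi ⊢
      exact hi.2
    refine h5.trans (mul_le_mul_of_nonneg_left ?_ (by positivity))
    have : φ₁ * b ≤ φ₁ * (b - a + e) := mul_le_mul_of_nonneg_left (by linarith) hφ1
    linarith [h3.1, h3.2]

variable {ρ : ℝ} {q J : ℕ} {s : ℕ → ℝ}

lemma bspline_one_eq_one (s : ℕ → ℝ) {m : ℕ} {x : ℝ} (h1 : s m ≤ x) (h2 : x < s (m + 1)) :
    bspline s 1 m x = 1 := by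
  simp [bspline, h1, h2]

/-- The constant in the stability of the B-spline basis on quasi-uniform knots. -/
def stabConst (ρ : ℝ) (q : ℕ) : ℝ := (1 + 2 * q * (ρ ^ 2 * q ^ 2 * 2 ^ q)) ^ (q - 1)

lemma one_le_stabConst (ρ : ℝ) (q : ℕ) : 1 ≤ stabConst ρ q :=
  one_le_pow₀ (le_add_of_nonneg_right (by positivity))

lemma UniformKnots.ratio_eq (h : UniformKnots ρ q J s) :
    (1 + 2 * (q : ℝ) * (ρ * q ^ 2 / J) / ((ρ * J)⁻¹ / 2 ^ q)) ^ (q - 1) = stabConst ρ q := by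
  have hJ : (0 : ℝ) < J := by exact_mod_cast h.pos
  have hρ : 0 < ρ := by linarith [h.one_le_ratio]
  rw [stabConst]
  congr 1
  field_simp

/-- Local lower bound for the empirical energy of a spline. -/
lemma UniformKnots.local_energy (h : UniformKnots ρ q J s) {N₀ : ℝ}
    (hN₀ : 0 < N₀) (hcount : ∀ u v, 0 ≤ u → v ≤ 1 → (ρ * J)⁻¹ / 2 ^ q ≤ v - u →
      N₀ ≤ ((Finset.univ.filter fun i => u < X i ∧ X i ≤ v).card : ℝ)) (θ : ℕ → ℝ) {m : ℕ}
    (hm1 : q ≤ m + 1) (hm2 : m < J) (k : ℕ) (hk1 : k ≤ m) (hk2 : m ≤ k + (q - 1))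
    (hX : ∀ i, X i ∈ Icc (0 : ℝ) 1) :
    N₀ * θ k ^ 2 ≤ stabConst ρ q ^ 2 *
      ∑ i, bspline s 1 m (X i) * splineFun s J q θ (X i) ^ 2 := by
  have hc := h.toClampedKnots
  have hm := h.lt m hm1 hm2
  have hg := h.gap m hm1 hm2
  have hq1 := h.one_le
  have hJ : (0 : ℝ) < J := by exact_mod_cast h.pos
  have hρ : 0 < ρ := by linarith [h.one_le_ratio]
  have hpow : (0 : ℝ) < 2 ^ q := by positivity
  set E := ∑ i, bspline s 1 m (X i) * splineFun s J q θ (X i) ^ 2 with hE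
  have hE0 : 0 ≤ E := Finset.sum_nonneg fun i _ =>
    mul_nonneg (hc.bspline_nonneg 1 m (hX i)) (sq_nonneg _)
  set d := (s (m + 1) - s m) / 2 ^ q with hd
  have hd0 : 0 < d := div_pos (by linarith) hpow
  have hdle : (ρ * J)⁻¹ / 2 ^ q ≤ d := div_le_div_of_nonneg_right hg hpow.le
  have htop : ∀ l : ℕ, l < 2 ^ (q - 1) → (2 * l + 1) * d < s (m + 1) - s m := by
    intro l hl
    have e : 2 ^ q = 2 * 2 ^ (q - 1) := by
      rw [← pow_succ', show q - 1 + 1 = q by omega]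
    have h2 : 2 * l + 1 < 2 ^ q := by omega
    have h3 : (2 * l + 1 : ℝ) < 2 ^ q := by exact_mod_cast h2
    have h4 : (2 * l + 1 : ℝ) * d < 2 ^ q * d := mul_lt_mul_of_pos_right h3 hd0
    rwa [hd, mul_div_cancel₀ _ hpow.ne'] at h4
  -- Cut the knot interval into 2 ^ q cells. Each even cell contains at least N₀ design points, so
  -- one of them has squared value at most E / N₀; the odd cells keep the chosen points separated.
  have hpick : ∀ l : ℕ, ∃ i, l < 2 ^ (q - 1) → s m + 2 * l * d < X i ∧
      X i ≤ s m + (2 * l + 1) * d ∧ |splineFun s J q θ (X i)| ≤ Real.sqrt (E / N₀) := by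
    intro l
    set F := Finset.univ.filter fun i => s m + 2 * l * d < X i ∧ X i ≤ s m + (2 * l + 1) * d
      with hF
    have hn : 0 < n := by
      by_contra hn0
      have hn0 : n = 0 := by omega
      subst hn0
      have := hcount 0 1 le_rfl le_rfl (by
        rw [sub_zero]
        refine hdle.trans ?_
        rw [hd, div_le_one hpow]
        have h1 := hc.le_one (m + 1)
        have h2 := hc.nonneg m
        have : (1 : ℝ) ≤ 2 ^ q := one_le_pow₀ (by norm_num)
        linarith)
      simp at this
      linarith
    by_cases hl : l < 2 ^ (q - 1)
    · have ht := htop l hl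
      have hsub : ∀ i ∈ F, s m ≤ X i ∧ X i < s (m + 1) := by
        intro i hi
        simp only [hF, Finset.mem_filter, Finset.mem_univ, true_and] at hi
        have : 0 ≤ 2 * (l : ℝ) * d := by positivity
        constructor <;> linarith [hi.1, hi.2]
      have hcard : N₀ ≤ (F.card : ℝ) := hcount _ _
        (by have := hc.nonneg m; positivity) (by linarith [hc.le_one (m + 1)])
        (by refine hdle.trans_eq ?_; ring)
      by_contra hcon
      push Not at hcon
      have hbig : ∀ i ∈ F, E / N₀ < splineFun s J q θ (X i) ^ 2 := by
        intro i hi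
        simp only [hF, Finset.mem_filter, Finset.mem_univ, true_and] at hi
        have h1 := (hcon i).2 hi.1 hi.2
        rw [← sq_abs]
        exact (Real.sqrt_lt' ((Real.sqrt_nonneg _).trans_lt h1)).1 h1
      have hne : F.Nonempty := by
        rw [← Finset.card_pos]
        have : (0 : ℝ) < F.card := hN₀.trans_le hcard
        exact_mod_cast this
      have h2 : F.card • (E / N₀) < ∑ i ∈ F, splineFun s J q θ (X i) ^ 2 :=
        (Finset.sum_const _).symm.trans_lt (Finset.sum_lt_sum_of_nonempty hne hbig)
      have h3 : ∑ i ∈ F, splineFun s J q θ (X i) ^ 2 ≤ E := by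
        have h4 : ∑ i ∈ F, splineFun s J q θ (X i) ^ 2 =
            ∑ i ∈ F, bspline s 1 m (X i) * splineFun s J q θ (X i) ^ 2 :=
          Finset.sum_congr rfl fun i hi => by
            rw [bspline_one_eq_one s (hsub i hi).1 (hsub i hi).2, one_mul]
        rw [h4]
        exact Finset.sum_le_univ_sum_of_nonneg fun i =>
          mul_nonneg (hc.bspline_nonneg 1 m (hX i)) (sq_nonneg _)
      rw [nsmul_eq_mul] at h2
      have h5 : N₀ * (E / N₀) ≤ F.card * (E / N₀) :=
        mul_le_mul_of_nonneg_right hcard (div_nonneg hE0 hN₀.le)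
      rw [mul_div_cancel₀ _ hN₀.ne'] at h5
      linarith
    · exact ⟨⟨0, hn⟩, fun hh => absurd hh hl⟩
  choose p hp using hpick
  have hmain := abs_coeff_le_of_abs_eval_le hc.mono hm hm2 (q := q) (W := ρ * q ^ 2 / J)
    (d := (ρ * J)⁻¹ / 2 ^ q) (by positivity) (fun i k _ _ hk => h.width i k hk) (q - 1)
    (by omega) (by omega) θ (Real.sqrt (E / N₀)) (fun l => X (p l))
    (fun l hl => by
      obtain ⟨h1, h2, _⟩ := hp l hl
      have h3 := htop l hl
      have : 0 ≤ 2 * (l : ℝ) * d := by positivity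
      constructor <;> linarith)
    (fun l hl => by
      obtain ⟨_, h2, _⟩ := hp l (by omega)
      obtain ⟨h1, _, _⟩ := hp (l + 1) hl
      push_cast at h1
      linarith)
    (fun l hl => by
      obtain ⟨h1, h2, h3⟩ := hp l hl
      have h4 := htop l hl
      have : 0 ≤ 2 * (l : ℝ) * d := by positivity
      rw [hc.splineFun_eq_eval hm (Or.inl ⟨by linarith, by linarith⟩)] at h3
      rw [show q - 1 + 1 = q by omega]
      exact h3)
    k hk1 hk2
  rw [h.ratio_eq] at hmain
  have h1 : θ k ^ 2 ≤ stabConst ρ q ^ 2 * (E / N₀) := by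
    rw [← sq_abs]
    refine (pow_le_pow_left₀ (abs_nonneg _) hmain 2).trans_eq ?_
    rw [mul_pow, Real.sq_sqrt (div_nonneg hE0 hN₀.le)]
  calc N₀ * θ k ^ 2 ≤ N₀ * (stabConst ρ q ^ 2 * (E / N₀)) :=
        mul_le_mul_of_nonneg_left h1 hN₀.le
    _ = stabConst ρ q ^ 2 * E := by field_simp

/-- Lower bound for the empirical Gram form of the B-spline basis. -/
lemma UniformKnots.gram_lower (h : UniformKnots ρ q J s) {N₀ : ℝ}
    (hN₀ : 0 < N₀) (hcount : ∀ u v, 0 ≤ u → v ≤ 1 → (ρ * J)⁻¹ / 2 ^ q ≤ v - u →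
      N₀ ≤ ((Finset.univ.filter fun i => u < X i ∧ X i ≤ v).card : ℝ)) (θ : ℕ → ℝ)
    (hX : ∀ i, X i ∈ Icc (0 : ℝ) 1) :
    N₀ * ∑ k ∈ Finset.range J, θ k ^ 2 ≤
      stabConst ρ q ^ 2 * (1 + q) * ∑ i, splineFun s J q θ (X i) ^ 2 := by
  have hc := h.toClampedKnots
  set S := ∑ i, splineFun s J q θ (X i) ^ 2 with hS
  have hq1 := h.one_le
  have hqJ := h.le
  set E : ℕ → ℝ := fun m => ∑ i, bspline s 1 m (X i) * splineFun s J q θ (X i) ^ 2 with hE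
  have hE0 : ∀ m, 0 ≤ E m := fun m => Finset.sum_nonneg fun i _ =>
    mul_nonneg (hc.bspline_nonneg 1 m (hX i)) (sq_nonneg _)
  have hS0 : 0 ≤ S := Finset.sum_nonneg fun i _ => sq_nonneg _
  have hEsum : ∑ m ∈ Finset.range J, E m = S := by
    rw [hE, Finset.sum_comm]
    refine Finset.sum_congr rfl fun i _ => ?_
    rw [← Finset.sum_mul, hc.sum_bspline le_rfl hq1 (hX i), one_mul]
  have hES : ∀ m < J, E m ≤ S := fun m hm => by
    rw [← hEsum]
    exact Finset.single_le_sum (fun j _ => hE0 j) (Finset.mem_range.2 hm)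
  -- A coefficient is charged to the knot interval of its own index. The first q are charged to the
  -- first genuine interval, hence to the total energy, which produces the factor 1 + q.
  have hterm : ∀ k ∈ Finset.range J,
      N₀ * θ k ^ 2 ≤ stabConst ρ q ^ 2 * (E k + if k < q then S else 0) := by
    intro k hk
    rw [Finset.mem_range] at hk
    split_ifs with hkq
    · refine (h.local_energy hN₀ hcount θ (m := q - 1) (by omega) (by omega) k (by omega)
        (by omega) hX).trans (mul_le_mul_of_nonneg_left ?_ (by positivity))
      have h1 := hES (q - 1) (by omega)
      have h2 := hE0 k
      simp only [hE] at h1 h2 ⊢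
      linarith
    · rw [add_zero]
      exact h.local_energy hN₀ hcount θ (m := k) (by omega) hk k le_rfl (by omega) hX
  rw [Finset.mul_sum]
  refine (Finset.sum_le_sum hterm).trans ?_
  rw [← Finset.mul_sum, Finset.sum_add_distrib, hEsum, mul_assoc]
  refine mul_le_mul_of_nonneg_left ?_ (by positivity)
  have h1 : ∑ k ∈ Finset.range J, (if k < q then S else 0) ≤ q * S := by
    rw [← Finset.sum_filter, Finset.sum_const, nsmul_eq_mul]
    refine mul_le_mul_of_nonneg_right ?_ hS0
    have h2 : ((Finset.range J).filter fun k => k < q).card ≤ (Finset.range q).card :=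
      Finset.card_le_card fun k hk => by
        simp only [Finset.mem_filter, Finset.mem_range] at hk ⊢
        exact hk.2
    rw [Finset.card_range] at h2
    exact_mod_cast h2
  linarith

/-- A basis function is at most 1 and lives on an interval of width ρq²/J. -/
lemma UniformKnots.column_sum_le (h : UniformKnots ρ q J s) {N₁ : ℝ}
    (hcount : ∀ a b, 0 ≤ a → a ≤ b → b ≤ 1 → b - a ≤ ρ * q ^ 2 / J →
      ((Finset.univ.filter fun i => a ≤ X i ∧ X i ≤ b).card : ℝ) ≤ N₁)
    (hX : ∀ i, X i ∈ Icc (0 : ℝ) 1) {k : ℕ} (hk : k < J) :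
    ∑ i, bspline s q k (X i) ≤ N₁ := by
  have hc := h.toClampedKnots
  refine le_trans ?_ (hcount (s k) (s (k + q)) (hc.nonneg _) (hc.mono (by omega)) (hc.le_one _)
    (h.width k q le_rfl))
  rw [Finset.card_filter]
  push_cast
  refine Finset.sum_le_sum fun i _ => ?_
  split_ifs with hi
  · exact hc.bspline_le_one h.one_le le_rfl hk (hX i)
  · by_contra hcon
    exact hi (hc.bspline_support (hX i) (by linarith))

end Design

end

end BayesLepski


namespace BayesLepski

noncomputable section

/-! ### Sup-norm error of the posterior mean and bounds on the empirical variance. -/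

section Posterior

/-- Extension of a coefficient vector by zero. -/
def extendCoeff {J : ℕ} (v : Fin J → ℝ) (k : ℕ) : ℝ := if h : k < J then v ⟨k, h⟩ else 0

lemma extendCoeff_coe {J : ℕ} (v : Fin J → ℝ) (k : Fin J) : extendCoeff v k = v k := by
  simp [extendCoeff]

lemma bvec_dotProduct {q J : ℕ} (T : KnotPartition (J - q)) (v : Fin J → ℝ) (x : ℝ) :
    bvec q J T x ⬝ᵥ v = splineFun (T.extended q) J q (extendCoeff v) x := by
  rw [splineFun, ← Fin.sum_univ_eq_sum_range
    (fun k => extendCoeff v k * bspline (T.extended q) q k x), dotProduct]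
  refine Finset.sum_congr rfl fun k _ => ?_
  rw [extendCoeff_coe, bvec, mul_comm]

lemma basisMatrix_mulVec {q J n : ℕ} (T : KnotPartition (J - q)) (X : Fin n → ℝ)
    (v : Fin J → ℝ) (i : Fin n) :
    (basisMatrix q J T X *ᵥ v) i = splineFun (T.extended q) J q (extendCoeff v) (X i) :=
  bvec_dotProduct T v (X i)

/-- A prior and a design for which the B-spline basis of dimension `J` is well conditioned. -/
structure PosteriorSetting (ρ c₁ cη a b : ℝ) (q r : ℕ) {J n : ℕ} (T : KnotPartition (J - q))
    (X : Fin n → ℝ) (η : Fin J → ℝ) (Ω : Matrix (Fin J) (Fin J) ℝ) : Prop where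
  c₁_pos : 0 < c₁
  a_pos : 0 < a
  b_nonneg : 0 ≤ b
  knots : UniformKnots ρ q J (T.extended q)
  le : J ≤ n
  mem : ∀ i, X i ∈ Icc (0 : ℝ) 1
  mean_le : ∀ i, |η i| ≤ cη
  hermitian : Ω.IsHermitian
  eig : ∀ i, c₁ ≤ hermitian.eigenvalues i
  band : ∀ i j : Fin J, (r : ℤ) < |(i : ℤ) - (j : ℤ)| → Ω⁻¹ i j = 0
  gram_lower : ∀ θ : ℕ → ℝ, a * (n / J) * ∑ k ∈ Finset.range J, θ k ^ 2 ≤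
    ∑ i, splineFun (T.extended q) J q θ (X i) ^ 2
  column_sum : ∀ k < J, ∑ i, bspline (T.extended q) q k (X i) ≤ b * (n / J)

/-- Approximation constant for splines on quasi-uniform knots. -/
def approxConst (ρ : ℝ) (q : ℕ) : ℝ := (ρ * q ^ 2) ^ q

/-- Bound for the sup-norm of the inverse of the posterior precision, up to the factor `J / n`. -/
def solveConst (c₁ a b : ℝ) (q r : ℕ) : ℝ :=
  (a + b + c₁⁻¹)⁻¹ * bandConst (q + r) (1 - a / (a + b + c₁⁻¹))

/-- Bound for the B-spline coefficients, minus the prior mean, of a good approximation. -/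
def coeffConst (ρ cη : ℝ) (q : ℕ) : ℝ := cη + stabConst ρ q * (1 + approxConst ρ q)

/-- Constant in front of the approximation error. -/
def biasConst (ρ c₁ a b : ℝ) (q r : ℕ) : ℝ := (1 + solveConst c₁ a b q r * b) * approxConst ρ q

/-- Constant in front of the prior bias. -/
def priorConst (ρ c₁ cη a b : ℝ) (q r : ℕ) : ℝ :=
  solveConst c₁ a b q r * ((2 * r + 1) * c₁⁻¹ * coeffConst ρ cη q)

namespace PosteriorSetting

variable {ρ c₁ cη a b : ℝ} {q r J n : ℕ} {T : KnotPartition (J - q)}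
  {X : Fin n → ℝ} {η : Fin J → ℝ} {Ω : Matrix (Fin J) (Fin J) ℝ}

lemma posDef (h : PosteriorSetting ρ c₁ cη a b q r T X η Ω) : Ω.PosDef :=
  posDef_of_le_eigenvalues h.hermitian h.c₁_pos h.eig

lemma J_pos (h : PosteriorSetting ρ c₁ cη a b q r T X η Ω) : (0 : ℝ) < J := by
  exact_mod_cast h.knots.pos

lemma n_pos (h : PosteriorSetting ρ c₁ cη a b q r T X η Ω) : (0 : ℝ) < n := by
  exact_mod_cast lt_of_lt_of_le h.knots.pos h.le

lemma one_le_ratio (h : PosteriorSetting ρ c₁ cη a b q r T X η Ω) : (1 : ℝ) ≤ n / J := by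
  rw [one_le_div h.J_pos]
  exact_mod_cast h.le

lemma cη_nonneg (h : PosteriorSetting ρ c₁ cη a b q r T X η Ω) : 0 ≤ cη :=
  (abs_nonneg _).trans (h.mean_le ⟨0, h.knots.pos⟩)

lemma one_le_approxConst (h : PosteriorSetting ρ c₁ cη a b q r T X η Ω) :
    1 ≤ approxConst ρ q := by
  have h1 := h.knots.one_le_ratio
  have h2 : (1 : ℝ) ≤ q := by exact_mod_cast h.knots.one_le
  exact one_le_pow₀ (by nlinarith)

lemma solveConst_nonneg (h : PosteriorSetting ρ c₁ cη a b q r T X η Ω) :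
    0 ≤ solveConst c₁ a b q r := by
  have h1 := h.c₁_pos
  have h2 := h.a_pos
  have h3 := h.b_nonneg
  have h4 : 0 < a + b + c₁⁻¹ := by positivity
  refine mul_nonneg (inv_nonneg.2 h4.le) (bandConst_nonneg _ ?_)
  rw [sub_nonneg, div_le_one h4]
  have : 0 < c₁⁻¹ := by positivity
  linarith

lemma mulVec_sq (v : Fin J → ℝ) :
    (basisMatrix q J T X *ᵥ v) ⬝ᵥ (basisMatrix q J T X *ᵥ v) =
      ∑ i, splineFun (T.extended q) J q (extendCoeff v) (X i) ^ 2 := by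
  rw [dotProduct_self_eq_sum_sq]
  exact Finset.sum_congr rfl fun i _ => by rw [basisMatrix_mulVec]

lemma sum_extendCoeff_sq (v : Fin J → ℝ) :
    ∑ k ∈ Finset.range J, extendCoeff v k ^ 2 = v ⬝ᵥ v := by
  rw [← Fin.sum_univ_eq_sum_range (fun k => extendCoeff v k ^ 2), dotProduct_self_eq_sum_sq]
  exact Finset.sum_congr rfl fun i _ => by rw [extendCoeff_coe]

lemma form_lower (h : PosteriorSetting ρ c₁ cη a b q r T X η Ω) (v : Fin J → ℝ) :
    a * (n / J) * (v ⬝ᵥ v) ≤ (basisMatrix q J T X *ᵥ v) ⬝ᵥ (basisMatrix q J T X *ᵥ v) := by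
  rw [mulVec_sq, ← sum_extendCoeff_sq]
  exact h.gram_lower _

/-- Since the basis is a partition of unity, Cauchy–Schwarz gives (∑ θ_k B_k)² ≤ ∑ θ_k² B_k; the
column sums do the rest. -/
lemma form_upper (h : PosteriorSetting ρ c₁ cη a b q r T X η Ω) (v : Fin J → ℝ) :
    (basisMatrix q J T X *ᵥ v) ⬝ᵥ (basisMatrix q J T X *ᵥ v) ≤ b * (n / J) * (v ⬝ᵥ v) := by
  have hc := h.knots.toClampedKnots
  rw [mulVec_sq, ← sum_extendCoeff_sq]
  have h1 : ∀ i, splineFun (T.extended q) J q (extendCoeff v) (X i) ^ 2 ≤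
      ∑ k ∈ Finset.range J, extendCoeff v k ^ 2 * bspline (T.extended q) q k (X i) := by
    intro i
    have h2 := Finset.sum_sq_le_sum_mul_sum_of_sq_le_mul (Finset.range J)
      (r := fun k => extendCoeff v k * bspline (T.extended q) q k (X i))
      (f := fun k => bspline (T.extended q) q k (X i))
      (g := fun k => extendCoeff v k ^ 2 * bspline (T.extended q) q k (X i))
      (fun k _ => hc.bspline_nonneg q k (h.mem i))
      (fun k _ => mul_nonneg (sq_nonneg _) (hc.bspline_nonneg q k (h.mem i)))
      (fun k _ => le_of_eq (by ring))
    rwa [hc.sum_bspline hc.one_le le_rfl (h.mem i), one_mul] at h2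
  refine (Finset.sum_le_sum fun i _ => h1 i).trans ?_
  rw [Finset.sum_comm, Finset.mul_sum]
  refine Finset.sum_le_sum fun k hk => ?_
  rw [← Finset.mul_sum, mul_comm]
  exact mul_le_mul_of_nonneg_right (h.column_sum k (Finset.mem_range.1 hk)) (sq_nonneg _)

lemma precision_band (h : PosteriorSetting ρ c₁ cη a b q r T X η Ω) (i j : Fin J)
    (hij : ((q + r : ℕ) : ℤ) < |(i : ℤ) - (j : ℤ)|) :
    ((basisMatrix q J T X)ᵀ * basisMatrix q J T X + Ω⁻¹) i j = 0 := by
  have hc := h.knots.toClampedKnots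
  rw [Matrix.add_apply, h.band i j (by push_cast at hij; linarith), add_zero, Matrix.mul_apply]
  refine Finset.sum_eq_zero fun l _ => ?_
  change bspline (T.extended q) q i (X l) * bspline (T.extended q) q j (X l) = 0
  rcases le_total (i : ℕ) j with hle | hle
  · refine hc.bspline_mul_eq_zero ?_ (h.mem l)
    rw [abs_sub_comm, abs_of_nonneg (by omega)] at hij
    omega
  · rw [mul_comm]
    refine hc.bspline_mul_eq_zero ?_ (h.mem l)
    rw [abs_of_nonneg (by omega)] at hij
    omega

lemma abs_solve_le (h : PosteriorSetting ρ c₁ cη a b q r T X η Ω) {u v : Fin J → ℝ}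
    (huv : ((basisMatrix q J T X)ᵀ * basisMatrix q J T X + Ω⁻¹) *ᵥ u = v) {V : ℝ}
    (hv : ∀ i, |v i| ≤ V) (i : Fin J) : |u i| ≤ solveConst c₁ a b q r * (J / n * V) := by
  have h1 := h.c₁_pos
  have h2 := h.a_pos
  have h3 := h.b_nonneg
  have h4 := h.one_le_ratio
  have h5 : 0 < c₁⁻¹ := by positivity
  have hr : (0 : ℝ) < n / J := by linarith
  -- The prior form is absorbed because n / J ≥ 1. Including a in the upper constant makes it
  -- strictly larger than the lower one.
  have h6 := abs_le_of_banded_mulVec_eq (posterior_transpose (basisMatrix q J T X) h.posDef)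
    h.precision_band (a := a * (n / J)) (b := (a + b + c₁⁻¹) * (n / J)) (by positivity)
    (mul_lt_mul_of_pos_right (by linarith) hr)
    (fun v => by
      rw [posterior_form]
      have := h.form_lower v
      have := inv_form_nonneg h.posDef v
      linarith)
    (fun v => by
      rw [posterior_form]
      have e1 := h.form_upper v
      have e2 := inv_form_le h.hermitian h.c₁_pos h.eig v
      have e3 := dotProduct_self_nonneg' v
      have e4 : c₁⁻¹ * (v ⬝ᵥ v) ≤ c₁⁻¹ * (n / J) * (v ⬝ᵥ v) :=
        mul_le_mul_of_nonneg_right (le_mul_of_one_le_right h5.le h4) e3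
      have e5 : 0 ≤ a * (n / J) * (v ⬝ᵥ v) := by positivity
      linarith)
    huv hv i
  refine h6.trans_eq ?_
  have hn := h.n_pos
  have hJ := h.J_pos
  rw [mul_div_mul_right _ _ hr.ne', solveConst]
  field_simp

/-- Good spline approximation with bounded coefficients. -/
lemma exists_approx (h : PosteriorSetting ρ c₁ cη a b q r T X η Ω) {α : ℝ} (hα : 0 < α)
    (hαq : α ≤ q) {f₀ : ℝ → ℝ} (hf : holderENorm α f₀ ≠ ⊤) :
    ∃ θ : Fin J → ℝ,
      (∀ x ∈ Icc (0 : ℝ) 1, |f₀ x - splineFun (T.extended q) J q (extendCoeff θ) x| ≤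
        approxConst ρ q * ((holderENorm α f₀).toReal * (J : ℝ) ^ (-α))) ∧
      ∀ k, |η k - θ k| ≤ coeffConst ρ cη q * (1 + (holderENorm α f₀).toReal) := by
  have hc := h.knots.toClampedKnots
  have hJ := h.J_pos
  have hρ := h.knots.one_le_ratio
  have hq : (1 : ℝ) ≤ q := by exact_mod_cast h.knots.one_le
  have hW0 : (0 : ℝ) < ρ * q ^ 2 / J := by positivity
  set L := (holderENorm α f₀).toReal with hL
  have hL0 : 0 ≤ L := ENNReal.toReal_nonneg
  obtain ⟨θ', hθ'⟩ := hc.exists_approx hW0 h.knots.width hα hαq hf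
  set θ : Fin J → ℝ := fun k => θ' k with hθ
  have hext : ∀ x, splineFun (T.extended q) J q (extendCoeff θ) x =
      splineFun (T.extended q) J q θ' x := by
    intro x
    refine Finset.sum_congr rfl fun k hk => ?_
    rw [extendCoeff, dif_pos (Finset.mem_range.1 hk)]
  have hρq : 1 ≤ ρ * q ^ 2 := by nlinarith
  have hrate : (ρ * q ^ 2 / J) ^ α ≤ approxConst ρ q * (J : ℝ) ^ (-α) := by
    rw [Real.div_rpow (by positivity) hJ.le, Real.rpow_neg hJ.le, div_eq_mul_inv]
    refine mul_le_mul_of_nonneg_right ?_ (by positivity)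
    rw [approxConst, ← Real.rpow_natCast (ρ * q ^ 2) q]
    exact Real.rpow_le_rpow_of_exponent_le hρq hαq
  have happ : ∀ x ∈ Icc (0 : ℝ) 1, |f₀ x - splineFun (T.extended q) J q (extendCoeff θ) x| ≤
      approxConst ρ q * (L * (J : ℝ) ^ (-α)) := by
    intro x hx
    rw [hext]
    refine (hθ' x hx).trans ?_
    rw [mul_left_comm]
    exact mul_le_mul_of_nonneg_left hrate hL0
  have hJ1 : (J : ℝ) ^ (-α) ≤ 1 :=
    Real.rpow_le_one_of_one_le_of_nonpos (by exact_mod_cast h.knots.pos) (by linarith)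
  have hA := h.one_le_approxConst
  -- The approximant is bounded, f₀ being bounded by its Hölder norm and J ^ (-α) ≤ 1; basis
  -- stability then bounds its coefficients uniformly in J.
  have hbd : ∀ x ∈ Icc (0 : ℝ) 1, |splineFun (T.extended q) J q (extendCoeff θ) x| ≤
      L + approxConst ρ q * L := by
    intro x hx
    have h1 := happ x hx
    have h2 := (exists_holder_data hα hαq hf).1 x hx
    have h3 : approxConst ρ q * (L * (J : ℝ) ^ (-α)) ≤ approxConst ρ q * L :=
      mul_le_mul_of_nonneg_left (mul_le_of_le_one_right hL0 hJ1) (by linarith)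
    have h4 := abs_sub_abs_le_abs_sub (splineFun (T.extended q) J q (extendCoeff θ) x) (f₀ x)
    rw [abs_sub_comm] at h4
    linarith
  refine ⟨θ, happ, fun k => ?_⟩
  have h1 := hc.abs_coeff_le (w := (ρ * J)⁻¹) (by positivity) hW0.le h.knots.width h.knots.gap
    hbd k.2
  rw [h.knots.ratio_eq, extendCoeff_coe] at h1
  have h2 := h.mean_le k
  have h3 := abs_sub (η k) (θ k)
  have h4 := one_le_stabConst ρ q
  have h5 := h.cη_nonneg
  have h6 : 0 ≤ cη * L := by positivity
  have h7 : 0 ≤ stabConst ρ q * (1 + approxConst ρ q) := by positivity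
  rw [coeffConst]
  have h8 : stabConst ρ q * (L + approxConst ρ q * L) =
    stabConst ρ q * (1 + approxConst ρ q) * L := by ring
  linarith

lemma coeffConst_nonneg (h : PosteriorSetting ρ c₁ cη a b q r T X η Ω) :
    0 ≤ coeffConst ρ cη q := by
  have h1 := h.cη_nonneg
  have h2 := one_le_stabConst ρ q
  have h3 := h.one_le_approxConst
  rw [coeffConst]
  positivity

lemma transpose_mulVec_le (h : PosteriorSetting ρ c₁ cη a b q r T X η Ω) {g : Fin n → ℝ} {e : ℝ}
    (he : ∀ i, |g i| ≤ e) (k : Fin J) :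
    |((basisMatrix q J T X)ᵀ *ᵥ g) k| ≤ b * (n / J) * e := by
  have hc := h.knots.toClampedKnots
  have he0 : 0 ≤ e := by
    have hn : 0 < n := lt_of_lt_of_le h.knots.pos h.le
    exact (abs_nonneg _).trans (he ⟨0, hn⟩)
  have e1 : ((basisMatrix q J T X)ᵀ *ᵥ g) k = ∑ i, bspline (T.extended q) q k (X i) * g i := rfl
  rw [e1]
  refine (Finset.abs_sum_le_sum_abs _ _).trans ?_
  have h1 : ∀ i ∈ Finset.univ, |bspline (T.extended q) q k (X i) * g i| ≤
      bspline (T.extended q) q k (X i) * e := fun i _ => by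
    have h2 := hc.bspline_nonneg q k (h.mem i)
    rw [abs_mul, abs_of_nonneg h2]
    exact mul_le_mul_of_nonneg_left (he i) h2
  refine (Finset.sum_le_sum h1).trans ?_
  rw [← Finset.sum_mul]
  exact mul_le_mul_of_nonneg_right (h.column_sum k k.2) he0

/-- The sup-norm error of the posterior mean: approximation error, prior bias and noise. -/
lemma abs_sub_postMean_le (h : PosteriorSetting ρ c₁ cη a b q r T X η Ω) {α : ℝ} (hα : 0 < α)
    (hαq : α ≤ q) {f₀ : ℝ → ℝ} (hf : holderENorm α f₀ ≠ ⊤) {Y : Fin n → ℝ} {ν : ℝ}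
    (hν : ∀ k, |∑ i, (((basisMatrix q J T X)ᵀ * basisMatrix q J T X + Ω⁻¹)⁻¹ *
      (basisMatrix q J T X)ᵀ) k i * (Y i - f₀ (X i))| ≤ ν) {x : ℝ} (hx : x ∈ Icc (0 : ℝ) 1) :
    |f₀ x - postMean q J T X η Ω Y x| ≤
      biasConst ρ c₁ a b q r * ((holderENorm α f₀).toReal * (J : ℝ) ^ (-α))
        + priorConst ρ c₁ cη a b q r * (1 + (holderENorm α f₀).toReal) * (J / n) + ν := by
  obtain ⟨θ, hθ1, hθ2⟩ := h.exists_approx hα hαq hf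
  set B := basisMatrix q J T X with hB
  set M := Bᵀ * B + Ω⁻¹ with hM
  set L := (holderENorm α f₀).toReal with hL
  set e := approxConst ρ q * (L * (J : ℝ) ^ (-α)) with he
  set m := M⁻¹ *ᵥ (Bᵀ *ᵥ Y + Ω⁻¹ *ᵥ η) with hm
  set ε : Fin n → ℝ := fun i => Y i - f₀ (X i) with hε
  set g : Fin n → ℝ := fun i => f₀ (X i) - (B *ᵥ θ) i with hg
  have hc := h.knots.toClampedKnots
  have hpm : postMean q J T X η Ω Y x = splineFun (T.extended q) J q (extendCoeff m) x := by
    rw [← bvec_dotProduct]; rfl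
  have hMm : M *ᵥ m = Bᵀ *ᵥ Y + Ω⁻¹ *ᵥ η := by
    rw [hm, Matrix.mulVec_mulVec, posterior_mul_inv B h.posDef, Matrix.one_mulVec]
  have hMw : M *ᵥ ((M⁻¹ * Bᵀ) *ᵥ ε) = Bᵀ *ᵥ ε := by
    rw [Matrix.mulVec_mulVec, ← Matrix.mul_assoc, posterior_mul_inv B h.posDef, Matrix.one_mul]
  have hY : Y = ε + g + B *ᵥ θ := by
    funext i
    simp [hε, hg]
  -- Removing the noise part of the posterior coefficients leaves a deterministic equation, driven
  -- by the approximation error g at the design points and by the prior pull η - θ.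
  have hsolve : M *ᵥ (m - θ - (M⁻¹ * Bᵀ) *ᵥ ε) = Bᵀ *ᵥ g + Ω⁻¹ *ᵥ (η - θ) := by
    rw [Matrix.mulVec_sub, Matrix.mulVec_sub, hMm, hMw]
    nth_rewrite 1 [hY]
    rw [hM, Matrix.add_mulVec, Matrix.mulVec_add, Matrix.mulVec_add, Matrix.mulVec_sub,
      ← Matrix.mulVec_mulVec]
    abel
  have hgle : ∀ i, |g i| ≤ e := by
    intro i
    simp only [hg]
    rw [hB, basisMatrix_mulVec]
    exact hθ1 (X i) (h.mem i)
  have hc1 : 0 < c₁⁻¹ := inv_pos.2 h.c₁_pos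
  have hrhs : ∀ i, |(Bᵀ *ᵥ g + Ω⁻¹ *ᵥ (η - θ)) i| ≤
      b * (n / J) * e + (2 * r + 1) * c₁⁻¹ * (coeffConst ρ cη q * (1 + L)) := by
    intro i
    refine (abs_add_le _ _).trans (add_le_add (h.transpose_mulVec_le hgle i) ?_)
    exact abs_mulVec_le_of_banded h.band hc1.le
      (abs_inv_entry_le h.hermitian h.c₁_pos h.eig) hθ2 i
  have hK := h.solveConst_nonneg
  have hu : ∀ k, |θ k - m k| ≤ solveConst c₁ a b q r * (J / n *
      (b * (n / J) * e + (2 * r + 1) * c₁⁻¹ * (coeffConst ρ cη q * (1 + L)))) + ν := by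
    intro k
    have h1 := h.abs_solve_le hsolve hrhs k
    have h2 : |((M⁻¹ * Bᵀ) *ᵥ ε) k| ≤ ν := hν k
    have h3 : θ k - m k = -((m - θ - (M⁻¹ * Bᵀ) *ᵥ ε) k) - ((M⁻¹ * Bᵀ) *ᵥ ε) k := by
      simp only [Pi.sub_apply]; ring
    rw [h3]
    refine (abs_sub _ _).trans ?_
    rw [abs_neg]
    exact add_le_add h1 h2
  have hspl : |splineFun (T.extended q) J q (extendCoeff θ) x -
      splineFun (T.extended q) J q (extendCoeff m) x| ≤ solveConst c₁ a b q r * (J / n *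
      (b * (n / J) * e + (2 * r + 1) * c₁⁻¹ * (coeffConst ρ cη q * (1 + L)))) + ν := by
    have e1 : splineFun (T.extended q) J q (extendCoeff θ) x -
        splineFun (T.extended q) J q (extendCoeff m) x =
        splineFun (T.extended q) J q (fun k => extendCoeff θ k - extendCoeff m k) x := by
      simp only [splineFun, sub_mul, Finset.sum_sub_distrib]
    rw [e1]
    refine hc.abs_splineFun_le hc.one_le le_rfl hx _ _ fun k hk => ?_
    simp only [extendCoeff, dif_pos hk]
    exact hu _
  rw [hpm]
  refine (abs_sub_le _ (splineFun (T.extended q) J q (extendCoeff θ) x) _).trans ?_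
  have h1 := hθ1 x hx
  have hn := h.n_pos
  have hJ := h.J_pos
  have e2 : solveConst c₁ a b q r * (J / n *
      (b * (n / J) * e + (2 * r + 1) * c₁⁻¹ * (coeffConst ρ cη q * (1 + L)))) =
      solveConst c₁ a b q r * b * e + priorConst ρ c₁ cη a b q r * (1 + L) * (J / n) := by
    rw [priorConst]
    field_simp
  have e3 : biasConst ρ c₁ a b q r * (L * (J : ℝ) ^ (-α)) =
      e + solveConst c₁ a b q r * b * e := by
    rw [biasConst, he]; ring
  rw [e2] at hspl
  rw [e3]
  linarith

/-- Lower bound for the empirical Bayes estimate of the standard deviation. -/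
lemma le_sigmaHat (h : PosteriorSetting ρ c₁ cη a b q r T X η Ω) {f₀ : ℝ → ℝ} {σ₀ : ℝ}
    (hσ₀ : 0 < σ₀) {Y : Fin n → ℝ} (hY : n * σ₀ ^ 2 / 2 ≤ ∑ i, (Y i - f₀ (X i)) ^ 2)
    (herr : ∀ x ∈ Icc (0 : ℝ) 1, |f₀ x - postMean q J T X η Ω Y x| ≤ σ₀ / 4) :
    σ₀ / 4 ≤ sigmaHat q J T X η Ω Y := by
  have hn := h.n_pos
  rw [sigmaHat]
  refine Real.le_sqrt_of_sq_le ?_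
  set B := basisMatrix q J T X with hB
  set M := Bᵀ * B + Ω⁻¹ with hM
  have h1 := le_marginal_form B h.posDef (Y - B *ᵥ η)
  -- Centring the data at the prior mean does not change the residual of the posterior fit.
  have hres : ∀ i, ((Y - B *ᵥ η) - B *ᵥ (M⁻¹ *ᵥ (Bᵀ *ᵥ (Y - B *ᵥ η)))) i =
      Y i - postMean q J T X η Ω Y (X i) := by
    intro i
    have e1 : M⁻¹ *ᵥ (Bᵀ *ᵥ Y + Ω⁻¹ *ᵥ η) = η + M⁻¹ *ᵥ (Bᵀ *ᵥ (Y - B *ᵥ η)) := by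
      have e2 : η = M⁻¹ *ᵥ (M *ᵥ η) := by
        rw [Matrix.mulVec_mulVec, posterior_inv_mul B h.posDef, Matrix.one_mulVec]
      nth_rewrite 2 [e2]
      rw [← Matrix.mulVec_add, hM, Matrix.add_mulVec, Matrix.mulVec_sub, ← Matrix.mulVec_mulVec]
      congr 1
      abel
    have e3 : postMean q J T X η Ω Y (X i) = (B *ᵥ (M⁻¹ *ᵥ (Bᵀ *ᵥ Y + Ω⁻¹ *ᵥ η))) i := rfl
    rw [e3, e1, Matrix.mulVec_add]
    simp only [Pi.sub_apply, Pi.add_apply]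
    ring
  rw [← hM, dotProduct_self_eq_sum_sq] at h1
  simp only [hres] at h1
  -- Summation gives nσ₀²/2 ≤ 2 RSS + nσ₀²/8, so RSS ≥ 3nσ₀²/16, more than the nσ₀²/16 required.
  have h2 : ∀ i, (Y i - f₀ (X i)) ^ 2 ≤
      2 * (Y i - postMean q J T X η Ω Y (X i)) ^ 2 + 2 * (σ₀ / 4) ^ 2 := by
    intro i
    have h3 := herr (X i) (h.mem i)
    have h4 : (f₀ (X i) - postMean q J T X η Ω Y (X i)) ^ 2 ≤ (σ₀ / 4) ^ 2 := by
      rw [← sq_abs]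
      exact pow_le_pow_left₀ (abs_nonneg _) h3 2
    nlinarith [sq_nonneg ((Y i - postMean q J T X η Ω Y (X i)) +
      (f₀ (X i) - postMean q J T X η Ω Y (X i)))]
  have h3 := Finset.sum_le_sum fun i (_ : i ∈ Finset.univ) => h2 i
  rw [Finset.sum_add_distrib, ← Finset.mul_sum, Finset.sum_const, Finset.card_univ,
    Fintype.card_fin, nsmul_eq_mul] at h3
  rw [← div_eq_inv_mul, le_div_iff₀ hn]
  have : 0 < n * σ₀ ^ 2 := by positivity
  nlinarith

/-- Upper bound for the empirical Bayes estimate of the standard deviation. -/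
lemma sigmaHat_le (h : PosteriorSetting ρ c₁ cη a b q r T X η Ω) {α : ℝ} (hα : 0 < α)
    (hαq : α ≤ q) {f₀ : ℝ → ℝ} (hf : holderENorm α f₀ ≠ ⊤) {σ₀ : ℝ} (hσ₀ : 0 < σ₀)
    {Y : Fin n → ℝ} (hY : ∑ i, (Y i - f₀ (X i)) ^ 2 ≤ 3 / 2 * (n * σ₀ ^ 2))
    (hprior : c₁⁻¹ * (coeffConst ρ cη q * (1 + (holderENorm α f₀).toReal)) ^ 2 * (J / n) ≤
      σ₀ ^ 2) :
    sigmaHat q J T X η Ω Y ≤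
      2 * σ₀ + 2 * approxConst ρ q * ((holderENorm α f₀).toReal * (J : ℝ) ^ (-α)) := by
  obtain ⟨θ, hθ1, hθ2⟩ := h.exists_approx hα hαq hf
  have hn := h.n_pos
  have hJ := h.J_pos
  set B := basisMatrix q J T X with hB
  set L := (holderENorm α f₀).toReal with hL
  set e := approxConst ρ q * (L * (J : ℝ) ^ (-α)) with he
  have hL0 : 0 ≤ L := ENNReal.toReal_nonneg
  have hA := h.one_le_approxConst
  have he0 : 0 ≤ e := by positivity
  rw [sigmaHat]
  refine Real.sqrt_le_iff.2 ⟨by positivity, ?_⟩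
  -- The trial vector is the good approximation θ, recentred at the prior mean.
  have h1 := marginal_form_le B h.posDef (Y - B *ᵥ η) (θ - η)
  have hz : (Y - B *ᵥ η) - B *ᵥ (θ - η) = Y - B *ᵥ θ := by
    rw [Matrix.mulVec_sub]; abel
  rw [hz, dotProduct_self_eq_sum_sq] at h1
  have h2 : ∀ i, (Y - B *ᵥ θ) i ^ 2 ≤ 2 * (Y i - f₀ (X i)) ^ 2 + 2 * e ^ 2 := by
    intro i
    have h3 := hθ1 (X i) (h.mem i)
    have h4 : (f₀ (X i) - (B *ᵥ θ) i) ^ 2 ≤ e ^ 2 := by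
      rw [hB, basisMatrix_mulVec, ← sq_abs]
      exact pow_le_pow_left₀ (abs_nonneg _) h3 2
    rw [Pi.sub_apply]
    nlinarith [sq_nonneg ((Y i - f₀ (X i)) - (f₀ (X i) - (B *ᵥ θ) i))]
  have h3 := Finset.sum_le_sum fun i (_ : i ∈ Finset.univ) => h2 i
  rw [Finset.sum_add_distrib, ← Finset.mul_sum, Finset.sum_const, Finset.card_univ,
    Fintype.card_fin, nsmul_eq_mul] at h3
  have h4 := inv_form_le h.hermitian h.c₁_pos h.eig (θ - η)
  have h5 : (θ - η) ⬝ᵥ (θ - η) ≤ J * (coeffConst ρ cη q * (1 + L)) ^ 2 := by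
    have := dotProduct_self_le_of_abs_le (v := θ - η) (V := coeffConst ρ cη q * (1 + L))
      (fun k => by rw [Pi.sub_apply, abs_sub_comm]; exact hθ2 k)
    simpa using this
  have hc1 : 0 < c₁⁻¹ := inv_pos.2 h.c₁_pos
  have h6 : c₁⁻¹ * ((θ - η) ⬝ᵥ (θ - η)) ≤ n * σ₀ ^ 2 := by
    calc c₁⁻¹ * ((θ - η) ⬝ᵥ (θ - η)) ≤ c₁⁻¹ * (J * (coeffConst ρ cη q * (1 + L)) ^ 2) :=
          mul_le_mul_of_nonneg_left h5 hc1.le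
      _ = n * (c₁⁻¹ * (coeffConst ρ cη q * (1 + L)) ^ 2 * (J / n)) := by field_simp
      _ ≤ n * σ₀ ^ 2 := mul_le_mul_of_nonneg_left hprior hn.le
  rw [← div_eq_inv_mul, div_le_iff₀ hn]
  have h7 : 0 ≤ σ₀ * e := by positivity
  -- The budget is 3nσ₀² from the noise, nσ₀² from the prior penalty and 2ne² from the
  -- approximation.
  have h8 : (2 * σ₀ + 2 * approxConst ρ q * (L * (J : ℝ) ^ (-α))) ^ 2 * n =
      n * (4 * σ₀ ^ 2) + n * (8 * (σ₀ * e)) + n * (4 * e ^ 2) := by rw [he]; ring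
  have h9 : 0 ≤ n * (σ₀ * e) := by positivity
  have h10 : 0 ≤ n * e ^ 2 := by positivity
  rw [h8]
  linarith

/-- The posterior mean is a spline. -/
lemma postMean_mem_splineSpace (h : PosteriorSetting ρ c₁ cη a b q r T X η Ω) (Y : Fin n → ℝ) :
    postMean q J T X η Ω Y ∈ splineSpace q T := by
  have : postMean q J T X η Ω Y = splineFun (T.extended q) J q (extendCoeff
      (((basisMatrix q J T X)ᵀ * basisMatrix q J T X + Ω⁻¹)⁻¹ *ᵥ
        ((basisMatrix q J T X)ᵀ *ᵥ Y + Ω⁻¹ *ᵥ η))) := by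
    funext x
    rw [← bvec_dotProduct]; rfl
  rw [this]
  exact splineFun_mem_splineSpace h.knots.one_le h.knots.le T _

end PosteriorSetting

end Posterior

end

end BayesLepski


namespace BayesLepski

noncomputable section

/-! ### Deterministic comparison of the selected index with the oracle index. -/

section LepskiRule

/-- The stochastic rate `√(J log J / n)`. -/
def rate (n J : ℕ) : ℝ := Real.sqrt (J * Real.log J / n)

lemma rate_nonneg (n J : ℕ) : 0 ≤ rate n J := Real.sqrt_nonneg _

lemma rate_mono (n : ℕ) {i j : ℕ} (hi : 1 ≤ i) (hij : i ≤ j) : rate n i ≤ rate n j := by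
  have h1 : (1 : ℝ) ≤ i := by exact_mod_cast hi
  have h2 : (i : ℝ) ≤ j := by exact_mod_cast hij
  refine Real.sqrt_le_sqrt (div_le_div_of_nonneg_right ?_ (by positivity))
  exact mul_le_mul h2 (Real.log_le_log (by linarith) h2) (Real.log_nonneg h1) (by linarith)

/-- Both j + 1 ≤ 2j and j + 1 ≤ j² hold, so the radicand grows by at most 4. This controls the rate
at the oracle index by that at its predecessor. -/
lemma rate_succ_le (n : ℕ) {j : ℕ} (hj : 2 ≤ j) : rate n (j + 1) ≤ 2 * rate n j := by
  have h1 : (2 : ℝ) ≤ j := by exact_mod_cast hj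
  refine Real.sqrt_le_iff.2 ⟨mul_nonneg zero_le_two (rate_nonneg _ _), ?_⟩
  have h3 : 0 ≤ Real.log j := Real.log_nonneg (by linarith)
  rw [mul_pow, rate, Real.sq_sqrt (by positivity), mul_div_assoc']
  refine div_le_div_of_nonneg_right ?_ (by positivity)
  have h2 : Real.log ((j + 1 : ℕ) : ℝ) ≤ 2 * Real.log j := by
    rw [← Real.log_rpow (by linarith)]
    refine Real.log_le_log (by positivity) ?_
    push_cast
    norm_num
    nlinarith
  push_cast at h2 ⊢
  calc ((j : ℝ) + 1) * Real.log ((j : ℝ) + 1) ≤ (2 * j) * (2 * Real.log j) :=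
        mul_le_mul (by linarith) h2 (Real.log_nonneg (by linarith)) (by linarith)
    _ = 2 ^ 2 * (j * Real.log j) := by ring

lemma rate_pos {n J : ℕ} (hn : 0 < n) (hJ : 2 ≤ J) : 0 < rate n J := by
  have h1 : (2 : ℝ) ≤ J := by exact_mod_cast hJ
  have h2 : 0 < Real.log J := Real.log_pos (by linarith)
  have : (0 : ℝ) < n := by exact_mod_cast hn
  exact Real.sqrt_pos.2 (by positivity)

lemma supNorm_le {g : ℝ → ℝ} {Z : ℝ} (h : ∀ x ∈ Icc (0 : ℝ) 1, |g x| ≤ Z) : supNorm g ≤ Z := by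
  have : Nonempty (Icc (0 : ℝ) 1) := ⟨⟨0, le_rfl, zero_le_one⟩⟩
  exact ciSup_le fun x => h x x.2

/-- The value of Z is irrelevant: some bound is needed because a real supremum over an unbounded
family is 0. -/
lemma abs_le_supNorm {g : ℝ → ℝ} {Z : ℝ} (h : ∀ x ∈ Icc (0 : ℝ) 1, |g x| ≤ Z) {x : ℝ}
    (hx : x ∈ Icc (0 : ℝ) 1) : |g x| ≤ supNorm g :=
  le_ciSup (f := fun x : Icc (0 : ℝ) 1 => |g x|)
    ⟨Z, by rintro _ ⟨y, rfl⟩; exact h y y.2⟩ ⟨x, hx⟩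

lemma supENorm_le {g : ℝ → ℝ} {Z : ℝ} (h : ∀ x ∈ Icc (0 : ℝ) 1, |g x| ≤ Z) :
    supENorm g ≤ ENNReal.ofReal Z :=
  iSup₂_le fun x hx => ENNReal.ofReal_le_ofReal (h x hx)

variable {q n jmax : ℕ}

lemma jmax_mem_candidates (h : jmin q n ≤ jmax) : jmax ∈ candidates q n jmax := ⟨h, le_rfl⟩

/-- Either the oracle inequality holds at the oracle index, which is the first such index, or the
oracle index is `jmax` and the inequality fails throughout. -/
lemma oracleIndex_spec (h : jmin q n ≤ jmax) (α : ℝ) (f₀ : ℝ → ℝ) :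
    oracleIndex q n jmax α f₀ ∈ candidates q n jmax ∧
      ((holderENorm α f₀).toReal * (oracleIndex q n jmax α f₀ : ℝ) ^ (-α) ≤
          rate n (oracleIndex q n jmax α f₀) ∨ oracleIndex q n jmax α f₀ = jmax) ∧
      ((rate n (oracleIndex q n jmax α f₀) <
          (holderENorm α f₀).toReal * (oracleIndex q n jmax α f₀ : ℝ) ^ (-α)) ∨
        ∀ j ∈ candidates q n jmax, j < oracleIndex q n jmax α f₀ →
          rate n j < (holderENorm α f₀).toReal * (j : ℝ) ^ (-α)) := by
  set S : Set ℕ := {j | j ∈ candidates q n jmax ∧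
    (holderENorm α f₀).toReal * (j : ℝ) ^ (-α) ≤ Real.sqrt (j * Real.log j / n)} with hS
  by_cases hne : S.Nonempty
  · have e : oracleIndex q n jmax α f₀ = sInf S := by
      rw [oracleIndex]; exact if_pos hne
    rw [e]
    have h1 := Nat.sInf_mem hne
    refine ⟨h1.1, Or.inl h1.2, Or.inr fun j hj hlt => ?_⟩
    have h2 := Nat.notMem_of_lt_sInf hlt
    by_contra hcon
    exact h2 ⟨hj, not_lt.1 hcon⟩
  · have e : oracleIndex q n jmax α f₀ = jmax := by
      rw [oracleIndex]; exact if_neg hne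
    rw [e]
    refine ⟨jmax_mem_candidates h, Or.inr rfl, Or.inl ?_⟩
    by_contra hcon
    exact hne ⟨jmax, jmax_mem_candidates h, not_lt.1 hcon⟩

variable {T : ∀ J, KnotPartition (J - q)} {X : Fin n → ℝ} {η : ∀ J, Fin J → ℝ}
  {Ω : ∀ J, Matrix (Fin J) (Fin J) ℝ} {Y : Fin n → ℝ} {τ α : ℝ} {f₀ : ℝ → ℝ} {K t : ℝ}

lemma lepskiIndex_spec (h : jmin q n ≤ jmax) :
    ∃ j, lepskiIndex q jmax T X η Ω τ Y = j ∧ j ∈ candidates q n jmax ∧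
      ∀ i ∈ candidates q n jmax, j < i →
        supNorm (fun x =>
            postMean q j (T j) X (η j) (Ω j) Y x - postMean q i (T i) X (η i) (Ω i) Y x)
          ≤ τ * sigmaHat q i (T i) X (η i) (Ω i) Y * rate n i :=
  ⟨_, rfl, Nat.sInf_mem (s := {j | j ∈ candidates q n jmax ∧ ∀ i ∈ candidates q n jmax, j < i →
    supNorm (fun x => postMean q j (T j) X (η j) (Ω j) Y x - postMean q i (T i) X (η i) (Ω i) Y x)
      ≤ τ * sigmaHat q i (T i) X (η i) (Ω i) Y * Real.sqrt (i * Real.log i / n)})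
    ⟨jmax, jmax_mem_candidates h, fun i hi hlt => absurd hi.2 (by omega)⟩⟩

/-- The Lepski index does not exceed the oracle index when the errors are under control. -/
lemma lepskiIndex_le_oracleIndex (h : jmin q n ≤ jmax) (hpos : 0 < jmin q n) (hα : 0 < α)
    (hK : 0 ≤ K)
    (herr : ∀ J ∈ candidates q n jmax, ∀ x ∈ Icc (0 : ℝ) 1,
      |f₀ x - postMean q J (T J) X (η J) (Ω J) Y x| ≤
        K * ((holderENorm α f₀).toReal * (J : ℝ) ^ (-α)) + t * rate n J)
    {σ : ℝ} (hsig : ∀ J ∈ candidates q n jmax, (∀ x ∈ Icc (0 : ℝ) 1,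
      |f₀ x - postMean q J (T J) X (η J) (Ω J) Y x| ≤ σ) → σ ≤ sigmaHat q J (T J) X (η J) (Ω J) Y)
    (hsmall : ∀ J ∈ candidates q n jmax, (K + t) * rate n J ≤ σ)
    (ht : 0 ≤ t) (hσ : 0 < σ) (hτ : 2 * (K + t) ≤ τ * σ) :
    lepskiIndex q jmax T X η Ω τ Y ≤ oracleIndex q n jmax α f₀ := by
  obtain ⟨hmem, hor, -⟩ := oracleIndex_spec h α f₀
  rcases hor with hor | hor
  · refine Nat.sInf_le ⟨hmem, fun i hi hlt => ?_⟩
    set j := oracleIndex q n jmax α f₀ with hj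
    have hj0 : (0 : ℝ) < j := hpos.trans_le hmem.1
    have hj1 : 1 ≤ j := by exact_mod_cast hj0
    have hr : rate n j ≤ rate n i := rate_mono n hj1 hlt.le
    -- Beyond the oracle index the bias decreases and the rate increases.
    have hi' : (holderENorm α f₀).toReal * (i : ℝ) ^ (-α) ≤ rate n i := by
      refine le_trans (le_trans ?_ hor) hr
      refine mul_le_mul_of_nonneg_left ?_ ENNReal.toReal_nonneg
      exact Real.rpow_le_rpow_of_nonpos hj0 (by exact_mod_cast hlt.le) (by linarith)
    have ei : ∀ x ∈ Icc (0 : ℝ) 1, |f₀ x - postMean q i (T i) X (η i) (Ω i) Y x| ≤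
        (K + t) * rate n i := fun x hx => by
      have h1 := herr i hi x hx
      have h2 := mul_le_mul_of_nonneg_left hi' hK
      linarith
    have ej : ∀ x ∈ Icc (0 : ℝ) 1, |f₀ x - postMean q j (T j) X (η j) (Ω j) Y x| ≤
        (K + t) * rate n i := fun x hx => by
      have h1 := herr j hmem x hx
      have h2 := mul_le_mul_of_nonneg_left (hor.trans hr) hK
      have h3 := mul_le_mul_of_nonneg_left hr ht
      linarith
    have hs := hsig i hi fun x hx => (ei x hx).trans (hsmall i hi)
    have hτ0 : 0 ≤ τ := by
      by_contra hneg
      have : τ * σ < 0 := mul_neg_of_neg_of_pos (not_le.1 hneg) hσ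
      linarith
    have h4 : supNorm (fun x => postMean q j (T j) X (η j) (Ω j) Y x -
        postMean q i (T i) X (η i) (Ω i) Y x) ≤ 2 * (K + t) * rate n i := by
      refine supNorm_le fun x hx => ?_
      have h5 := abs_sub_le (postMean q j (T j) X (η j) (Ω j) Y x) (f₀ x)
        (postMean q i (T i) X (η i) (Ω i) Y x)
      rw [abs_sub_comm _ (f₀ x)] at h5
      linarith [ei x hx, ej x hx]
    refine h4.trans ?_
    have h6 : 2 * (K + t) ≤ τ * sigmaHat q i (T i) X (η i) (Ω i) Y :=
      hτ.trans (mul_le_mul_of_nonneg_left hs hτ0)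
    exact mul_le_mul_of_nonneg_right h6 (rate_nonneg n i)
  -- If the oracle index is `jmax`, every candidate is below it.
  · rw [hor]
    obtain ⟨j, hj, hjc, -⟩ := lepskiIndex_spec (T := T) (X := X) (η := η) (Ω := Ω) (τ := τ)
      (Y := Y) h
    rw [hj]
    exact hjc.2

/-- The Lepski index is not much smaller than the oracle index when the truth is self-similar and
the errors at the oracle index are under control. -/
lemma oracleIndex_div_le_lepskiIndex (h : jmin q n ≤ jmax) (hn : 0 < n) (hq : 1 ≤ q)
    (hpos : 2 ≤ jmin q n) (hqj : (q : ℝ) ≤ jmin q n) (hα : 0 < α) (hαq : α ≤ q) (hτ : 0 ≤ τ)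
    (ht : 0 ≤ t) {ρ δ : ℝ} (hδ : 0 < δ)
    (hT : ∀ J, (T J).QuasiUniform ρ)
    (hf : holderENorm α f₀ ≠ ⊤) (hss : f₀ ∈ selfSimilar q ρ δ α)
    (hspline : ∀ J ∈ candidates q n jmax,
      postMean q J (T J) X (η J) (Ω J) Y ∈ splineSpace q (T J))
    (herr : ∀ J ∈ candidates q n jmax, ∀ x ∈ Icc (0 : ℝ) 1,
      |f₀ x - postMean q J (T J) X (η J) (Ω J) Y x| ≤
        K * ((holderENorm α f₀).toReal * (J : ℝ) ^ (-α)) + t * rate n J)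
    {σ A : ℝ} (hσ : 0 ≤ σ) (hA : 0 ≤ A) (hsig : ∀ J ∈ candidates q n jmax,
      sigmaHat q J (T J) X (η J) (Ω J) Y ≤
        σ + A * ((holderENorm α f₀).toReal * (J : ℝ) ^ (-α)))
    (hsmall : ∀ J ∈ candidates q n jmax, rate n J ≤ 1) {κ : ℕ} (hκ2 : 2 ≤ κ)
    (hκ : K + τ * A + 2 ^ (q + 1) * (t + τ * σ) < δ * (κ : ℝ) ^ α) :
    (oracleIndex q n jmax α f₀ : ℝ) / κ ≤ lepskiIndex q jmax T X η Ω τ Y := by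
  by_contra hcon
  push Not at hcon
  obtain ⟨j, hj, hjc, hjl⟩ := lepskiIndex_spec (T := T) (X := X) (η := η) (Ω := Ω) (τ := τ)
    (Y := Y) h
  rw [hj] at hcon
  obtain ⟨hic, -, hor⟩ := oracleIndex_spec h α f₀
  set i := oracleIndex q n jmax α f₀ with hi
  set L := (holderENorm α f₀).toReal with hL
  have hL0 : 0 ≤ L := ENNReal.toReal_nonneg
  have hκ0 : (2 : ℝ) ≤ κ := by exact_mod_cast hκ2
  have hj0 : (0 : ℝ) < j := by linarith [hjc.1]
  have hi0 : (0 : ℝ) < i := by linarith [hic.1]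
  have hjκ : (j : ℝ) * κ < i := by rwa [lt_div_iff₀ (by linarith)] at hcon
  have hji : j < i := by
    have : (j : ℝ) < i := by nlinarith
    exact_mod_cast this
  have hi2 : 2 ≤ i := by
    have : (2 : ℝ) ≤ i := hpos.trans hic.1
    exact_mod_cast this
  set x₀ := L * (i : ℝ) ^ (-α) with hx₀
  have hx0 : 0 ≤ x₀ := by positivity
  -- Either the rate is below the bias at i itself, or i - 1 is a candidate (as j < i) at which the
  -- bias exceeds the rate. One step changes the rate by at most 2 and the bias by at most 2 ^ α ≤ 2
  -- ^ q.
  have hrx : rate n i ≤ 2 ^ (q + 1) * x₀ := by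
    have hpow1 : (1 : ℝ) ≤ 2 ^ (q + 1) := one_le_pow₀ (by norm_num)
    rcases hor with hor | hor
    · exact hor.le.trans (le_mul_of_one_le_left hx0 hpow1)
    · obtain ⟨m, hm⟩ : ∃ m, i = m + 1 := ⟨i - 1, by omega⟩
      have hjm : j ≤ m := by omega
      have hmin : jmin q n ≤ m := hjc.1.trans (by exact_mod_cast hjm)
      have hm2 : (2 : ℝ) ≤ m := hpos.trans hmin
      have hmr := hor m ⟨hmin, by have := hic.2; omega⟩ (by omega)
      have h1 := rate_succ_le n (j := m) (by exact_mod_cast hm2)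
      have h2 : (m : ℝ) ^ (-α) ≤ 2 ^ q * ((m + 1 : ℕ) : ℝ) ^ (-α) := by
        have h3 : (m : ℝ) ^ (-α) ≤ (((m + 1 : ℕ) : ℝ) / 2) ^ (-α) :=
          Real.rpow_le_rpow_of_nonpos (by positivity) (by push_cast; linarith) (by linarith)
        refine h3.trans ?_
        rw [Real.div_rpow (by positivity) (by norm_num), Real.rpow_neg zero_le_two, div_inv_eq_mul,
          mul_comm]
        refine mul_le_mul_of_nonneg_right ?_ (by positivity)
        rw [← Real.rpow_natCast]
        exact Real.rpow_le_rpow_of_exponent_le (by norm_num) hαq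
      calc rate n i ≤ 2 * rate n m := by rw [hm]; exact h1
        _ ≤ 2 * (L * (m : ℝ) ^ (-α)) := by linarith
        _ ≤ 2 * (L * (2 ^ q * ((m + 1 : ℕ) : ℝ) ^ (-α))) := by gcongr
        _ = 2 ^ (q + 1) * x₀ := by rw [hx₀, hm, pow_succ]; ring
  have hr0 := rate_pos hn hi2
  -- This rules out f₀ = 0, for which the oracle index is already the least candidate, and permits
  -- the final cancellation.
  have hxpos : 0 < x₀ := by
    by_contra hneg
    have : x₀ = 0 := le_antisymm (not_lt.1 hneg) hx0
    rw [this, mul_zero] at hrx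
    linarith
  have hr1 := hsmall i hic
  have hlep := hjl i hic hji
  have hsi := hsig i hic
  have hpoint : ∀ x ∈ Icc (0 : ℝ) 1, |(f₀ - postMean q j (T j) X (η j) (Ω j) Y) x| ≤
      (K + τ * A + 2 ^ (q + 1) * (t + τ * σ)) * x₀ := by
    intro x hx
    have h1 : ∀ y ∈ Icc (0 : ℝ) 1, |postMean q j (T j) X (η j) (Ω j) Y y -
        postMean q i (T i) X (η i) (Ω i) Y y| ≤ (K * (L * (j : ℝ) ^ (-α)) + t * rate n j) +
          (K * (L * (i : ℝ) ^ (-α)) + t * rate n i) := by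
      intro y hy
      have h5 := abs_sub_le (postMean q j (T j) X (η j) (Ω j) Y y) (f₀ y)
        (postMean q i (T i) X (η i) (Ω i) Y y)
      rw [abs_sub_comm _ (f₀ y)] at h5
      exact h5.trans (add_le_add (herr j hjc y hy) (herr i hic y hy))
    have h2 := abs_le_supNorm (g := fun x => postMean q j (T j) X (η j) (Ω j) Y x -
        postMean q i (T i) X (η i) (Ω i) Y x) h1 hx
    have h3 := herr i hic x hx
    have h4 := abs_sub_le (f₀ x) (postMean q i (T i) X (η i) (Ω i) Y x)
      (postMean q j (T j) X (η j) (Ω j) Y x)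
    rw [abs_sub_comm (postMean q i (T i) X (η i) (Ω i) Y x)] at h4
    -- The part of σ̂ proportional to x₀ is multiplied by a rate at most 1 and so stays of order x₀.
    have h5 : τ * sigmaHat q i (T i) X (η i) (Ω i) Y * rate n i ≤
        τ * σ * rate n i + τ * A * x₀ := by
      calc τ * sigmaHat q i (T i) X (η i) (Ω i) Y * rate n i ≤ τ * (σ + A * x₀) * rate n i :=
            mul_le_mul_of_nonneg_right (mul_le_mul_of_nonneg_left hsi hτ) hr0.le
        _ = τ * σ * rate n i + τ * A * x₀ * rate n i := by ring
        _ ≤ τ * σ * rate n i + τ * A * x₀ := by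
            have : τ * A * x₀ * rate n i ≤ τ * A * x₀ :=
              mul_le_of_le_one_right (by positivity) hr1
            linarith
    have h6 : (t + τ * σ) * rate n i ≤ (t + τ * σ) * (2 ^ (q + 1) * x₀) :=
      mul_le_mul_of_nonneg_left hrx (by positivity)
    rw [Pi.sub_apply]
    linarith
  have hself : ENNReal.ofReal δ * holderENorm α f₀ * ENNReal.ofReal ((T j).mesh ^ α) ≤
      ⨅ p ∈ splineSpace q (T j), supENorm (f₀ - p) := by
    have := hss
    simp only [selfSimilar, mem_iInter] at this
    exact this _ (T j) (hT j)
  have h1 := (hself.trans (iInf₂_le _ (hspline j hjc))).trans (supENorm_le hpoint)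
  rw [← ENNReal.ofReal_toReal hf, ← hL, ← ENNReal.ofReal_mul hδ.le,
    ← ENNReal.ofReal_mul (by positivity)] at h1
  have hmesh := (T j).inv_le_mesh
  have hmesh0 : 0 ≤ (T j).mesh := le_trans (by positivity) hmesh
  have hZ : 0 ≤ (K + τ * A + 2 ^ (q + 1) * (t + τ * σ)) * x₀ :=
    (abs_nonneg _).trans (hpoint 0 ⟨le_rfl, zero_le_one⟩)
  rw [ENNReal.ofReal_le_ofReal_iff hZ] at h1
  have hqj' : q ≤ j := by
    have : (q : ℝ) ≤ j := hqj.trans hjc.1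
    exact_mod_cast this
  have hmj : (j : ℝ)⁻¹ ≤ (T j).mesh := by
    refine le_trans (inv_anti₀ (by positivity) ?_) hmesh
    exact_mod_cast (by omega : j - q + 1 ≤ j)
  -- The coarse partition has mesh at least 1/j > κ/i, so self-similarity amplifies the bias by κ ^
  -- α.
  have h2 : (κ : ℝ) ^ α * (i : ℝ) ^ (-α) ≤ (T j).mesh ^ α := by
    rw [Real.rpow_neg hi0.le, ← div_eq_mul_inv, ← Real.div_rpow (by positivity) hi0.le]
    refine Real.rpow_le_rpow (by positivity) (le_trans ?_ hmj) hα.le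
    rw [div_le_iff₀ hi0, inv_mul_eq_div, le_div_iff₀ hj0]
    linarith
  have h3 : δ * (κ : ℝ) ^ α * x₀ ≤ (K + τ * A + 2 ^ (q + 1) * (t + τ * σ)) * x₀ := by
    refine le_trans ?_ h1
    calc δ * (κ : ℝ) ^ α * x₀ = δ * L * ((κ : ℝ) ^ α * (i : ℝ) ^ (-α)) := by rw [hx₀]; ring
      _ ≤ δ * L * (T j).mesh ^ α := mul_le_mul_of_nonneg_left h2 (by positivity)
  have h4 := le_of_mul_le_mul_right h3 hxpos
  linarith

end LepskiRule

end

end BayesLepski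


namespace BayesLepski

noncomputable section

/-! ### Rates for large n and conditioning of all candidate bases. -/

section Asymptotics

lemma tendsto_log_atTop : Tendsto (fun n : ℕ => Real.log n) atTop atTop :=
  Real.tendsto_log_atTop.comp tendsto_natCast_atTop_atTop

lemma tendsto_div_log_atTop : Tendsto (fun n : ℕ => (n : ℝ) / Real.log n) atTop atTop := by
  have h1 : Tendsto (fun x : ℝ => Real.log x / x) atTop (𝓝[>] 0) := by
    refine tendsto_nhdsWithin_iff.2 ⟨?_, ?_⟩
    · have := Real.isLittleO_log_id_atTop.tendsto_div_nhds_zero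
      simpa using this
    · filter_upwards [eventually_gt_atTop 1] with x hx
      exact div_pos (Real.log_pos hx) (by linarith)
  have h2 := h1.inv_tendsto_nhdsGT_zero.comp tendsto_natCast_atTop_atTop
  refine h2.congr fun n => ?_
  simp

lemma tendsto_jmin (q : ℕ) : Tendsto (jmin q) atTop atTop :=
  (tendsto_rpow_atTop (y := (1 : ℝ) / (2 * q + 1)) (by positivity)).comp tendsto_div_log_atTop

variable {q : ℕ} {jmax : ℕ → ℕ}

lemma eventually_jmax_mul_log_le
    (hjmax' : (fun n => (jmax n : ℝ)) =o[atTop] fun n : ℕ => (n : ℝ) / Real.log n)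
    {ε : ℝ} (hε : 0 < ε) :
    ∀ᶠ n in atTop, (jmax n : ℝ) * Real.log n ≤ ε * n := by
  filter_upwards [hjmax'.bound hε, tendsto_log_atTop.eventually_gt_atTop 0] with n h1 h2
  rw [Real.norm_of_nonneg (by positivity), Real.norm_of_nonneg (by positivity), mul_div_assoc',
    le_div_iff₀ h2] at h1
  exact h1

lemma eventually_jmax_le
    (hjmax' : (fun n => (jmax n : ℝ)) =o[atTop] fun n : ℕ => (n : ℝ) / Real.log n) :
    ∀ᶠ n in atTop, jmax n ≤ n := by
  filter_upwards [eventually_jmax_mul_log_le hjmax' one_pos,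
    tendsto_log_atTop.eventually_ge_atTop 1] with n h1 h2
  have h3 : (jmax n : ℝ) ≤ jmax n * Real.log n := le_mul_of_one_le_right (by positivity) h2
  have : (jmax n : ℝ) ≤ n := by linarith
  exact_mod_cast this

lemma eventually_rate_le
    (hjmax' : (fun n => (jmax n : ℝ)) =o[atTop] fun n : ℕ => (n : ℝ) / Real.log n)
    {ε : ℝ} (hε : 0 < ε) :
    ∀ᶠ n in atTop, ∀ J ∈ candidates q n (jmax n), rate n J ≤ ε := by
  filter_upwards [eventually_jmax_mul_log_le hjmax' (pow_pos hε 2), eventually_jmax_le hjmax',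
    (tendsto_jmin q).eventually_ge_atTop 1, eventually_gt_atTop 0] with n h1 h2 h3 h4 J hJ
  have hn : (0 : ℝ) < n := by exact_mod_cast h4
  have hJ1 : (1 : ℝ) ≤ J := h3.trans hJ.1
  have hJm : (J : ℝ) ≤ jmax n := by exact_mod_cast hJ.2
  have hJn : (J : ℝ) ≤ n := by exact_mod_cast hJ.2.trans h2
  refine Real.sqrt_le_iff.2 ⟨hε.le, ?_⟩
  rw [div_le_iff₀ hn]
  refine le_trans ?_ h1
  exact mul_le_mul hJm (Real.log_le_log (by linarith) hJn) (Real.log_nonneg hJ1) (by linarith)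

/-- J/n ≤ √(J/n), and log J is large because J ≥ jmin. Thus the prior bias is absorbed by one extra
rate, the 1 in t + 1. -/
lemma eventually_mul_le_rate
    (hjmax' : (fun n => (jmax n : ℝ)) =o[atTop] fun n : ℕ => (n : ℝ) / Real.log n)
    (c : ℝ) :
    ∀ᶠ n in atTop, ∀ J ∈ candidates q n (jmax n), c * ((J : ℝ) / n) ≤ rate n J := by
  filter_upwards [eventually_jmax_le hjmax', (tendsto_jmin q).eventually_ge_atTop (Real.exp (c ^ 2)),
    eventually_gt_atTop 0] with n h2 h3 h4 J hJ
  have hn : (0 : ℝ) < n := by exact_mod_cast h4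
  have hJe : Real.exp (c ^ 2) ≤ J := h3.trans hJ.1
  have hJ0 : (0 : ℝ) < J := (Real.exp_pos _).trans_le hJe
  have hJn : (J : ℝ) ≤ n := by exact_mod_cast hJ.2.trans h2
  have hlog : c ^ 2 ≤ Real.log J := (Real.le_log_iff_exp_le hJ0).2 hJe
  refine Real.le_sqrt_of_sq_le ?_
  have h5 : (J : ℝ) / n ≤ 1 := (div_le_one hn).2 hJn
  have h6 : (0 : ℝ) ≤ J / n := by positivity
  calc (c * ((J : ℝ) / n)) ^ 2 = (J / n) * (c ^ 2 * (J / n)) := by ring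
    _ ≤ (J / n) * (Real.log J * 1) :=
        mul_le_mul_of_nonneg_left (mul_le_mul hlog h5 h6 ((sq_nonneg c).trans hlog)) h6
    _ = J * Real.log J / n := by ring

/-- The assumptions of the theorem make the B-spline bases well conditioned for all candidates. -/
lemma exists_posteriorSetting (hq : 1 ≤ q)
    (hjmax' : (fun n => (jmax n : ℝ)) =o[atTop] fun n : ℕ => (n : ℝ) / Real.log n)
    {ρ : ℝ} {T : ∀ _n J : ℕ, KnotPartition (J - q)} (hT : ∀ n J, (T n J).QuasiUniform ρ)
    {φ : ℝ → ℝ} (hφ : ContinuousOn φ (Icc 0 1)) (hφpos : ∀ x ∈ Icc (0 : ℝ) 1, 0 < φ x)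
    {X : ∀ n, Fin n → ℝ} (hX : ∀ n i, X n i ∈ Icc (0 : ℝ) 1)
    (hdesign : (fun n => supNorm (fun x => empiricalCDF (X n) x - ∫ t in (0 : ℝ)..x, φ t))
      =o[atTop] fun n => ((jmax n : ℝ))⁻¹)
    {η : ∀ _n J : ℕ, Fin J → ℝ} {cη : ℝ} (hη : ∀ n J i, |η n J i| ≤ cη)
    {Ω : ∀ _n J : ℕ, Matrix (Fin J) (Fin J) ℝ} (hΩ : ∀ n J, (Ω n J).IsHermitian)
    {c₁ : ℝ} (hc₁ : 0 < c₁) (hΩeig : ∀ n J i, c₁ ≤ (hΩ n J).eigenvalues i)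
    {r : ℕ} (hΩband : ∀ n J (i j : Fin J), (r : ℤ) < |(i : ℤ) - (j : ℤ)| → (Ω n J)⁻¹ i j = 0) :
    ∃ a b : ℝ, ∀ᶠ n in atTop, ∀ J ∈ candidates q n (jmax n),
      PosteriorSetting ρ c₁ cη a b q r (T n J) (X n) (η n J) (Ω n J) := by
  have hne : (Icc (0 : ℝ) 1).Nonempty := ⟨0, le_rfl, zero_le_one⟩
  obtain ⟨x₀, hx₀, hmin⟩ := isCompact_Icc.exists_isMinOn hne hφ
  obtain ⟨x₁, hx₁, hmax⟩ := isCompact_Icc.exists_isMaxOn hne hφ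
  set φ₀ := φ x₀
  set φ₁ := φ x₁
  have hφ0 : 0 < φ₀ := hφpos x₀ hx₀
  have hφ1 : 0 < φ₁ := hφpos x₁ hx₁
  have h0 : ∀ x ∈ Icc (0 : ℝ) 1, φ₀ ≤ φ x := fun x hx => hmin hx
  have h1 : ∀ x ∈ Icc (0 : ℝ) 1, φ x ≤ φ₁ := fun x hx => hmax hx
  have hρ : 1 ≤ ρ := (hT 0 0).one_le
  -- A cell has limiting mass at least φ₀ (ρJ)⁻¹ / 2 ^ q; with this ε the discrepancy 2ε/J is half
  -- of that.
  set ε := φ₀ / (ρ * 2 ^ q) / 4 with hε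
  have hε0 : 0 < ε := by positivity
  set S := stabConst ρ q ^ 2 * (1 + q) with hS
  have hS0 : 0 < S := by
    have := one_le_stabConst ρ q
    positivity
  refine ⟨φ₀ / (2 * ρ * 2 ^ q) / S, φ₁ * (ρ * q ^ 2 + 1) + 2 * ε, ?_⟩
  filter_upwards [hdesign.bound hε0, eventually_jmax_le hjmax', eventually_gt_atTop 0,
    (tendsto_jmin q).eventually_ge_atTop (q : ℝ)] with n hD hjn hn hjq J hJ
  have hn' : (0 : ℝ) < n := by exact_mod_cast hn
  have hqJ : q ≤ J := by
    have : (q : ℝ) ≤ J := hjq.trans hJ.1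
    exact_mod_cast this
  have hJ0 : (0 : ℝ) < J := by exact_mod_cast (by omega : 0 < J)
  set D := supNorm (fun x => empiricalCDF (X n) x - ∫ t in (0 : ℝ)..x, φ t) with hDdef
  have hDpt : ∀ x ∈ Icc (0 : ℝ) 1, |empiricalCDF (X n) x - ∫ t in (0 : ℝ)..x, φ t| ≤ D := by
    intro x hx
    -- A crude bound, only to make the supremum genuine.
    refine abs_le_supNorm (g := fun x => empiricalCDF (X n) x - ∫ t in (0 : ℝ)..x, φ t)
      (Z := 1 + φ₁) (fun y hy => ?_) hx
    have h2 := integral_density_bounds hφ h0 h1 le_rfl hy.1 hy.2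
    rw [intervalIntegral.integral_same, sub_zero, sub_zero] at h2
    have h3 : φ₁ * y ≤ φ₁ := mul_le_of_le_one_right hφ1.le hy.2
    have h4 : 0 ≤ φ₀ * y := mul_nonneg hφ0.le hy.1
    have h5 : empiricalCDF (X n) y ≤ 1 := by
      rw [empiricalCDF_eq, inv_mul_le_iff₀ hn', mul_one]
      have := Finset.card_filter_le (Finset.univ : Finset (Fin n)) fun i => X n i ≤ y
      rw [Finset.card_univ, Fintype.card_fin] at this
      exact_mod_cast this
    have h6 : 0 ≤ empiricalCDF (X n) y := by
      rw [empiricalCDF_eq]; positivity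
    rw [abs_le]
    constructor <;> linarith [h2.1, h2.2]
  have hDJ : D ≤ ε / J := by
    have hJm : (J : ℝ) ≤ jmax n := by exact_mod_cast hJ.2
    have h2 := (le_abs_self D).trans hD
    rw [Real.norm_of_nonneg (by positivity)] at h2
    refine h2.trans ?_
    rw [div_eq_mul_inv]
    exact mul_le_mul_of_nonneg_left (inv_anti₀ hJ0 hJm) hε0.le
  have hk := (hT n J).uniformKnots hq hqJ
  refine ⟨hc₁, by positivity, by positivity, hk, hJ.2.trans hjn, hX n, hη n J, hΩ n J, hΩeig n J,
    hΩband n J, fun θ => ?_, fun k hkJ => ?_⟩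
  · have h2 := hk.gram_lower (X := X n) (N₀ := φ₀ / (2 * ρ * 2 ^ q) * (n / J)) (by positivity)
      (fun u v hu hv huv => by
        have hℓ : 0 < (ρ * J)⁻¹ / 2 ^ q := by positivity
        refine le_trans ?_ (le_card_design hn hφ h0 h1 hDpt hu (by linarith) hv)
        have h3 : φ₀ * ((ρ * J)⁻¹ / 2 ^ q) ≤ φ₀ * (v - u) :=
          mul_le_mul_of_nonneg_left huv hφ0.le
        have h4 : φ₀ / (2 * ρ * 2 ^ q) * (n / J) =
            n * (φ₀ * ((ρ * J)⁻¹ / 2 ^ q) - 2 * (ε / J)) := by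
          rw [hε]; field_simp; ring
        rw [h4]
        exact mul_le_mul_of_nonneg_left (by linarith) hn'.le)
      θ (hX n)
    rw [← hS] at h2
    calc φ₀ / (2 * ρ * 2 ^ q) / S * (n / J) * ∑ k ∈ Finset.range J, θ k ^ 2
        = (φ₀ / (2 * ρ * 2 ^ q) * (n / J) * ∑ k ∈ Finset.range J, θ k ^ 2) / S := by ring
      _ ≤ _ := by rw [div_le_iff₀ hS0, mul_comm _ S]; exact h2
  · refine hk.column_sum_le (N₁ := (φ₁ * (ρ * q ^ 2 + 1) + 2 * ε) * (n / J))
      (fun u v hu huv hv hw => ?_) (hX n) hkJ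
    refine (card_design_le hn hφ (fun x hx => (hφpos x hx).le) h1 hDpt hu huv hv
      (e := 1 / J) (by positivity)).trans ?_
    have h3 : φ₁ * (v - u + 1 / J) ≤ φ₁ * (ρ * q ^ 2 / J + 1 / J) :=
      mul_le_mul_of_nonneg_left (by linarith) hφ1.le
    calc (n : ℝ) * (φ₁ * (v - u + 1 / J) + 2 * D)
        ≤ n * (φ₁ * (ρ * q ^ 2 / J + 1 / J) + 2 * (ε / J)) :=
          mul_le_mul_of_nonneg_left (by linarith) hn'.le
      _ = _ := by field_simp

end Asymptotics

/-! ### Probability of the good event. -/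

section GoodEvent

/-- The event on which the noise of all posterior means and the size of the errors are under
control. -/
def goodEvent (q : ℕ) {n : ℕ} (jmax : ℕ) (T : ∀ J, KnotPartition (J - q)) (X : Fin n → ℝ)
    (Ω : ∀ J, Matrix (Fin J) (Fin J) ℝ) (f₀ : ℝ → ℝ) (σ₀ t : ℝ) : Set (Fin n → ℝ) :=
  {Y | (∀ J ∈ candidates q n jmax, ∀ k : Fin J,
      |∑ i, (((basisMatrix q J (T J) X)ᵀ * basisMatrix q J (T J) X + (Ω J)⁻¹)⁻¹ *
        (basisMatrix q J (T J) X)ᵀ) k i * (Y i - f₀ (X i))| ≤ t * rate n J) ∧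
    n * σ₀ ^ 2 / 2 ≤ ∑ i, (Y i - f₀ (X i)) ^ 2 ∧
    ∑ i, (Y i - f₀ (X i)) ^ 2 ≤ 3 / 2 * (n * σ₀ ^ 2)}

/-- The constant in the probability bound for the complement of the good event. -/
def badConst (σ₀ : ℝ) : ℝ := 4 + 4 * gaussianSqVariance σ₀ / σ₀ ^ 4

lemma sum_Icc_inv_sq_le {m N : ℕ} (hm : 1 ≤ m) :
    ∑ J ∈ Finset.Icc m N, ((J : ℝ) ^ 2)⁻¹ ≤ 2 * (m : ℝ)⁻¹ := by
  have hm' : (1 : ℝ) ≤ m := by exact_mod_cast hm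
  rcases le_or_gt m N with h | h
  · rw [← Finset.Ioc_insert_left h, Finset.sum_insert (by simp)]
    have h1 := sum_Ioc_inv_sq_le_sub (α := ℝ) (k := m) (n := N) (by omega) h
    have h2 : ((m : ℝ) ^ 2)⁻¹ ≤ (m : ℝ)⁻¹ := inv_anti₀ (by linarith) (by nlinarith)
    have h3 : (0 : ℝ) ≤ (N : ℝ)⁻¹ := by positivity
    linarith
  · rw [Finset.Icc_eq_empty (by omega), Finset.sum_empty]
    positivity

/-- Union bound over candidates and coefficients: J tails of size 2J⁻³ sum to 2J⁻², and summing over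
J ≥ jmin gives 4/jmin. The bound does not depend on f₀, which supplies the uniformity. -/
lemma trueLaw_compl_goodEvent_le {ρ c₁ cη a b : ℝ} {q r n jmax : ℕ}
    {T : ∀ J, KnotPartition (J - q)} {X : Fin n → ℝ} {η : ∀ J, Fin J → ℝ}
    {Ω : ∀ J, Matrix (Fin J) (Fin J) ℝ}
    (hset : ∀ J ∈ candidates q n jmax, PosteriorSetting ρ c₁ cη a b q r (T J) X (η J) (Ω J))
    (hmin : 1 ≤ jmin q n) (hmn : jmin q n ≤ n) (ha : 0 < a) (f₀ : ℝ → ℝ) {σ₀ : ℝ}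
    (hσ₀ : 0 < σ₀) :
    (trueLaw X f₀ σ₀).real (goodEvent q jmax T X Ω f₀ σ₀ (Real.sqrt (6 * σ₀ ^ 2 / a)))ᶜ ≤
      badConst σ₀ / jmin q n := by
  set t := Real.sqrt (6 * σ₀ ^ 2 / a) with ht
  set W : ∀ J, Matrix (Fin J) (Fin n) ℝ := fun J =>
    ((basisMatrix q J (T J) X)ᵀ * basisMatrix q J (T J) X + (Ω J)⁻¹)⁻¹ *
        (basisMatrix q J (T J) X)ᵀ with hW
  set m := ⌈jmin q n⌉₊ with hm
  have hn' : (0 : ℝ) < n := by linarith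
  have hn : 0 < n := by exact_mod_cast hn'
  have hm1 : 1 ≤ m := Nat.one_le_ceil_iff.2 (by linarith)
  have hmem : ∀ J, J ∈ Finset.Icc m jmax ↔ J ∈ candidates q n jmax := by
    intro J
    rw [Finset.mem_Icc, hm, Nat.ceil_le]
    rfl
  set F : ∀ J, Fin J → Set (Fin n → ℝ) := fun J k =>
    {Y | t * rate n J ≤ |∑ i, W J k i * (Y i - f₀ (X i))|} with hF
  set G : Set (Fin n → ℝ) :=
    {Y | n * σ₀ ^ 2 / 2 ≤ |∑ i, (Y i - f₀ (X i)) ^ 2 - n * σ₀ ^ 2|} with hG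
  have hsub : (goodEvent q jmax T X Ω f₀ σ₀ t)ᶜ ⊆
      (⋃ J ∈ Finset.Icc m jmax, ⋃ k ∈ (Finset.univ : Finset (Fin J)), F J k) ∪ G := by
    intro Y hY
    by_contra hcon
    rw [mem_union, not_or] at hcon
    obtain ⟨h1, h2⟩ := hcon
    have h3 : |∑ i, (Y i - f₀ (X i)) ^ 2 - n * σ₀ ^ 2| < n * σ₀ ^ 2 / 2 := not_le.1 h2
    rw [abs_lt] at h3
    refine hY ⟨fun J hJ k => ?_, ?_, ?_⟩
    · by_contra hbig
      refine h1 (mem_biUnion (x := J) ((hmem J).2 hJ) (mem_biUnion (x := k) (Finset.mem_univ k) ?_))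
      exact (not_le.1 hbig).le
    · linarith [h3.1]
    · linarith [h3.2]
  have htail : ∀ J ∈ Finset.Icc m jmax, ∀ k : Fin J,
      (trueLaw X f₀ σ₀).real (F J k) ≤ 2 * ((J : ℝ) ^ 3)⁻¹ := by
    intro J hJ k
    have hs := hset J ((hmem J).1 hJ)
    have hJ0 := hs.J_pos
    have hJ1 : (1 : ℝ) ≤ J := by exact_mod_cast hs.knots.pos
    have hv := posterior_weights_sq_le (basisMatrix q J (T J) X) hs.posDef
      (a := a * (n / J)) (by positivity) hs.form_lower k
    refine (trueLaw_real_le_abs_sum X f₀ σ₀ hσ₀ (W J k) (by positivity) hv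
      (mul_nonneg (Real.sqrt_nonneg _) (rate_nonneg _ _))).trans ?_
    refine mul_le_mul_of_nonneg_left (le_of_eq ?_) zero_le_two
    have hlog : 0 ≤ Real.log J := Real.log_nonneg hJ1
    -- The choice t² = 6σ₀²/a makes the exponent exactly -3 log J.
    have e : -(t * rate n J) ^ 2 / (2 * (σ₀ ^ 2 * (a * (n / J))⁻¹)) = -(3 * Real.log J) := by
      rw [mul_pow, ht, rate, Real.sq_sqrt (by positivity), Real.sq_sqrt (by positivity)]
      field_simp
      ring
    rw [e, Real.exp_neg, ← Real.log_rpow hJ0, Real.exp_log (by positivity)]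
    norm_cast
  have hsum : (trueLaw X f₀ σ₀).real
      (⋃ J ∈ Finset.Icc m jmax, ⋃ k ∈ (Finset.univ : Finset (Fin J)), F J k) ≤ 4 * (m : ℝ)⁻¹ := by
    refine (measureReal_biUnion_finset_le _ _).trans ?_
    have h1 : ∀ J ∈ Finset.Icc m jmax, (trueLaw X f₀ σ₀).real
        (⋃ k ∈ (Finset.univ : Finset (Fin J)), F J k) ≤ 2 * ((J : ℝ) ^ 2)⁻¹ := by
      intro J hJ
      have hJ0 := (hset J ((hmem J).1 hJ)).J_pos
      refine (measureReal_biUnion_finset_le _ _).trans ?_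
      refine (Finset.sum_le_sum fun k _ => htail J hJ k).trans_eq ?_
      rw [Finset.sum_const, Finset.card_univ, Fintype.card_fin, nsmul_eq_mul]
      field_simp
    refine (Finset.sum_le_sum h1).trans ?_
    rw [← Finset.mul_sum]
    linarith [sum_Icc_inv_sq_le (N := jmax) hm1]
  have hchi := trueLaw_real_chiSq X f₀ σ₀ hσ₀ hn
  rw [← hG] at hchi
  have hV := gaussianSqVariance_nonneg σ₀
  have hinv1 : (m : ℝ)⁻¹ ≤ (jmin q n)⁻¹ := inv_anti₀ (by linarith) (Nat.le_ceil _)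
  have hinv2 : (n : ℝ)⁻¹ ≤ (jmin q n)⁻¹ := inv_anti₀ (by linarith) hmn
  refine (measureReal_mono hsub).trans ((measureReal_union_le _ _).trans ?_)
  rw [badConst, div_eq_mul_inv _ (jmin q n), add_mul]
  refine add_le_add (hsum.trans (by linarith)) (hchi.trans ?_)
  rw [div_eq_mul_inv _ (n : ℝ)]
  exact mul_le_mul_of_nonneg_left hinv2 (by positivity)

end GoodEvent

lemma holderENorm_zero (α : ℝ) : holderENorm α 0 = 0 := by
  have h : ∀ k, iteratedDerivWithin k (0 : ℝ → ℝ) (Icc 0 1) = 0 := by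
    intro k
    funext x
    exact iteratedDerivWithin_const_zero
  have h2 : supENorm 0 = 0 := by simp [supENorm]
  rw [holderENorm, if_pos]
  · simp [h, h2]
  · intro k _
    rw [h]
    exact differentiableOn_const 0

/-- Nonemptiness of the class keeps the infimum of probabilities at most 1; over an empty class it
would be ∞. -/
lemma zero_mem_class (q : ℕ) (ρ δ α R : ℝ) :
    (0 : ℝ → ℝ) ∈ holderBall α R ∩ selfSimilar q ρ δ α := by
  constructor
  · simp [holderBall, holderENorm_zero]
  · simp [selfSimilar, holderENorm_zero]

end

end BayesLepski


namespace BayesLepski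

noncomputable section

/-! ### Choice of constants and assembly. -/

section Conclusion

lemma PosteriorSetting.biasConst_nonneg {ρ c₁ cη a b : ℝ} {q r J n : ℕ}
    {T : KnotPartition (J - q)} {X : Fin n → ℝ} {η : Fin J → ℝ} {Ω : Matrix (Fin J) (Fin J) ℝ}
    (h : PosteriorSetting ρ c₁ cη a b q r T X η Ω) : 0 ≤ biasConst ρ c₁ a b q r := by
  have h1 := h.one_le_approxConst
  have h2 := h.solveConst_nonneg
  have h3 := h.b_nonneg
  rw [biasConst]
  positivity

lemma PosteriorSetting.priorConst_nonneg {ρ c₁ cη a b : ℝ} {q r J n : ℕ}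
    {T : KnotPartition (J - q)} {X : Fin n → ℝ} {η : Fin J → ℝ} {Ω : Matrix (Fin J) (Fin J) ℝ}
    (h : PosteriorSetting ρ c₁ cη a b q r T X η Ω) : 0 ≤ priorConst ρ c₁ cη a b q r := by
  have h1 := h.coeffConst_nonneg
  have h2 := h.solveConst_nonneg
  have h3 := h.c₁_pos
  rw [priorConst]
  positivity

/-- On the good event the Lepski index is, up to the factor `κ`, the oracle index. -/
lemma index_bounds_of_mem_goodEvent {ρ c₁ cη a b : ℝ} {q r n jmax : ℕ}
    {T : ∀ J, KnotPartition (J - q)} {X : Fin n → ℝ} {η : ∀ J, Fin J → ℝ}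
    {Ω : ∀ J, Matrix (Fin J) (Fin J) ℝ} (hT : ∀ J, (T J).QuasiUniform ρ)
    (hset : ∀ J ∈ candidates q n jmax, PosteriorSetting ρ c₁ cη a b q r (T J) X (η J) (Ω J))
    (h : jmin q n ≤ jmax) (hn : 0 < n) (hq : 1 ≤ q) (hmin : 2 ≤ jmin q n)
    (hqj : (q : ℝ) ≤ jmin q n) {σ₀ τ δ R t α : ℝ} (hσ₀ : 0 < σ₀) (ht : 0 ≤ t) (hδ : 0 < δ)
    (hR : 0 ≤ R)
    (hprior : ∀ J ∈ candidates q n jmax,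
      priorConst ρ c₁ cη a b q r * (1 + R) * ((J : ℝ) / n) ≤ rate n J)
    (hvar : ∀ J ∈ candidates q n jmax,
      c₁⁻¹ * (coeffConst ρ cη q * (1 + R)) ^ 2 * ((J : ℝ) / n) ≤ σ₀ ^ 2)
    (hsmall : ∀ J ∈ candidates q n jmax,
      (biasConst ρ c₁ a b q r + (t + 1)) * rate n J ≤ σ₀ / 4)
    (hone : ∀ J ∈ candidates q n jmax, rate n J ≤ 1)
    (hτ : 8 * (biasConst ρ c₁ a b q r + (t + 1)) / σ₀ ≤ τ) (hα : α ∈ Ioc (0 : ℝ) q) {κ : ℕ}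
    (hκ2 : 2 ≤ κ)
    (hκ : biasConst ρ c₁ a b q r + τ * (2 * approxConst ρ q) +
      2 ^ (q + 1) * ((t + 1) + τ * (2 * σ₀)) < δ * (κ : ℝ) ^ α)
    {f₀ : ℝ → ℝ} (hf₀ : f₀ ∈ holderBall α R ∩ selfSimilar q ρ δ α) {Y : Fin n → ℝ}
    (hY : Y ∈ goodEvent q jmax T X Ω f₀ σ₀ t) :
    (oracleIndex q n jmax α f₀ : ℝ) / κ ≤ lepskiIndex q jmax T X η Ω τ Y ∧
      lepskiIndex q jmax T X η Ω τ Y ≤ oracleIndex q n jmax α f₀ := by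
  obtain ⟨hα0, hαq⟩ := hα
  have hf : holderENorm α f₀ ≠ ⊤ := ne_top_of_le_ne_top ENNReal.ofReal_ne_top hf₀.1
  have hL : (holderENorm α f₀).toReal ≤ R := by
    rw [← ENNReal.toReal_ofReal hR]
    exact ENNReal.toReal_mono ENNReal.ofReal_ne_top hf₀.1
  have hL0 : 0 ≤ (holderENorm α f₀).toReal := ENNReal.toReal_nonneg
  have hs := hset jmax (jmax_mem_candidates h)
  have hK := hs.biasConst_nonneg
  have hP := hs.priorConst_nonneg
  have hC := hs.coeffConst_nonneg
  have hA := hs.one_le_approxConst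
  have hc₁ := hs.c₁_pos
  have hτ0 : 0 ≤ τ := le_trans (by positivity) hτ
  have herr : ∀ J ∈ candidates q n jmax, ∀ x ∈ Icc (0 : ℝ) 1,
      |f₀ x - postMean q J (T J) X (η J) (Ω J) Y x| ≤
        biasConst ρ c₁ a b q r * ((holderENorm α f₀).toReal * (J : ℝ) ^ (-α))
          + (t + 1) * rate n J := by
    intro J hJ x hx
    have h1 := (hset J hJ).abs_sub_postMean_le hα0 hαq hf (hY.1 J hJ) hx
    have h2 : priorConst ρ c₁ cη a b q r * (1 + (holderENorm α f₀).toReal) * ((J : ℝ) / n) ≤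
        priorConst ρ c₁ cη a b q r * (1 + R) * ((J : ℝ) / n) := by gcongr
    have h3 := hprior J hJ
    linarith
  constructor
  · refine oracleIndex_div_le_lepskiIndex h hn hq hmin hqj hα0 hαq hτ0 (by linarith) hδ hT hf hf₀.2
      (fun J hJ => (hset J hJ).postMean_mem_splineSpace Y) herr (σ := 2 * σ₀)
      (A := 2 * approxConst ρ q) (by positivity) (by positivity) (fun J hJ => ?_) hone hκ2 hκ
    refine (hset J hJ).sigmaHat_le hα0 hαq hf hσ₀ hY.2.2 (le_trans ?_ (hvar J hJ))
    gcongr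
  · refine lepskiIndex_le_oracleIndex h (by linarith) hα0 hK herr (σ := σ₀ / 4)
      (fun J hJ he => (hset J hJ).le_sigmaHat hσ₀ hY.2.1 he) hsmall (by linarith) (by positivity) ?_
    -- The lower bound σ₀/4 on σ̂ and the factor 2 from the triangle inequality account for the 8 in
    -- the condition on τ.
    rw [div_le_iff₀ hσ₀] at hτ
    linarith

/-- A factor `κ` whose power `κ ^ α` exceeds `Γ / δ`. -/
def oracleFactor (Γ δ α : ℝ) : ℕ := ⌈(Γ / δ) ^ (1 / α)⌉₊ + 2

lemma two_le_oracleFactor (Γ δ α : ℝ) : 2 ≤ oracleFactor Γ δ α := by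
  rw [oracleFactor]; omega

lemma lt_mul_oracleFactor_rpow {Γ δ α : ℝ} (hΓ : 0 ≤ Γ) (hδ : 0 < δ) (hα : 0 < α) :
    Γ < δ * (oracleFactor Γ δ α : ℝ) ^ α := by
  have h0 : 0 ≤ Γ / δ := by positivity
  have h1 : (Γ / δ) ^ (1 / α) < oracleFactor Γ δ α := by
    rw [oracleFactor]
    push_cast
    linarith [Nat.le_ceil ((Γ / δ) ^ (1 / α))]
  have h2 := Real.rpow_lt_rpow (by positivity) h1 hα
  rw [← Real.rpow_mul h0, one_div_mul_cancel hα.ne', Real.rpow_one, div_lt_iff₀ hδ] at h2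
  linarith

end Conclusion

end

end BayesLepski

open BayesLepski in
theorem lemma5p3
    -- order of the B-splines
    (q : ℕ) (hq : 1 ≤ q)
    -- upper end point of the candidate set
    (jmax : ℕ → ℕ)
    (hjmax : ∀ᶠ n in atTop, BayesLepski.jmin q n ≤ (jmax n : ℝ))
    (hjmax' : (fun n => (jmax n : ℝ)) =o[atTop] fun n : ℕ => (n : ℝ) / Real.log n)
    -- quasi-uniform knots, `J - q` interior knots for `J` basis functions
    (ρ : ℝ) (T : ∀ _n J : ℕ, BayesLepski.KnotPartition (J - q))
    (hT : ∀ n J, (T n J).QuasiUniform ρ)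
    -- covariates close to a distribution with positive continuous density on `[0,1]`
    (φ : ℝ → ℝ) (hφ : ContinuousOn φ (Icc 0 1)) (hφpos : ∀ x ∈ Icc (0 : ℝ) 1, 0 < φ x)
    (hφint : ∫ t in (0 : ℝ)..1, φ t = 1)
    (X : ∀ n, Fin n → ℝ) (hX : ∀ n i, X n i ∈ Icc (0 : ℝ) 1)
    (hdesign : (fun n => BayesLepski.supNorm
        (fun x => BayesLepski.empiricalCDF (X n) x - ∫ t in (0 : ℝ)..x, φ t))
      =o[atTop] fun n => ((jmax n : ℝ))⁻¹)
    -- prior mean and prior covariance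
    (η : ∀ _n J : ℕ, Fin J → ℝ) (cη : ℝ) (hη : ∀ n J i, |η n J i| ≤ cη)
    (Ω : ∀ _n J : ℕ, Matrix (Fin J) (Fin J) ℝ) (hΩ : ∀ n J, (Ω n J).IsHermitian)
    (c₁ c₂ : ℝ) (hc₁ : 0 < c₁)
    (hΩeig : ∀ n J i, c₁ ≤ (hΩ n J).eigenvalues i ∧ (hΩ n J).eigenvalues i ≤ c₂)
    (r : ℕ) (hΩband : ∀ n J (i j : Fin J), (r : ℤ) < |(i : ℤ) - (j : ℤ)| → (Ω n J)⁻¹ i j = 0)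
    -- error standard deviation
    (σ₀ : ℝ) (hσ₀ : 0 < σ₀) :
    ∃ τ₀ > (0 : ℝ), ∀ τ ≥ τ₀, ∀ δ > (0 : ℝ),
      ∃ κ : ℝ → ℕ, (∀ α, 1 ≤ κ α) ∧ ∀ R > (0 : ℝ),
        (∃ μ > (1 : ℝ), ∃ Q > (0 : ℝ), ∃ C > (0 : ℝ), ∀ᶠ n in atTop,
          ∀ α ∈ Ioc (0 : ℝ) q,
            ∀ f₀ ∈ BayesLepski.holderBall α R ∩ BayesLepski.selfSimilar q ρ δ α,
              (BayesLepski.trueLaw (X n) f₀ σ₀).real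
                {Y | (BayesLepski.lepskiIndex q (jmax n) (T n) (X n) (η n) (Ω n) τ Y : ℝ)
                      < (BayesLepski.oracleIndex q n (jmax n) α f₀ : ℝ) / κ α}
                ≤ C * (1 / BayesLepski.jmin q n ^ (μ - 1)
                    + BayesLepski.oracleIndex q n (jmax n) α f₀
                      * Real.exp (-Q * BayesLepski.oracleIndex q n (jmax n) α f₀))) ∧
        Tendsto
          (fun n => ⨅ α ∈ Ioc (0 : ℝ) q,
            ⨅ f₀ ∈ BayesLepski.holderBall α R ∩ BayesLepski.selfSimilar q ρ δ α,
              BayesLepski.trueLaw (X n) f₀ σ₀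
                {Y | (BayesLepski.oracleIndex q n (jmax n) α f₀ : ℝ) / κ α
                        ≤ BayesLepski.lepskiIndex q (jmax n) (T n) (X n) (η n) (Ω n) τ Y ∧
                      BayesLepski.lepskiIndex q (jmax n) (T n) (X n) (η n) (Ω n) τ Y
                        ≤ BayesLepski.oracleIndex q n (jmax n) α f₀})
          atTop (𝓝 1) := by


  obtain ⟨a, b, hset⟩ := exists_posteriorSetting hq hjmax' hT hφ hφpos hX hdesign hη hΩ hc₁
    (fun n J i => (hΩeig n J i).1) hΩband
  -- One instance suffices to read off the signs of the constants.
  obtain ⟨n₀, hs₀⟩ : ∃ n, PosteriorSetting ρ c₁ cη a b q r (T n (jmax n)) (X n) (η n (jmax n))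
      (Ω n (jmax n)) := by
    obtain ⟨n, h1, h2⟩ := (hset.and hjmax).exists
    exact ⟨n, h1 _ (jmax_mem_candidates h2)⟩
  have ha := hs₀.a_pos
  have hK := hs₀.biasConst_nonneg
  have hA := hs₀.one_le_approxConst
  set K := biasConst ρ c₁ a b q r with hKdef
  set t := Real.sqrt (6 * σ₀ ^ 2 / a) with ht
  have ht0 : 0 ≤ t := Real.sqrt_nonneg _
  have hV := gaussianSqVariance_nonneg σ₀
  have hC : 0 < badConst σ₀ := by
    rw [badConst]
    positivity
  refine ⟨8 * (K + (t + 1)) / σ₀, by positivity, fun τ hτ δ hδ => ?_⟩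
  have hτ0 : 0 ≤ τ := le_trans (by positivity) hτ
  set Γ := K + τ * (2 * approxConst ρ q) + 2 ^ (q + 1) * ((t + 1) + τ * (2 * σ₀)) with hΓ
  have hΓ0 : 0 ≤ Γ := by positivity
  -- Γ does not involve R; the radius only affects how large n must be.
  refine ⟨oracleFactor Γ δ, fun α => one_le_two.trans (two_le_oracleFactor Γ δ α), fun R hR => ?_⟩
  have hjminto := tendsto_jmin q
  have hev : ∀ᶠ n in atTop, 1 ≤ jmin q n ∧ ∀ α ∈ Ioc (0 : ℝ) q,
      ∀ f₀ ∈ holderBall α R ∩ selfSimilar q ρ δ α,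
        (trueLaw (X n) f₀ σ₀).real
          (goodEvent q (jmax n) (T n) (X n) (Ω n) f₀ σ₀ t)ᶜ ≤ badConst σ₀ / jmin q n ∧
        ∀ Y ∈ goodEvent q (jmax n) (T n) (X n) (Ω n) f₀ σ₀ t,
          (oracleIndex q n (jmax n) α f₀ : ℝ) / oracleFactor Γ δ α ≤
              lepskiIndex q (jmax n) (T n) (X n) (η n) (Ω n) τ Y ∧
            lepskiIndex q (jmax n) (T n) (X n) (η n) (Ω n) τ Y ≤
              oracleIndex q n (jmax n) α f₀ := by
    -- The three thresholds serve the prior penalty in σ̂, the bound of the rate by 1, and errors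
    -- below σ₀/4.
    have hsm : 0 < min (σ₀ ^ 2) (min 1 (σ₀ / 4 / (K + (t + 1)))) := by positivity
    filter_upwards [hset, hjmax, eventually_jmax_le hjmax', eventually_gt_atTop 0,
      hjminto.eventually_ge_atTop 2, hjminto.eventually_ge_atTop (q : ℝ),
      eventually_rate_le hjmax' hsm,
      eventually_mul_le_rate hjmax' (priorConst ρ c₁ cη a b q r * (1 + R)),
      eventually_mul_le_rate hjmax' (c₁⁻¹ * (coeffConst ρ cη q * (1 + R)) ^ 2)]
      with n h1 h2 h3 h4 h5 h6 h7 h8 h9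
    refine ⟨by linarith, fun α hα f₀ hf₀ => ⟨?_, fun Y hY => ?_⟩⟩
    · refine trueLaw_compl_goodEvent_le h1 (by linarith) (h2.trans ?_) ha f₀ hσ₀
      exact_mod_cast h3
    · refine index_bounds_of_mem_goodEvent (hT n) h1 h2 h4 hq h5 h6 hσ₀ ht0 hδ hR.le h8
        (fun J hJ => (h9 J hJ).trans ((h7 J hJ).trans (min_le_left _ _)))
        (fun J hJ => ?_)
        (fun J hJ => (h7 J hJ).trans ((min_le_right _ _).trans (min_le_left _ _)))
        hτ hα (two_le_oracleFactor Γ δ α) (lt_mul_oracleFactor_rpow hΓ0 hδ hα.1) hf₀ hY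
      have h10 := (h7 J hJ).trans ((min_le_right _ _).trans (min_le_right _ _))
      rw [le_div_iff₀ (by positivity)] at h10
      linarith
  -- With μ = 2 the first term is 1/jmin, which alone covers the failure probability; the
  -- exponential term is just nonnegative.
  refine ⟨⟨2, one_lt_two, 1, one_pos, badConst σ₀, hC, ?_⟩, ?_⟩
  · filter_upwards [hev] with n hn α hα f₀ hf₀
    obtain ⟨h1, h2⟩ := hn.2 α hα f₀ hf₀
    refine (measureReal_mono (fun Y hY hgood => ?_)).trans (h1.trans ?_)
    · exact absurd (h2 Y hgood).1 (not_le.2 hY)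
    · rw [div_eq_mul_one_div]
      refine mul_le_mul_of_nonneg_left ?_ hC.le
      have e : (2 : ℝ) - 1 = 1 := by norm_num
      rw [e, Real.rpow_one]
      exact le_add_of_nonneg_right (by positivity)
  · have hlim : Tendsto (fun n => 1 - ENNReal.ofReal (badConst σ₀ / jmin q n)) atTop (𝓝 1) := by
      have h1 : Tendsto (fun n => ENNReal.ofReal (badConst σ₀ / jmin q n)) atTop (𝓝 0) := by
        have := ENNReal.tendsto_ofReal (hjminto.const_div_atTop (badConst σ₀))
        rwa [ENNReal.ofReal_zero] at this
      have h2 := ENNReal.Tendsto.sub (tendsto_const_nhds (x := (1 : ℝ≥0∞)) (f := atTop)) h1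
        (Or.inl ENNReal.one_ne_top)
      rwa [tsub_zero] at h2
    refine tendsto_of_tendsto_of_tendsto_of_le_of_le' hlim tendsto_const_nhds ?_ ?_
    · filter_upwards [hev] with n hn
      refine le_iInf₂ fun α hα => le_iInf₂ fun f₀ hf₀ => ?_
      obtain ⟨h1, h2⟩ := hn.2 α hα f₀ hf₀
      rw [tsub_le_iff_right]
      set G := goodEvent q (jmax n) (T n) (X n) (Ω n) f₀ σ₀ t with hG
      have h3 : (trueLaw (X n) f₀ σ₀) Gᶜ ≤ ENNReal.ofReal (badConst σ₀ / jmin q n) := by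
        rw [← ENNReal.ofReal_toReal (measure_ne_top _ Gᶜ)]
        exact ENNReal.ofReal_le_ofReal h1
      -- Subadditivity avoids any measurability question about the good event.
      have h4 : (1 : ℝ≥0∞) ≤ (trueLaw (X n) f₀ σ₀) G + (trueLaw (X n) f₀ σ₀) Gᶜ := by
        rw [← measure_univ (μ := trueLaw (X n) f₀ σ₀), ← union_compl_self G]
        exact measure_union_le _ _
      exact h4.trans (add_le_add (measure_mono fun Y hY => h2 Y hY) h3)
    · refine Eventually.of_forall fun n => ?_
      have hq0 : (q : ℝ) ∈ Ioc (0 : ℝ) q := ⟨by exact_mod_cast hq, le_rfl⟩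
      exact (iInf₂_le (q : ℝ) hq0).trans
        ((iInf₂_le (0 : ℝ → ℝ) (zero_mem_class q ρ δ q R)).trans prob_le_one)
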